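/- Let $\mathbb H$ be the quaternions and $\mathbb B$ its open unit ball. For $p=x+Iy$ with $I^2=-1$, write a slice function as $f(p)=\alpha(x,y)+I\beta(x,y)$, where $\alpha=\frac12(f(p)+f(\bar p))$, $\beta=\frac12 I(f(\bar p)-f(p))$; then $f\star g=(\alpha_f\alpha_g-\beta_f\beta_g)+I(\alpha_f\beta_g+\beta_f\alpha_g)$ (so $\sum p^nA_n\star\sum p^nB_n=\sum p^n\sum_{r\le n}A_rB_{n-r}$), and $h\star_r k=(k^*\star h^*)^*$ is the right product in the variable $\bar q$. For a square matrix, or an operator, $A$ put $(I-pA)^{-\star}=(I-\bar pA)(I-2\,\mathrm{Re}(p)A+|p|^2A^2)^{-1}$ wherever the last inverse exists (it equals $\sum p^nA^n$ for small $p$), and accordingly $C\star(I-pA)^{-\star}=(C-\bar pCA)(I-2\,\mathrm{Re}(p)A+|p|^2A^2)^{-1}$. A signature matrix is a matrix $J$ with $J=J^*=J^{-1}$; $\mathrm{sq}_-(X)$ is the number of strictly negative eigenvalues of a Hermitian matrix $X$, with multiplicity. A kernel has $\kappa$ negative squares if it is Hermitian and the Gram matrices $(c_\ell^*K(z_\ell,z_j)c_j)$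 have at most $\kappa$ strictly negative eigenvalues, with exactly $\kappa$ for some choice of points and vectors. Let $J_1\in\mathbb H^{M\times M}$ and $J_2\in\mathbb H^{N\times N}$ be signature matrices with $\mathrm{sq}_-(J_1)=\mathrm{sq}_-(J_2)$. An $\mathbb H^{N\times M}$-valued function $s$, (left) slice hyperholomorphic in an open neighborhood $V\subseteq\mathbb B$ of the origin, is a generalized Schur function on $V$ if the kernel $$K_s(p,q)=\sum_{\ell\ge0}p^\ell\,(J_2-s(p)J_1s(q)^*)\,\bar q^{\,\ell}$$ has a finite number $\kappa$ of negative squares on $V$. Let $\mathscr P(s)$ be the right reproducing kernel Pontryagin space of $\mathbb H^N$-valued functions on $V$ with reproducing kernel $K_s$. For $M=N$ and $J_1=J_2=J$, write $s\in\mathcal U_\kappa(J)$ on $V$ if moreover $K_s$ has exactly $\kappa$ negative squares on $V$ and $\mathscr P(s)$ is finite dimensional. **Theorem.** 1. Let $s$ be a generalized Schur function on $V$. Then $\mathscr P(s)$ is finite dimensional if and only if there exist a finite dimensional right quaternionic Pontryagin space $\mathscr P$ and a right linear operator $\begin{pmatrix}A&B\\C&D\end{pmatrix}:\mathscr P\oplus\mathbb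 H^M_{J_1}\to\mathscr P\oplus\mathbb H^N_{J_2}$ which is coisometric, that is, $$\begin{pmatrix}A&B\\C&D\end{pmatrix}\begin{pmatrix}I_{\mathscr P}&0\\0&J_1\end{pmatrix}\begin{pmatrix}A&B\\C&D\end{pmatrix}^*=\begin{pmatrix}I_{\mathscr P}&0\\0&J_2\end{pmatrix}$$ (the adjoint being taken with respect to $\mathscr P\oplus\mathbb H^M$ and $\mathscr P\oplus\mathbb H^N$, with the standard inner products on $\mathbb H^M,\mathbb H^N$), such that $$s(p)=D+p\,C\star(I-pA)^{-\star}B$$ for all $p\in V$ for which $(I-pA)^{-\star}$ is defined. (Existence and uniqueness of $\mathscr P(s)$ are known and are not part of the claim. Precisely: a finite dimensional right reproducing kernel Pontryagin space with kernel $K_s$ exists if and only if there is such a realization, and every right reproducing kernel Pontryagin space with kernel $K_s$ is finite dimensional if and only if there is such a realization.) 2. Let $J\in\mathbb H^{N\times N}$ be a signature matrix and $s$ an $\mathbb H^{N\times N}$-valued function. Then $s$ belongs to $\mathcal U_\kappa(J)$ on some open neighborhood $V\subseteq\mathbb B$ of the origin, for some $\kappa\ge0$, if and only if there are an $n\ge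 0$, matrices $A\in\mathbb H^{n\times n}$, $B\in\mathbb H^{n\times N}$, $C\in\mathbb H^{N\times n}$, $D\in\mathbb H^{N\times N}$ and a Hermitian matrix $H\in\mathbb H^{n\times n}$ with $$\begin{pmatrix}A&B\\C&D\end{pmatrix}\begin{pmatrix}H&0\\0&J\end{pmatrix}\begin{pmatrix}A&B\\C&D\end{pmatrix}^*=\begin{pmatrix}H&0\\0&J\end{pmatrix}$$ and $s(p)=D+p\,C\star(I-pA)^{-\star}B$ in a neighborhood of the origin. For a given $\kappa$, $s$ belongs to $\mathcal U_\kappa(J)$ on some such $V$ if and only if there is such a realization in which $\mathrm{sq}_-(H)=\kappa$ and the pair $(C,A)$ is observable, i.e. $\bigcap_{k\ge0}\ker CA^k=\{0\}$. 3. Let $J_1\in\mathbb H^{M\times M}$, $J_2\in\mathbb H^{N\times N}$, $H\in\mathbb H^{n\times n}$ and let $A,B,C,D$ be matrices of compatible sizes such that $$\begin{pmatrix}A&B\\C&D\end{pmatrix}\begin{pmatrix}H&0\\0&J_1\end{pmatrix}\begin{pmatrix}A&B\\C&D\end{pmatrix}^*=\begin{pmatrix}H&0\\0&J_2\end{pmatrix},$$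 and put $s(p)=D+p\,C\star(I-pA)^{-\star}B$. Then $$J_2-s(p)J_1s(q)^*=C\star(I-pA)^{-\star}\star(H-pH\bar q)\star_r\big((I-qA)^{-\star}\big)^*\star_r C^*$$ for all $p,q$ for which $(I-pA)^{-\star}$ and $(I-qA)^{-\star}$ are defined. -/

import Mathlib

open scoped Quaternion Matrix Topology

namespace QuatSchur

noncomputable section

/-! ## Slice hyperholomorphic functions and their star products -/

/-- The sphere of purely imaginary unit quaternions. -/
def imSphere : Set ℍ[ℝ] := {I | I.re = 0 ∧ ‖I‖ = 1}

/-- Left slice hyperholomorphic quaternion-valued functions on an (open) set `Ω`: real differentiable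
functions such that, on every slice `ℝ + Iℝ`, one has `(∂ₓ f + I ∂_y f) / 2 = 0`. -/
def SliceHyperholomorphicOn (f : ℍ[ℝ] → ℍ[ℝ]) (Ω : Set ℍ[ℝ]) : Prop :=
  DifferentiableOn ℝ f Ω ∧
    ∀ I ∈ imSphere, ∀ x y : ℝ, (x : ℍ[ℝ]) + y • I ∈ Ω →
      (1 / 2 : ℝ) • (fderiv ℝ f ((x : ℍ[ℝ]) + y • I) 1
        + I * fderiv ℝ f ((x : ℍ[ℝ]) + y • I) I) = 0

/-- Matrix-valued slice hyperholomorphic functions: all the entries are. -/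
def MatrixSliceHyperholomorphicOn {N M : ℕ} (f : ℍ[ℝ] → Matrix (Fin N) (Fin M) ℍ[ℝ])
    (Ω : Set ℍ[ℝ]) : Prop :=
  ∀ i j, SliceHyperholomorphicOn (fun p => f p i j) Ω

/-- The imaginary unit `I_p = Im p / |Im p|` of a nonreal quaternion (and `0` if `p` is real, in
which case it only multiplies quantities that vanish). -/
def imUnit (p : ℍ[ℝ]) : ℍ[ℝ] := ‖p.im‖⁻¹ • p.im

/-- The first slice component `α` of `f(x + Iy) = α(x,y) + I β(x,y)`. -/
def sliceFst {N M : ℕ} (f : ℍ[ℝ] → Matrix (Fin N) (Fin M) ℍ[ℝ]) (p : ℍ[ℝ]) :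
    Matrix (Fin N) (Fin M) ℍ[ℝ] :=
  (1 / 2 : ℝ) • (f p + f (star p))

/-- The second slice component `β` of `f(x + Iy) = α(x,y) + I β(x,y)`. -/
def sliceSnd {N M : ℕ} (f : ℍ[ℝ] → Matrix (Fin N) (Fin M) ℍ[ℝ]) (p : ℍ[ℝ]) :
    Matrix (Fin N) (Fin M) ℍ[ℝ] :=
  (1 / 2 : ℝ) • (imUnit p • (f (star p) - f p))

/-- The left star product: if `f = α + I β` and `g = α' + I β'`, then
`f ⋆ g = (α α' - β β') + I (α β' + β α')`.  On power series it sends `∑ pⁿ Aₙ` and `∑ pⁿ Bₙ` to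
`∑ pⁿ (∑ᵣ Aᵣ Bₙ₋ᵣ)`. -/
def starMul {N M L : ℕ} (f : ℍ[ℝ] → Matrix (Fin N) (Fin M) ℍ[ℝ])
    (g : ℍ[ℝ] → Matrix (Fin M) (Fin L) ℍ[ℝ]) (p : ℍ[ℝ]) : Matrix (Fin N) (Fin L) ℍ[ℝ] :=
  (sliceFst f p * sliceFst g p - sliceSnd f p * sliceSnd g p)
    + imUnit p • (sliceFst f p * sliceSnd g p + sliceSnd f p * sliceFst g p)

/-- The right star product with respect to the variable `q̄`, of functions (written as functions of
`q`) that are right slice hyperholomorphic in `q̄`: `h ⋆ᵣ k = (k* ⋆ h*)*`. On series, it sends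
`∑ Aₙ q̄ⁿ` and `∑ Bₙ q̄ⁿ` to `∑ (∑ᵣ Aᵣ Bₙ₋ᵣ) q̄ⁿ`. -/
def starMulRight {N M L : ℕ} (h : ℍ[ℝ] → Matrix (Fin N) (Fin M) ℍ[ℝ])
    (k : ℍ[ℝ] → Matrix (Fin M) (Fin L) ℍ[ℝ]) (q : ℍ[ℝ]) : Matrix (Fin N) (Fin L) ℍ[ℝ] :=
  (starMul (fun r => (k r)ᴴ) (fun r => (h r)ᴴ) q)ᴴ

/-- `I - 2 Re(p) A + |p|² A²`. -/
def pencil {n : ℕ} (A : Matrix (Fin n) (Fin n) ℍ[ℝ]) (p : ℍ[ℝ]) : Matrix (Fin n) (Fin n) ℍ[ℝ] :=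
  1 - (2 * p.re) • A + (‖p‖ ^ 2) • (A * A)

/-- `(I - pA)^{-⋆} = (I - p̄ A) (I - 2 Re(p) A + |p|² A²)⁻¹`, which is `∑ pⁿ Aⁿ` for small `p`;
meaningful when `pencil A p` is invertible. -/
def starResolvent {n : ℕ} (A : Matrix (Fin n) (Fin n) ℍ[ℝ]) (p : ℍ[ℝ]) :
    Matrix (Fin n) (Fin n) ℍ[ℝ] :=
  (1 - star p • A) * Ring.inverse (pencil A p)

/-- `D + p C ⋆ (I - pA)^{-⋆} B` for matrices. -/
def transferFunction {n N M : ℕ} (A : Matrix (Fin n) (Fin n) ℍ[ℝ]) (B : Matrix (Fin n) (Fin M) ℍ[ℝ])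
    (C : Matrix (Fin N) (Fin n) ℍ[ℝ]) (D : Matrix (Fin N) (Fin M) ℍ[ℝ]) (p : ℍ[ℝ]) :
    Matrix (Fin N) (Fin M) ℍ[ℝ] :=
  D + p • (starMul (fun _ => C) (starResolvent A) p * B)

/-- Observability of a pair of matrices: `⋂ₖ ker C Aᵏ = {0}`. -/
def Observable {n N : ℕ} (C : Matrix (Fin N) (Fin n) ℍ[ℝ]) (A : Matrix (Fin n) (Fin n) ℍ[ℝ]) : Prop :=
  ∀ v : Fin n → ℍ[ℝ], (∀ k : ℕ, (C * A ^ k) *ᵥ v = 0) → v = 0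

/-! ## Hermitian matrices and negative squares -/

/-- The right subspace of the `v` with `A v = v μ`, for a real number `μ`. -/
def realEigenspace {n : ℕ} (A : Matrix (Fin n) (Fin n) ℍ[ℝ]) (μ : ℝ) :
    Submodule ℍ[ℝ]ᵐᵒᵖ (Fin n → ℍ[ℝ]) where
  carrier := {v | A *ᵥ v = MulOpposite.op (μ : ℍ[ℝ]) • v}
  add_mem' := by
    intro v w hv hw
    simp only [Set.mem_ofPred_eq] at *
    rw [Matrix.mulVec_add, hv, hw, smul_add]
  zero_mem' := by simp
  smul_mem' := by
    intro c v hv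
    simp only [Set.mem_ofPred_eq] at *
    rw [Matrix.mulVec_smul, hv]
    ext1 i
    simp [mul_assoc, Quaternion.coe_commutes]

/-- The number of strictly negative eigenvalues of a Hermitian matrix, with multiplicities. -/
def sqNeg {n : ℕ} (A : Matrix (Fin n) (Fin n) ℍ[ℝ]) : ℕ :=
  Module.finrank ℍ[ℝ]ᵐᵒᵖ ↥(⨆ μ : {μ : ℝ // μ < 0}, realEigenspace A μ)

/-- Signature matrices: `J = J* = J⁻¹`. -/
def IsSignature {n : ℕ} (J : Matrix (Fin n) (Fin n) ℍ[ℝ]) : Prop :=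
  J.IsHermitian ∧ J * J = 1

/-- The kernel `K` has `κ` negative squares on `V`. -/
def HasNegativeSquares {N : ℕ} (K : ℍ[ℝ] → ℍ[ℝ] → Matrix (Fin N) (Fin N) ℍ[ℝ]) (V : Set ℍ[ℝ])
    (κ : ℕ) : Prop :=
  (∀ z ∈ V, ∀ w ∈ V, K z w = (K w z)ᴴ) ∧
  (∀ (n : ℕ) (z : Fin n → ℍ[ℝ]) (c : Fin n → Fin N → ℍ[ℝ]), (∀ l, z l ∈ V) →
    sqNeg (Matrix.of fun l j => star (c l) ⬝ᵥ (K (z l) (z j) *ᵥ c j)) ≤ κ) ∧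
  (∃ (n : ℕ) (z : Fin n → ℍ[ℝ]) (c : Fin n → Fin N → ℍ[ℝ]), (∀ l, z l ∈ V) ∧
    sqNeg (Matrix.of fun l j => star (c l) ⬝ᵥ (K (z l) (z j) *ᵥ c j)) = κ)

/-! ## Pontryagin spaces -/

/-- The subspace `W`, with the form `b`, is a right quaternionic Hilbert space. -/
def IsHilbertSubspace {P : Type*} [AddCommGroup P] [Module ℍ[ℝ]ᵐᵒᵖ P] (b : P → P → ℍ[ℝ])
    (W : Submodule ℍ[ℝ]ᵐᵒᵖ P) : Prop :=
  (∀ v ∈ W, v ≠ 0 → 0 < (b v v).re) ∧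
  ∀ u : ℕ → P, (∀ n, u n ∈ W) →
    (∀ ε : ℝ, 0 < ε → ∃ n₀, ∀ m ≥ n₀, ∀ n ≥ n₀, (b (u m - u n) (u m - u n)).re < ε) →
    ∃ v ∈ W, Filter.Tendsto (fun n => (b (u n - v) (u n - v)).re) Filter.atTop (𝓝 0)

/-- An indefinite inner product that makes `P` a right quaternionic Pontryagin space. -/
structure PontryaginForm (P : Type*) [AddCommGroup P] [Module ℍ[ℝ]ᵐᵒᵖ P] where
  form : P → P → ℍ[ℝ]
  add_left : ∀ u v w, form (u + v) w = form u w + form v w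
  smul_left : ∀ (a : ℍ[ℝ]) (v w : P), form (MulOpposite.op a • v) w = form v w * a
  conj_symm : ∀ v w, form w v = star (form v w)
  exists_fundamental_decomposition : ∃ Pp Pm : Submodule ℍ[ℝ]ᵐᵒᵖ P,
    IsCompl Pp Pm ∧ (∀ v ∈ Pp, ∀ w ∈ Pm, form v w = 0) ∧
    IsHilbertSubspace form Pp ∧ IsHilbertSubspace (fun v w => -form v w) Pm ∧
    Module.Finite ℍ[ℝ]ᵐᵒᵖ Pm

/-- The right quaternionic Pontryagin spaces of `ℍᴺ`-valued functions on `V` with reproducing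
kernel `K`. -/
structure ReproducingKernelPontryaginSpace {N : ℕ} (V : Set ℍ[ℝ])
    (K : ℍ[ℝ] → ℍ[ℝ] → Matrix (Fin N) (Fin N) ℍ[ℝ]) where
  carrier : Submodule ℍ[ℝ]ᵐᵒᵖ (V → Fin N → ℍ[ℝ])
  inner : PontryaginForm carrier
  kernel_mem : ∀ (q : V) (a : Fin N → ℍ[ℝ]), (fun p : V => K p q *ᵥ a) ∈ carrier
  reproducing : ∀ (f : carrier) (q : V) (a : Fin N → ℍ[ℝ]),
    inner.form f ⟨fun p : V => K p q *ᵥ a, kernel_mem q a⟩ = star a ⬝ᵥ (f : V → Fin N → ℍ[ℝ]) q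

/-! ## Generalized Schur functions -/

/-- `K_s(p,q) = ∑ pˡ (J₂ - s(p) J₁ s(q)*) q̄ˡ`. -/
def schurKernel {N M : ℕ} (J₂ : Matrix (Fin N) (Fin N) ℍ[ℝ]) (J₁ : Matrix (Fin M) (Fin M) ℍ[ℝ])
    (s : ℍ[ℝ] → Matrix (Fin N) (Fin M) ℍ[ℝ]) (p q : ℍ[ℝ]) : Matrix (Fin N) (Fin N) ℍ[ℝ] :=
  ∑' l : ℕ, p ^ l • (MulOpposite.op (star q ^ l) • (J₂ - s p * J₁ * (s q)ᴴ))

/-- `s` is a generalized Schur function on the open neighborhood `V` of the origin, in the class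
with `κ` negative squares. (`V` lies in the open unit ball, where the series for the kernel
converges.) -/
structure IsGeneralizedSchur {N M : ℕ} (J₂ : Matrix (Fin N) (Fin N) ℍ[ℝ])
    (J₁ : Matrix (Fin M) (Fin M) ℍ[ℝ]) (V : Set ℍ[ℝ]) (s : ℍ[ℝ] → Matrix (Fin N) (Fin M) ℍ[ℝ])
    (κ : ℕ) : Prop where
  signature_left : IsSignature J₂
  signature_right : IsSignature J₁
  sqNeg_eq : sqNeg J₁ = sqNeg J₂
  isOpen : IsOpen V
  zero_mem : (0 : ℍ[ℝ]) ∈ V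
  subset_ball : V ⊆ Metric.ball 0 1
  sliceHyperholomorphic : MatrixSliceHyperholomorphicOn s V
  negativeSquares : HasNegativeSquares (schurKernel J₂ J₁ s) V κ

/-- The class `U_κ(J)` on `V`: generalized Schur functions with `κ` negative squares, `J₁ = J₂ = J`,
whose reproducing kernel Pontryagin space is finite dimensional. -/
def IsJUnitaryClass {N : ℕ} (J : Matrix (Fin N) (Fin N) ℍ[ℝ]) (V : Set ℍ[ℝ])
    (s : ℍ[ℝ] → Matrix (Fin N) (Fin N) ℍ[ℝ]) (κ : ℕ) : Prop :=
  IsGeneralizedSchur J J V s κ ∧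
    ∃ R : ReproducingKernelPontryaginSpace V (schurKernel J J s), Module.Finite ℍ[ℝ]ᵐᵒᵖ R.carrier

/-! ## Realizations on a Pontryagin space -/

section Operators

variable {P : Type*} [AddCommGroup P] [Module ℍ[ℝ]ᵐᵒᵖ P]

/-- The operator `I - 2 Re(p) A + |p|² A²`. -/
def opPencil (A : P →ₗ[ℍ[ℝ]ᵐᵒᵖ] P) (p : ℍ[ℝ]) : P →ₗ[ℍ[ℝ]ᵐᵒᵖ] P where
  toFun x := x - MulOpposite.op ((2 * p.re : ℝ) : ℍ[ℝ]) • A x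
    + MulOpposite.op ((‖p‖ ^ 2 : ℝ) : ℍ[ℝ]) • A (A x)
  map_add' x y := by simp only [map_add, smul_add]; abel
  map_smul' c x := by
    have h : ∀ (r : ℝ) (y : P), MulOpposite.op (r : ℍ[ℝ]) • c • y
        = c • MulOpposite.op (r : ℍ[ℝ]) • y := by
      intro r y
      rw [smul_smul, smul_smul]
      congr 1
      apply MulOpposite.unop_injective
      simp [Quaternion.coe_commutes]
    simp only [map_smul, h, RingHom.id_apply, smul_add, smul_sub]

/-- `C ⋆ (I - pA)^{-⋆} = (C - p̄ C A) (I - 2 Re(p) A + |p|² A²)⁻¹`, which is `∑ pⁿ C Aⁿ` for small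
`p`; meaningful when `opPencil A p` is invertible. -/
def opStarResolvent {N : ℕ} (C : P →ₗ[ℍ[ℝ]ᵐᵒᵖ] (Fin N → ℍ[ℝ])) (A : P →ₗ[ℍ[ℝ]ᵐᵒᵖ] P) (p : ℍ[ℝ])
    (x : P) : Fin N → ℍ[ℝ] :=
  C (Ring.inverse (opPencil A p : Module.End ℍ[ℝ]ᵐᵒᵖ P) x)
    - star p • C (A (Ring.inverse (opPencil A p : Module.End ℍ[ℝ]ᵐᵒᵖ P) x))

/-- `s(p) = D + p C ⋆ (I - pA)^{-⋆} B` at all the points `p` of `V` where `I - pA` has a star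
inverse. (When `P` is finite dimensional, this leaves out at most finitely many spheres `[p]`, and
none near `0`.) -/
def IsOpRealizationOn {N M : ℕ} (V : Set ℍ[ℝ]) (s : ℍ[ℝ] → Matrix (Fin N) (Fin M) ℍ[ℝ])
    (A : P →ₗ[ℍ[ℝ]ᵐᵒᵖ] P) (B : (Fin M → ℍ[ℝ]) →ₗ[ℍ[ℝ]ᵐᵒᵖ] P)
    (C : P →ₗ[ℍ[ℝ]ᵐᵒᵖ] (Fin N → ℍ[ℝ])) (D : (Fin M → ℍ[ℝ]) →ₗ[ℍ[ℝ]ᵐᵒᵖ] (Fin N → ℍ[ℝ])) : Prop :=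
  ∀ p ∈ V, IsUnit (opPencil A p : Module.End ℍ[ℝ]ᵐᵒᵖ P) →
    ∀ u, s p *ᵥ u = D u + p • opStarResolvent C A p (B u)

/-- The inner product of the direct sum of a Pontryagin space and of `ℍᴺ` with its standard
inner product. -/
def sumForm {N : ℕ} (Φ : PontryaginForm P) (x y : P × (Fin N → ℍ[ℝ])) : ℍ[ℝ] :=
  Φ.form x.1 y.1 + star y.2 ⬝ᵥ x.2

/-- The operator `T` from `P ⊕ ℍᴹ` to `P ⊕ ℍᴺ` satisfies `T diag(I, J₁) T* = diag(I, J₂)`, that is,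
it is coisometric from `P ⊕ ℍᴹ_{J₁}` to `P ⊕ ℍᴺ_{J₂}`. -/
def IsCoisometric {N M : ℕ} (Φ : PontryaginForm P) (J₁ : Matrix (Fin M) (Fin M) ℍ[ℝ])
    (J₂ : Matrix (Fin N) (Fin N) ℍ[ℝ])
    (T : P × (Fin M → ℍ[ℝ]) →ₗ[ℍ[ℝ]ᵐᵒᵖ] P × (Fin N → ℍ[ℝ])) : Prop :=
  ∃ T' : P × (Fin N → ℍ[ℝ]) →ₗ[ℍ[ℝ]ᵐᵒᵖ] P × (Fin M → ℍ[ℝ]),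
    (∀ x y, sumForm Φ (T x) y = sumForm Φ x (T' y)) ∧
    ∀ y, T ((T' y).1, J₁ *ᵥ (T' y).2) = (y.1, J₂ *ᵥ y.2)

end Operators

/-- `s` has on `V` a realization with a coisometric colligation whose state space is a finite
dimensional right quaternionic Pontryagin space. -/
def HasFiniteCoisometricRealization {N M : ℕ} (J₂ : Matrix (Fin N) (Fin N) ℍ[ℝ])
    (J₁ : Matrix (Fin M) (Fin M) ℍ[ℝ]) (V : Set ℍ[ℝ])
    (s : ℍ[ℝ] → Matrix (Fin N) (Fin M) ℍ[ℝ]) : Prop :=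
  ∃ (P : Type) (_ : AddCommGroup P) (_ : Module ℍ[ℝ]ᵐᵒᵖ P) (Φ : PontryaginForm P)
    (A : P →ₗ[ℍ[ℝ]ᵐᵒᵖ] P) (B : (Fin M → ℍ[ℝ]) →ₗ[ℍ[ℝ]ᵐᵒᵖ] P)
    (C : P →ₗ[ℍ[ℝ]ᵐᵒᵖ] (Fin N → ℍ[ℝ])) (D : (Fin M → ℍ[ℝ]) →ₗ[ℍ[ℝ]ᵐᵒᵖ] (Fin N → ℍ[ℝ])),
    Module.Finite ℍ[ℝ]ᵐᵒᵖ P ∧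
    IsCoisometric Φ J₁ J₂ ((A.coprod B).prod (C.coprod D)) ∧
    IsOpRealizationOn V s A B C D

/-- `[A B; C D] diag(H, J₁) [A B; C D]* = diag(H, J₂)`. -/
def ColligationRelation {n N M : ℕ} (H : Matrix (Fin n) (Fin n) ℍ[ℝ])
    (J₁ : Matrix (Fin M) (Fin M) ℍ[ℝ]) (J₂ : Matrix (Fin N) (Fin N) ℍ[ℝ])
    (A : Matrix (Fin n) (Fin n) ℍ[ℝ]) (B : Matrix (Fin n) (Fin M) ℍ[ℝ])
    (C : Matrix (Fin N) (Fin n) ℍ[ℝ]) (D : Matrix (Fin N) (Fin M) ℍ[ℝ]) : Prop :=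
  Matrix.fromBlocks A B C D * Matrix.fromBlocks H 0 0 J₁ * (Matrix.fromBlocks A B C D)ᴴ
    = Matrix.fromBlocks H 0 0 J₂

end

end QuatSchur

/-! Put `E(p) = C ⋆ (I - pA)^{-⋆}`. The maps `E ↦ pE` and `E ↦ EA` commute, and `pencil` is the real
polynomial `(1 - p·A)(1 - p̄·A)` in them, so where it is invertible `E(p)` is the unique solution of
`E = C + pEA` (`starEval_eq`, `eq_starEval`). Expanding `J₂ - s(p) J₁ s(q)*` and using the four
block relations leaves `E(p) H E(q)* - p E(p) H E(q)* q̄` (`colligation_identity`). This is the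
identity of part 3, once its star products are unwound.

In the ball the Stein equation `X - p X q̄ = J₂ - s(p) J₁ s(q)*` has only one solution
(`eq_of_stein`), and `K_s` solves it. A realization therefore gives `K_s(p,q) = E(p) H E(q)*`, a
kernel of finite rank; by density and continuity the rank stays finite when some points of `V` have
a singular pencil (`finite_kernelSpan`). The span of the kernel functions then carries a
nondegenerate form and is a reproducing kernel Pontryagin space, and any other such space is finite
dimensional too. Gram matrices of `K_s` are congruences of `H`; if `(C, A)` is observable the
vectors `E(q)*c` span `ℍⁿ`, and Sylvester's law of inertia gives exactly `sqNeg H` negative squares.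

Conversely, let `P(s)` be finite dimensional, with kernel functions `k_q u = K_s(·,q)u`. The Stein
equation says that the pairs `((k_q q̄u, u), (k_q u, s(q)*u))` span an isometric relation from `P(s)
⊕ ℍᴺ` with `J₂` to `P(s) ⊕ ℍᴹ` with `J₁`. Its domain is everything, and the two spaces have equal
negative index because `sqNeg J₁ = sqNeg J₂`, so it is the graph of an isometry
(`exists_isometry_of_relation`). The adjoint of that isometry is a coisometric colligation acting as
the backward shift: `f(q) = Cf + q(Af)(q)` and `s(q)u = Du + q(Bu)(q)`. Solving the first equation
for `f(q)` gives the realization. In coordinates `H` is the inverse of the Gram matrix of `P(s)`. -/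

namespace QuatSchur

/-! ## Hermitian forms on right quaternionic vector spaces -/

section Forms

variable {P : Type*} [AddCommGroup P] [Module ℍ[ℝ]ᵐᵒᵖ P]

/-- A Hermitian form on a right quaternionic vector space, linear in the first variable. -/
structure IsHermForm (b : P → P → ℍ[ℝ]) : Prop where
  add_left : ∀ u v w, b (u + v) w = b u w + b v w
  smul_left : ∀ (a : ℍ[ℝ]) (v w : P), b (MulOpposite.op a • v) w = b v w * a
  conj_symm : ∀ v w, b w v = star (b v w)

theorem PontryaginForm.isHermForm (Φ : PontryaginForm P) : IsHermForm Φ.form :=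
  ⟨Φ.add_left, Φ.smul_left, Φ.conj_symm⟩

namespace IsHermForm

variable {b : P → P → ℍ[ℝ]} (hb : IsHermForm b)
include hb

theorem add_right (u v w : P) : b u (v + w) = b u v + b u w := by
  rw [hb.conj_symm, hb.add_left, star_add, ← hb.conj_symm, ← hb.conj_symm]

theorem smul_right (a : ℍ[ℝ]) (v w : P) : b v (MulOpposite.op a • w) = star a * b v w := by
  rw [hb.conj_symm, hb.smul_left, star_mul, ← hb.conj_symm]

/-- The form as a linear functional of its first variable. -/
noncomputable def functional (w : P) : P →ₗ[ℍ[ℝ]ᵐᵒᵖ] ℍ[ℝ] where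
  toFun v := b v w
  map_add' u v := hb.add_left u v w
  map_smul' a v := by
    obtain ⟨a, rfl⟩ := MulOpposite.op_surjective a
    simp [hb.smul_left]

theorem functional_apply (v w : P) : hb.functional w v = b v w := rfl

theorem zero_left (w : P) : b 0 w = 0 := map_zero (hb.functional w)

theorem zero_right (w : P) : b w 0 = 0 := by rw [hb.conj_symm, hb.zero_left, star_zero]

theorem neg_left (v w : P) : b (-v) w = -b v w := map_neg (hb.functional w) v

theorem sub_left (u v w : P) : b (u - v) w = b u w - b v w := map_sub (hb.functional w) u v

theorem neg_right (v w : P) : b v (-w) = -b v w := by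
  rw [hb.conj_symm, hb.neg_left, star_neg, ← hb.conj_symm]

theorem sub_right (u v w : P) : b u (v - w) = b u v - b u w := by
  rw [sub_eq_add_neg, hb.add_right, hb.neg_right, sub_eq_add_neg]

theorem sum_left {ι : Type*} (s : Finset ι) (f : ι → P) (w : P) :
    b (∑ i ∈ s, f i) w = ∑ i ∈ s, b (f i) w := map_sum (hb.functional w) f s

theorem sum_right {ι : Type*} (s : Finset ι) (f : ι → P) (w : P) :
    b w (∑ i ∈ s, f i) = ∑ i ∈ s, b w (f i) := by
  rw [hb.conj_symm, hb.sum_left, star_sum]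
  exact Finset.sum_congr rfl fun i _ => (hb.conj_symm _ _).symm

theorem self_eq_re (v : P) : b v v = ((b v v).re : ℍ[ℝ]) :=
  (Quaternion.star_eq_self.mp (hb.conj_symm v v).symm)

theorem eq_zero_symm {v w : P} (h : b v w = 0) : b w v = 0 := by
  rw [hb.conj_symm, h, star_zero]

theorem re_symm (v w : P) : (b v w).re = (b w v).re := by
  rw [hb.conj_symm w v, Quaternion.re_star]

theorem neg : IsHermForm (fun v w => -b v w) where
  add_left u v w := by rw [hb.add_left, neg_add]
  smul_left a v w := by rw [hb.smul_left, neg_mul]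
  conj_symm v w := by rw [hb.conj_symm, star_neg]

theorem restrict (W : Submodule ℍ[ℝ]ᵐᵒᵖ P) : IsHermForm (fun v w : W => b v w) where
  add_left _ _ _ := hb.add_left _ _ _
  smul_left _ _ _ := hb.smul_left _ _ _
  conj_symm _ _ := hb.conj_symm _ _

/-- The vectors orthogonal to a given subspace. -/
def orthogonal (W : Submodule ℍ[ℝ]ᵐᵒᵖ P) : Submodule ℍ[ℝ]ᵐᵒᵖ P where
  carrier := {v | ∀ w ∈ W, b v w = 0}
  add_mem' {u v} hu hv w hw := by rw [hb.add_left, hu w hw, hv w hw, add_zero]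
  zero_mem' w _ := hb.zero_left w
  smul_mem' a v hv w hw := by
    obtain ⟨a, rfl⟩ := MulOpposite.op_surjective a
    rw [hb.smul_left, hv w hw, zero_mul]

theorem eq_zero_of_span {s : Set P} {v : P} (h : ∀ w ∈ s, b v w = 0) {w : P}
    (hw : w ∈ Submodule.span ℍ[ℝ]ᵐᵒᵖ s) : b v w = 0 := by
  induction hw using Submodule.span_induction with
  | mem x hx => exact h x hx
  | zero => exact hb.zero_right v
  | add x y _ _ hx hy => rw [hb.add_right, hx, hy, add_zero]
  | smul a x _ hx =>
    obtain ⟨a, rfl⟩ := MulOpposite.op_surjective a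
    rw [hb.smul_right, hx, mul_zero]

/-- The linear map `v ↦ (b v wᵢ)ᵢ`. -/
noncomputable def pairing {n : ℕ} (w : Fin n → P) : P →ₗ[ℍ[ℝ]ᵐᵒᵖ] (Fin n → ℍ[ℝ]) :=
  LinearMap.pi fun i => hb.functional (w i)

theorem pairing_apply {n : ℕ} (w : Fin n → P) (v : P) (i : Fin n) :
    hb.pairing w v i = b v (w i) := rfl

end IsHermForm

/-- The quaternions as a one-dimensional right vector space. -/
noncomputable def opLinearEquivSelf : ℍ[ℝ]ᵐᵒᵖ ≃ₗ[ℍ[ℝ]ᵐᵒᵖ] ℍ[ℝ] where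
  toFun := MulOpposite.unop
  invFun := MulOpposite.op
  left_inv _ := rfl
  right_inv _ := rfl
  map_add' _ _ := rfl
  map_smul' a x := by simp

/-- Coordinates with respect to a basis of a right quaternionic vector space. -/
noncomputable def coordEquiv {n : ℕ} (e : Module.Basis (Fin n) ℍ[ℝ]ᵐᵒᵖ P) :
    P ≃ₗ[ℍ[ℝ]ᵐᵒᵖ] (Fin n → ℍ[ℝ]) :=
  e.equivFun.trans (LinearEquiv.piCongrRight fun _ => opLinearEquivSelf)

theorem sum_coordEquiv {n : ℕ} (e : Module.Basis (Fin n) ℍ[ℝ]ᵐᵒᵖ P) (v : P) :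
    ∑ i, MulOpposite.op (coordEquiv e v i) • e i = v := e.sum_equivFun v

instance finite_pi (n : ℕ) : Module.Finite ℍ[ℝ]ᵐᵒᵖ (Fin n → ℍ[ℝ]) :=
  Module.Finite.equiv (LinearEquiv.piCongrRight fun _ : Fin n => opLinearEquivSelf)

theorem finrank_pi (n : ℕ) : Module.finrank ℍ[ℝ]ᵐᵒᵖ (Fin n → ℍ[ℝ]) = n := by
  rw [← (LinearEquiv.piCongrRight fun _ : Fin n => opLinearEquivSelf).finrank_eq]
  simp

namespace IsHermForm

variable {b : P → P → ℍ[ℝ]} (hb : IsHermForm b)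
include hb

/-- A finite dimensional subspace with trivial orthogonal complement is the whole space. -/
theorem finite_and_eq_top_of_orthogonal (W : Submodule ℍ[ℝ]ᵐᵒᵖ P) [Module.Finite ℍ[ℝ]ᵐᵒᵖ W]
    (h : ∀ v, (∀ w ∈ W, b v w = 0) → v = 0) : Module.Finite ℍ[ℝ]ᵐᵒᵖ P ∧ W = ⊤ := by
  set e := Module.finBasis ℍ[ℝ]ᵐᵒᵖ W
  set f := hb.pairing fun i => (e i : P)
  -- The kernel of `f` is the orthogonal complement of `W`. Injectivity embeds `P` in `ℍ^{dim W}`,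
  -- which bounds its dimension by that of `W`.
  have hf : Function.Injective f := by
    rw [injective_iff_map_eq_zero]
    refine fun v hv => h v fun w hw => ?_
    have : w ∈ Submodule.span ℍ[ℝ]ᵐᵒᵖ (Set.range fun i => (e i : P)) := by
      have h1 := congrArg (Submodule.map W.subtype) e.span_eq
      rw [Submodule.map_span, ← Set.range_comp, Submodule.map_top, Submodule.range_subtype] at h1
      exact h1.symm ▸ hw
    refine hb.eq_zero_of_span ?_ this
    rintro _ ⟨i, rfl⟩
    exact congrFun hv i
  have hfin : Module.Finite ℍ[ℝ]ᵐᵒᵖ P := Module.Finite.of_injective f hf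
  refine ⟨hfin, Submodule.eq_top_of_finrank_eq (le_antisymm (Submodule.finrank_le W) ?_)⟩
  simpa [finrank_pi] using LinearMap.finrank_le_finrank_of_injective hf

/-- The Riesz representation of linear functionals by a nondegenerate form. -/
theorem exists_riesz [Module.Finite ℍ[ℝ]ᵐᵒᵖ P] (h : ∀ v, (∀ w, b v w = 0) → v = 0)
    (φ : P →ₗ[ℍ[ℝ]ᵐᵒᵖ] ℍ[ℝ]) : ∃ y, ∀ x, φ x = b x y := by
  set e := Module.finBasis ℍ[ℝ]ᵐᵒᵖ P
  set f := hb.pairing fun i => e i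
  have hf : Function.Injective f := by
    rw [injective_iff_map_eq_zero]
    refine fun v hv => h v fun w => ?_
    refine hb.eq_zero_of_span ?_ (e.mem_span w)
    rintro _ ⟨i, rfl⟩
    exact congrFun hv i
  -- The pairing puts `y` in the linear slot, while the representing vector belongs in the
  -- conjugate-linear one; hence the conjugated target.
  obtain ⟨y, hy⟩ := (LinearMap.injective_iff_surjective_of_finrank_eq_finrank
    (by rw [finrank_pi])).mp hf fun i => star (φ (e i))
  refine ⟨y, fun x => ?_⟩
  have : φ = hb.functional y := by
    refine e.ext fun i => ?_
    rw [functional_apply, hb.conj_symm, ← hb.pairing_apply (fun i => e i), hy, star_star]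
  rw [this, functional_apply]

/-- Orthogonal projection on a nondegenerate subspace. -/
theorem exists_projection (W : Submodule ℍ[ℝ]ᵐᵒᵖ P) [Module.Finite ℍ[ℝ]ᵐᵒᵖ W]
    (h : ∀ v ∈ W, (∀ w ∈ W, b v w = 0) → v = 0) (v : P) :
    ∃ w ∈ W, v - w ∈ hb.orthogonal W := by
  obtain ⟨y, hy⟩ := (hb.restrict W).exists_riesz
    (fun v hv => Subtype.ext (h v v.2 fun w hw => hv ⟨w, hw⟩)) ((hb.functional v).comp W.subtype)
  refine ⟨y, y.2, fun w hw => ?_⟩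
  have := hy ⟨w, hw⟩
  simp only [LinearMap.comp_apply, Submodule.subtype_apply, functional_apply] at this
  apply hb.eq_zero_symm
  rw [hb.sub_right, this, sub_self]

/-- Degenerate Cauchy–Schwarz: moving `w` along the neutral direction `v` changes the quadratic form
affinely in the real parameter `t`, and an affine function bounded below has slope zero. -/
theorem eq_zero_of_nonneg (h : ∀ v, 0 ≤ (b v v).re) {v : P} (hv : (b v v).re = 0) (w : P) :
    b v w = 0 := by
  by_contra hne
  have hpos : 0 < Quaternion.normSq (b v w) := by
    rcases (Quaternion.normSq_nonneg (a := b v w)).lt_or_eq with h1 | h1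
    · exact h1
    · exact absurd (Quaternion.normSq_eq_zero.mp h1.symm) hne
  have key : ∀ t : ℝ, 0 ≤ (b w w).re - 2 * t * Quaternion.normSq (b v w) := by
    intro t
    have h1 := h (w + MulOpposite.op (-(t : ℍ[ℝ]) * star (b v w)) • v)
    have h2 : (b v w * (-(t : ℍ[ℝ]) * star (b v w))).re = -(t * Quaternion.normSq (b v w)) := by
      rw [neg_mul, mul_neg, ← mul_assoc, ← Quaternion.coe_commutes, mul_assoc,
        Quaternion.self_mul_star, ← Quaternion.coe_mul, Quaternion.re_neg, Quaternion.re_coe]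
    have h3 : b v v = 0 := by rw [hb.self_eq_re, hv, Quaternion.coe_zero]
    simp only [hb.add_left, hb.add_right, Quaternion.re_add] at h1
    rw [hb.re_symm w (_ • v), hb.smul_left, hb.smul_left, h2, hb.smul_right, h3] at h1
    simp only [mul_zero, zero_mul, Quaternion.re_zero] at h1
    linarith
  -- This `t` makes the affine function equal to `-1`.
  have := key (((b w w).re + 1) / (2 * Quaternion.normSq (b v w)))
  field_simp at this
  linarith

end IsHermForm

end Forms

/-! ### Fundamental decompositions, negative index and adjoints -/

section Decomposition

variable {P : Type*} [AddCommGroup P] [Module ℍ[ℝ]ᵐᵒᵖ P] {b : P → P → ℍ[ℝ]}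

/-- A finite dimensional subspace on which a form is positive definite is a Hilbert space. -/
theorem IsHermForm.isHilbertSubspace (hb : IsHermForm b) (W : Submodule ℍ[ℝ]ᵐᵒᵖ P)
    [Module.Finite ℍ[ℝ]ᵐᵒᵖ W] (h : ∀ v ∈ W, v ≠ 0 → 0 < (b v v).re) : IsHilbertSubspace b W := by
  refine ⟨h, fun u hu hc => ?_⟩
  -- The real part of `b` is an inner product on `W` seen as a finite dimensional real space, where
  -- completeness is automatic.
  let : Module ℝ W := Module.compHom W (algebraMap ℝ ℍ[ℝ]ᵐᵒᵖ)
  have hsm : ∀ (r : ℝ) (v : W), r • v = MulOpposite.op (r : ℍ[ℝ]) • v := fun r v => rfl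
  have : IsScalarTower ℝ ℍ[ℝ]ᵐᵒᵖ W := ⟨fun r a v => by
    rw [hsm, smul_smul, Algebra.smul_def]; rfl⟩
  have : Module.Finite ℝ ℍ[ℝ]ᵐᵒᵖ :=
    Module.Finite.equiv (MulOpposite.opLinearEquiv ℝ : ℍ[ℝ] ≃ₗ[ℝ] ℍ[ℝ]ᵐᵒᵖ)
  have : Module.Finite ℝ W := Module.Finite.trans ℍ[ℝ]ᵐᵒᵖ W
  let core : InnerProductSpace.Core ℝ W :=
    { inner := fun x y => (b x y).re
      conj_inner_symm := fun x y => by simpa using hb.re_symm _ _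
      re_inner_nonneg := fun x => by
        by_cases hx : (x : P) = 0
        · simp [hx, hb.zero_left]
        · exact (h x x.2 hx).le
      add_left := fun x y z => by simp [hb.add_left]
      smul_left := fun x y r => by
        simp only [hsm, Submodule.coe_smul, hb.smul_left]
        simp [← Quaternion.coe_commutes]
      definite := fun x hx => by
        by_contra hne
        exact (h x x.2 (fun h0 => hne (Subtype.ext h0))).ne' hx }
  let : NormedAddCommGroup W := core.toNormedAddCommGroup
  let : InnerProductSpace ℝ W := InnerProductSpace.ofCore core.toCore
  have : CompleteSpace W := FiniteDimensional.complete ℝ W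
  have hn : ∀ x : W, (b x x).re = ‖x‖ ^ 2 := fun x =>
    (real_inner_self_eq_norm_sq x)
  let w : ℕ → W := fun n => ⟨u n, hu n⟩
  have hw : CauchySeq w := by
    rw [Metric.cauchySeq_iff]
    intro ε hε
    obtain ⟨n₀, hn₀⟩ := hc (ε ^ 2) (by positivity)
    refine ⟨n₀, fun m hm n hn' => ?_⟩
    have := hn₀ m hm n hn'
    rw [show u m - u n = ((w m - w n : W) : P) from rfl, hn] at this
    rw [dist_eq_norm]
    exact lt_of_pow_lt_pow_left₀ 2 hε.le this
  obtain ⟨v, hv⟩ := cauchySeq_tendsto_of_complete hw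
  refine ⟨v, v.2, ?_⟩
  have h1 : Filter.Tendsto (fun n => ‖w n - v‖ ^ 2) Filter.atTop (𝓝 0) := by
    have := (tendsto_iff_norm_sub_tendsto_zero.mp hv).pow 2
    simpa using this
  refine h1.congr fun n => ?_
  rw [← hn]
  rfl

theorem finrank_le_of_disjoint [Module.Finite ℍ[ℝ]ᵐᵒᵖ P] {W Pp Pm : Submodule ℍ[ℝ]ᵐᵒᵖ P}
    (hc : Pp ⊔ Pm = ⊤) (hd : Disjoint W Pp) :
    Module.finrank ℍ[ℝ]ᵐᵒᵖ W ≤ Module.finrank ℍ[ℝ]ᵐᵒᵖ Pm := by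
  have h2 := Submodule.finrank_sup_add_finrank_inf_eq W Pp
  have h3 := Submodule.finrank_sup_add_finrank_inf_eq Pp Pm
  have h4 := Submodule.finrank_le (W ⊔ Pp)
  rw [hd.eq_bot, finrank_bot] at h2
  rw [hc, finrank_top] at h3
  omega

/-- A subspace on which the form is nonpositive is no larger than the negative part of a
decomposition. -/
theorem finrank_le_of_nonpos [Module.Finite ℍ[ℝ]ᵐᵒᵖ P] {W Pp Pm : Submodule ℍ[ℝ]ᵐᵒᵖ P}
    (hc : Pp ⊔ Pm = ⊤) (hp : ∀ v ∈ Pp, v ≠ 0 → 0 < (b v v).re) (hW : ∀ v ∈ W, (b v v).re ≤ 0) :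
    Module.finrank ℍ[ℝ]ᵐᵒᵖ W ≤ Module.finrank ℍ[ℝ]ᵐᵒᵖ Pm := by
  refine finrank_le_of_disjoint hc (Submodule.disjoint_def.mpr fun v hvW hvp => ?_)
  by_contra hne
  exact absurd (hp v hvp hne) (not_lt.mpr (hW v hvW))

/-- A subspace on which the form is negative definite is no larger than a complement of a
nonnegative subspace. -/
theorem finrank_le_of_neg [Module.Finite ℍ[ℝ]ᵐᵒᵖ P] {W Pp Pm : Submodule ℍ[ℝ]ᵐᵒᵖ P}
    (hc : Pp ⊔ Pm = ⊤) (hp : ∀ v ∈ Pp, 0 ≤ (b v v).re)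
    (hW : ∀ v ∈ W, v ≠ 0 → (b v v).re < 0) :
    Module.finrank ℍ[ℝ]ᵐᵒᵖ W ≤ Module.finrank ℍ[ℝ]ᵐᵒᵖ Pm := by
  refine finrank_le_of_disjoint hc (Submodule.disjoint_def.mpr fun v hvW hvp => ?_)
  by_contra hne
  exact absurd (hW v hvW hne) (not_lt.mpr (hp v hvp))

theorem IsHermForm.re_smul_self (hb : IsHermForm b) (a : ℍ[ℝ]) (v : P) :
    (b (MulOpposite.op a • v) (MulOpposite.op a • v)).re = Quaternion.normSq a * (b v v).re := by
  rw [hb.smul_left, hb.smul_right, hb.self_eq_re, ← Quaternion.coe_commutes, mul_assoc,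
    Quaternion.star_mul_self, ← Quaternion.coe_mul, Quaternion.re_coe, mul_comm, Quaternion.re_coe]

theorem IsHermForm.re_add_self_of_orthogonal (hb : IsHermForm b) {v w : P} (h : b v w = 0) :
    (b (v + w) (v + w)).re = (b v v).re + (b w w).re := by
  simp [hb.add_left, hb.add_right, h, hb.eq_zero_symm h]

/-- A nondegenerate form on a finite dimensional space has a fundamental decomposition. -/
theorem IsHermForm.exists_decomposition (hb : IsHermForm b) [Module.Finite ℍ[ℝ]ᵐᵒᵖ P]
    (h : ∀ v, (∀ w, b v w = 0) → v = 0) : ∃ Pp Pm : Submodule ℍ[ℝ]ᵐᵒᵖ P,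
    IsCompl Pp Pm ∧ (∀ v ∈ Pp, ∀ w ∈ Pm, b v w = 0) ∧ (∀ v ∈ Pp, v ≠ 0 → 0 < (b v v).re) ∧
      (∀ v ∈ Pm, v ≠ 0 → (b v v).re < 0) := by
  obtain ⟨Pm, hPm, hmax⟩ := exists_maximal_of_wellFoundedGT
    (P := fun W : Submodule ℍ[ℝ]ᵐᵒᵖ P => ∀ v ∈ W, v ≠ 0 → (b v v).re < 0)
    ⟨⊥, fun v hv hne => absurd ((Submodule.mem_bot _).mp hv) hne⟩
  have hproj := hb.exists_projection Pm fun v hv h0 => by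
    by_contra hne
    simpa [h0 v hv] using hPm v hv hne
  -- A negative vector orthogonal to `Pm` could be adjoined to it, against maximality.
  have hnn : ∀ v ∈ hb.orthogonal Pm, 0 ≤ (b v v).re := by
    intro v hv
    by_contra! hneg
    have hle := hmax (y := Pm ⊔ Submodule.span ℍ[ℝ]ᵐᵒᵖ {v}) (by
      intro x hx hne
      obtain ⟨w, hw, y, hy, rfl⟩ := Submodule.mem_sup.mp hx
      obtain ⟨a, rfl⟩ := Submodule.mem_span_singleton.mp hy
      obtain ⟨a, rfl⟩ := MulOpposite.op_surjective a
      rw [hb.re_add_self_of_orthogonal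
        (hb.eq_zero_symm (by rw [hb.smul_left, hv w hw, zero_mul])), hb.re_smul_self]
      by_cases hw0 : w = 0
      · have ha : a ≠ 0 := by
          rintro rfl
          simp [hw0] at hne
        have := lt_of_le_of_ne (Quaternion.normSq_nonneg (a := a))
          (Ne.symm (mt Quaternion.normSq_eq_zero.mp ha))
        rw [hw0, hb.zero_left, Quaternion.re_zero]
        nlinarith
      · have := hPm w hw hw0
        have := Quaternion.normSq_nonneg (a := a)
        nlinarith) le_sup_left
    have hvm : v ∈ Pm := hle (Submodule.mem_sup_right (Submodule.mem_span_singleton_self v))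
    simp [hv v hvm] at hneg
  -- A neutral vector of the complement is orthogonal to the complement by Cauchy–Schwarz and to
  -- `Pm` by definition, hence to the whole space.
  have hpos : ∀ v ∈ hb.orthogonal Pm, v ≠ 0 → 0 < (b v v).re := by
    intro v hv hne
    refine lt_of_le_of_ne (hnn v hv) fun h0 => hne (h v fun w => ?_)
    obtain ⟨y, hy, hwy⟩ := hproj w
    have h1 := (hb.restrict (hb.orthogonal Pm)).eq_zero_of_nonneg (fun x => hnn x x.2)
      (v := ⟨v, hv⟩) h0.symm ⟨w - y, hwy⟩
    rw [show w = (w - y) + y by abel, hb.add_right, hv y hy, add_zero]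
    exact h1
  refine ⟨hb.orthogonal Pm, Pm, ⟨?_, ?_⟩, fun v hv => hv, hpos, hPm⟩
  · rw [Submodule.disjoint_def]
    intro v hv hvm
    by_contra hne
    simpa [hv v hvm] using hPm v hvm hne
  · rw [codisjoint_iff, Submodule.eq_top_iff']
    intro v
    obtain ⟨y, hy, hvy⟩ := hproj v
    rw [show v = (v - y) + y by abel]
    exact Submodule.add_mem_sup hvy hy

/-- A nondegenerate form makes a finite dimensional space a Pontryagin space. -/
noncomputable def IsHermForm.pontryaginForm (hb : IsHermForm b) [Module.Finite ℍ[ℝ]ᵐᵒᵖ P]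
    (h : ∀ v, (∀ w, b v w = 0) → v = 0) : PontryaginForm P where
  form := b
  add_left := hb.add_left
  smul_left := hb.smul_left
  conj_symm := hb.conj_symm
  exists_fundamental_decomposition := by
    obtain ⟨Pp, Pm, hc, ho, hp, hm⟩ := hb.exists_decomposition h
    exact ⟨Pp, Pm, hc, ho, hb.isHilbertSubspace Pp hp,
      hb.neg.isHilbertSubspace Pm fun v hv hne => by simpa using hm v hv hne, inferInstance⟩

theorem PontryaginForm.nondegenerate (Φ : PontryaginForm P) (v : P)
    (hv : ∀ w, Φ.form v w = 0) : v = 0 := by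
  obtain ⟨Pp, Pm, hc, ho, hp, hm, -⟩ := Φ.exists_fundamental_decomposition
  have hb := Φ.isHermForm
  have hmem : v ∈ Pp ⊔ Pm := by rw [hc.sup_eq_top]; trivial
  obtain ⟨x, hx, y, hy, rfl⟩ := Submodule.mem_sup.mp hmem
  have h1 : Φ.form x x = 0 := by
    simpa [hb.add_left, hb.eq_zero_symm (ho x hx y hy)] using hv x
  have h2 : Φ.form y y = 0 := by simpa [hb.add_left, ho x hx y hy] using hv y
  have hx0 : x = 0 := by
    by_contra hne
    simpa [h1] using hp.1 x hx hne
  have hy0 : y = 0 := by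
    by_contra hne
    simpa [h2] using hm.1 y hy hne
  rw [hx0, hy0, add_zero]

/-- Adjoints of linear maps between finite dimensional nondegenerate spaces. -/
theorem IsHermForm.exists_adjoint {Q : Type*} [AddCommGroup Q] [Module ℍ[ℝ]ᵐᵒᵖ Q]
    {c : Q → Q → ℍ[ℝ]} (hb : IsHermForm b) (hc : IsHermForm c) [Module.Finite ℍ[ℝ]ᵐᵒᵖ P]
    (h : ∀ v, (∀ w, b v w = 0) → v = 0) (T : P →ₗ[ℍ[ℝ]ᵐᵒᵖ] Q) :
    ∃ T' : Q →ₗ[ℍ[ℝ]ᵐᵒᵖ] P, ∀ x y, b (T' x) y = c x (T y) := by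
  have hr : ∀ x, ∃ z, ∀ y, c (T y) x = b y z := fun x =>
    hb.exists_riesz h ((hc.functional x).comp T)
  choose f hf using hr
  have hf' : ∀ x y, b (f x) y = c x (T y) := fun x y => by
    rw [hb.conj_symm, ← hf, ← hc.conj_symm]
  have huniq : ∀ x y, (∀ w, b x w = b y w) → x = y := fun x y hxy =>
    sub_eq_zero.mp (h _ fun w => by rw [hb.sub_left, hxy, sub_self])
  refine ⟨{ toFun := f, map_add' := fun x y => huniq _ _ fun w => ?_,
            map_smul' := fun a x => huniq _ _ fun w => ?_ }, hf'⟩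
  · rw [hb.add_left, hf', hf', hf', hc.add_left]
  · obtain ⟨a, rfl⟩ := MulOpposite.op_surjective a
    rw [RingHom.id_apply, hb.smul_left, hf', hf', hc.smul_left]

end Decomposition

/-! ### Spectral theorem and law of inertia for quaternionic Hermitian matrices -/

section Spectral

/-- The standard sesquilinear form of a quaternionic matrix. -/
noncomputable def matForm {n : ℕ} (G : Matrix (Fin n) (Fin n) ℍ[ℝ]) (v w : Fin n → ℍ[ℝ]) : ℍ[ℝ] :=
  star w ⬝ᵥ (G *ᵥ v)

theorem re_sum {ι : Type*} (s : Finset ι) (f : ι → ℍ[ℝ]) :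
    (∑ i ∈ s, f i).re = ∑ i ∈ s, (f i).re :=
  map_sum (QuaternionAlgebra.reₗ (-1 : ℝ) 0 (-1)) f s

theorem star_dotProduct_star {n : ℕ} (v w : Fin n → ℍ[ℝ]) : star (star v ⬝ᵥ w) = star w ⬝ᵥ v := by
  simp [dotProduct, star_sum]

theorem dotProduct_op_smul {n : ℕ} (v w : Fin n → ℍ[ℝ]) (a : ℍ[ℝ]) :
    v ⬝ᵥ (MulOpposite.op a • w) = (v ⬝ᵥ w) * a := by
  simp [dotProduct, Finset.sum_mul, mul_assoc]

theorem star_dotProduct_mulVec {n m : ℕ} (B : Matrix (Fin n) (Fin m) ℍ[ℝ]) (v : Fin n → ℍ[ℝ])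
    (w : Fin m → ℍ[ℝ]) : star v ⬝ᵥ (B *ᵥ w) = star (Bᴴ *ᵥ v) ⬝ᵥ w := by
  rw [Matrix.dotProduct_mulVec, Matrix.star_mulVec, Matrix.conjTranspose_conjTranspose]

theorem isHermForm_matForm {n : ℕ} {G : Matrix (Fin n) (Fin n) ℍ[ℝ]} (hG : G.IsHermitian) :
    IsHermForm (matForm G) where
  add_left u v w := by simp [matForm, Matrix.mulVec_add, dotProduct_add]
  smul_left a v w := by rw [matForm, Matrix.mulVec_smul, dotProduct_op_smul, matForm]
  conj_symm v w := by
    rw [matForm, matForm, star_dotProduct_star, star_dotProduct_mulVec, hG.eq]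

theorem dotProduct_star_self_eq {n : ℕ} (v : Fin n → ℍ[ℝ]) :
    star v ⬝ᵥ v = ((∑ i, Quaternion.normSq (v i) : ℝ) : ℍ[ℝ]) := by
  simp only [dotProduct, Pi.star_apply, Quaternion.star_mul_self]
  exact (map_sum (algebraMap ℝ ℍ[ℝ]) _ _).symm

theorem sum_normSq_pos {n : ℕ} {v : Fin n → ℍ[ℝ]} (hv : v ≠ 0) :
    0 < ∑ i, Quaternion.normSq (v i) := by
  obtain ⟨i, hi⟩ := Function.ne_iff.mp hv
  exact Finset.sum_pos' (fun _ _ => Quaternion.normSq_nonneg) ⟨i, Finset.mem_univ i,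
    lt_of_le_of_ne Quaternion.normSq_nonneg (Ne.symm (mt Quaternion.normSq_eq_zero.mp hi))⟩

variable {n : ℕ} {G : Matrix (Fin n) (Fin n) ℍ[ℝ]}

theorem mem_realEigenspace {μ : ℝ} {v : Fin n → ℍ[ℝ]} :
    v ∈ realEigenspace G μ ↔ G *ᵥ v = MulOpposite.op (μ : ℍ[ℝ]) • v := Iff.rfl

theorem matForm_of_mem_realEigenspace {μ : ℝ} {v : Fin n → ℍ[ℝ]} (hv : v ∈ realEigenspace G μ)
    (w : Fin n → ℍ[ℝ]) : matForm G v w = star w ⬝ᵥ v * (μ : ℍ[ℝ]) := by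
  rw [matForm, mem_realEigenspace.mp hv, dotProduct_op_smul]

theorem matForm_realEigenspace_ne (hG : G.IsHermitian) {μ ν : ℝ} (hne : μ ≠ ν)
    {v w : Fin n → ℍ[ℝ]} (hv : v ∈ realEigenspace G μ) (hw : w ∈ realEigenspace G ν) :
    matForm G v w = 0 := by
  have h1 := matForm_of_mem_realEigenspace hv w
  have h2 := matForm_of_mem_realEigenspace hw v
  rw [(isHermForm_matForm hG).conj_symm, h1, star_mul, star_dotProduct_star, Quaternion.star_coe,
    Quaternion.coe_commutes, ← sub_eq_zero, ← mul_sub, ← Quaternion.coe_sub, mul_eq_zero] at h2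
  rcases h2 with h2 | h2
  · rw [h1, ← star_dotProduct_star, h2, star_zero, zero_mul]
  · exact absurd (by simpa [sub_eq_zero] using h2) hne

/-- Quaternionic Hermitian matrices are diagonalizable, with real eigenvalues. -/
theorem iSup_realEigenspace_eq_top (hG : G.IsHermitian) : ⨆ μ : ℝ, realEigenspace G μ = ⊤ := by
  -- Viewed on `ℝ^{4n}`, `G` is a real symmetric operator, so the real spectral theorem applies. Its
  -- eigenspaces are right quaternionic because real eigenvalues are central.
  let T : PiLp 2 (fun _ : Fin n => ℍ[ℝ]) →ₗ[ℝ] PiLp 2 (fun _ : Fin n => ℍ[ℝ]) :=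
    { toFun := fun v => WithLp.toLp 2 (G *ᵥ v.ofLp)
      map_add' := fun v w => by simp [Matrix.mulVec_add]
      map_smul' := fun r v => by simp [Matrix.mulVec_smul] }
  have hin : ∀ v w : PiLp 2 (fun _ : Fin n => ℍ[ℝ]),
      inner ℝ v w = (star v.ofLp ⬝ᵥ w.ofLp).re := by
    intro v w
    simp only [PiLp.inner_apply, Quaternion.inner_def, dotProduct]
    rw [re_sum]
    refine Finset.sum_congr rfl fun i _ => ?_
    simp only [Pi.star_apply, Quaternion.re_mul, Quaternion.re_star, Quaternion.imI_star,
      Quaternion.imJ_star, Quaternion.imK_star]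
    ring
  have hT : T.IsSymmetric := by
    intro v w
    rw [hin, hin]
    change (star (G *ᵥ v.ofLp) ⬝ᵥ w.ofLp).re = (star v.ofLp ⬝ᵥ (G *ᵥ w.ofLp)).re
    rw [star_dotProduct_mulVec, hG.eq]
  have htop : ⨆ μ, Module.End.eigenspace T μ = ⊤ :=
    Submodule.orthogonal_eq_bot_iff.mp hT.orthogonalComplement_iSup_eigenspaces_eq_bot
  rw [Submodule.eq_top_iff']
  intro v
  have hv : WithLp.toLp 2 v ∈ ⨆ μ, Module.End.eigenspace T μ := htop ▸ Submodule.mem_top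
  suffices ∀ x ∈ ⨆ μ, Module.End.eigenspace T μ, x.ofLp ∈ ⨆ μ : ℝ, realEigenspace G μ from
    this _ hv
  intro x hx
  induction hx using Submodule.iSup_induction' with
  | mem μ x hx =>
    refine Submodule.mem_iSup_of_mem μ (mem_realEigenspace.mpr ?_)
    have := congrArg WithLp.ofLp (Module.End.mem_eigenspace_iff.mp hx)
    change G *ᵥ x.ofLp = μ • x.ofLp at this
    rw [this]
    ext1 i
    simp [← Quaternion.coe_commutes, Quaternion.coe_mul_eq_smul]
  | zero => exact Submodule.zero_mem _
  | add x y _ _ hx hy => exact Submodule.add_mem _ hx hy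

theorem matForm_sum_realEigenspace (hG : G.IsHermitian) {ι : Type*} {μ : ι → ℝ}
    (hμ : Function.Injective μ) (s : Finset ι) {f : ι → Fin n → ℍ[ℝ]}
    (hf : ∀ i, f i ∈ realEigenspace G (μ i)) :
    (matForm G (∑ i ∈ s, f i) (∑ i ∈ s, f i)).re =
      ∑ i ∈ s, μ i * ∑ k, Quaternion.normSq (f i k) := by
  have hb := isHermForm_matForm hG
  rw [hb.sum_left, re_sum]
  refine Finset.sum_congr rfl fun i hi => ?_
  rw [hb.sum_right, Finset.sum_eq_single_of_mem i hi fun j _ hj =>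
    matForm_realEigenspace_ne hG (hμ.ne hj.symm) (hf i) (hf j),
    matForm_of_mem_realEigenspace (hf i), dotProduct_star_self_eq, ← Quaternion.coe_mul,
    Quaternion.re_coe, mul_comm]

/-- The weights `c i` are the squared norms of the components of `v` in the mutually orthogonal
eigenspaces, so the sign of the form can be read from the signs of the eigenvalues. -/
theorem matForm_iSup_realEigenspace (hG : G.IsHermitian) {ι : Type*} {μ : ι → ℝ}
    (hμ : Function.Injective μ) {v : Fin n → ℍ[ℝ]} (hv : v ∈ ⨆ i, realEigenspace G (μ i)) :
    ∃ (s : Finset ι) (c : ι → ℝ), (∀ i, 0 ≤ c i) ∧ (matForm G v v).re = ∑ i ∈ s, μ i * c i ∧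
      (v ≠ 0 → ∃ i ∈ s, 0 < c i) := by
  obtain ⟨f, hf, rfl⟩ := (Submodule.mem_iSup_iff_exists_finsupp _ _).mp hv
  refine ⟨f.support, fun i => ∑ k, Quaternion.normSq (f i k), fun i =>
    Finset.sum_nonneg fun _ _ => Quaternion.normSq_nonneg,
    matForm_sum_realEigenspace hG hμ _ hf, fun hne => ?_⟩
  obtain ⟨i, hi, hi0⟩ := Finset.exists_ne_zero_of_sum_ne_zero hne
  exact ⟨i, hi, sum_normSq_pos hi0⟩

theorem matForm_neg_of_mem (hG : G.IsHermitian) {v : Fin n → ℍ[ℝ]}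
    (hv : v ∈ ⨆ μ : {μ : ℝ // μ < 0}, realEigenspace G μ) (hne : v ≠ 0) :
    (matForm G v v).re < 0 := by
  obtain ⟨s, c, hc, heq, hpos⟩ := matForm_iSup_realEigenspace hG Subtype.val_injective hv
  obtain ⟨i, hi, hi0⟩ := hpos hne
  rw [heq]
  exact Finset.sum_neg' (fun j _ => mul_nonpos_of_nonpos_of_nonneg j.2.le (hc j))
    ⟨i, hi, mul_neg_of_neg_of_pos i.2 hi0⟩

theorem matForm_nonneg_of_mem (hG : G.IsHermitian) {v : Fin n → ℍ[ℝ]}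
    (hv : v ∈ ⨆ μ : {μ : ℝ // 0 ≤ μ}, realEigenspace G μ) : 0 ≤ (matForm G v v).re := by
  obtain ⟨s, c, hc, heq, -⟩ := matForm_iSup_realEigenspace hG Subtype.val_injective hv
  rw [heq]
  exact Finset.sum_nonneg fun j _ => mul_nonneg j.2 (hc j)

theorem iSup_nonneg_sup_iSup_neg (hG : G.IsHermitian) :
    (⨆ μ : {μ : ℝ // 0 ≤ μ}, realEigenspace G μ) ⊔ (⨆ μ : {μ : ℝ // μ < 0}, realEigenspace G μ)
      = ⊤ := by
  rw [eq_top_iff, ← iSup_realEigenspace_eq_top hG]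
  refine iSup_le fun μ => ?_
  rcases lt_or_ge μ 0 with h | h
  · exact le_sup_of_le_right (le_iSup (fun μ : {μ : ℝ // μ < 0} => realEigenspace G μ) ⟨μ, h⟩)
  · exact le_sup_of_le_left (le_iSup (fun μ : {μ : ℝ // 0 ≤ μ} => realEigenspace G μ) ⟨μ, h⟩)

/-- Negative definite subspaces have dimension at most `sqNeg`. -/
theorem finrank_le_sqNeg (hG : G.IsHermitian) {W : Submodule ℍ[ℝ]ᵐᵒᵖ (Fin n → ℍ[ℝ])}
    (hW : ∀ v ∈ W, v ≠ 0 → (matForm G v v).re < 0) : Module.finrank ℍ[ℝ]ᵐᵒᵖ W ≤ sqNeg G :=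
  finrank_le_of_neg (iSup_nonneg_sup_iSup_neg hG) (fun _ hv => matForm_nonneg_of_mem hG hv) hW

/-- A quaternionic matrix as a right linear map. -/
noncomputable def mulVecRight {m n : ℕ} (B : Matrix (Fin n) (Fin m) ℍ[ℝ]) :
    (Fin m → ℍ[ℝ]) →ₗ[ℍ[ℝ]ᵐᵒᵖ] (Fin n → ℍ[ℝ]) where
  toFun v := B *ᵥ v
  map_add' := Matrix.mulVec_add B
  map_smul' a v := Matrix.mulVec_smul B a v

theorem mulVecRight_apply {m n : ℕ} (B : Matrix (Fin n) (Fin m) ℍ[ℝ]) (v : Fin m → ℍ[ℝ]) :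
    mulVecRight B v = B *ᵥ v := rfl

theorem matForm_congr {m : ℕ} (B : Matrix (Fin n) (Fin m) ℍ[ℝ]) (v w : Fin m → ℍ[ℝ]) :
    matForm (Bᴴ * G * B) v w = matForm G (B *ᵥ v) (B *ᵥ w) := by
  rw [matForm, ← Matrix.mulVec_mulVec, ← Matrix.mulVec_mulVec, star_dotProduct_mulVec,
    Matrix.conjTranspose_conjTranspose, matForm]

theorem isHermitian_congr {m : ℕ} (hG : G.IsHermitian) (B : Matrix (Fin n) (Fin m) ℍ[ℝ]) :
    (Bᴴ * G * B).IsHermitian := by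
  rw [Matrix.IsHermitian, Matrix.conjTranspose_mul, Matrix.conjTranspose_mul, hG.eq,
    Matrix.conjTranspose_conjTranspose, Matrix.mul_assoc]

/-- A Hermitian matrix that factors as `Bᴴ G B` has no more negative squares than `G`. -/
theorem sqNeg_congr_le {m : ℕ} (hG : G.IsHermitian) (B : Matrix (Fin n) (Fin m) ℍ[ℝ]) :
    sqNeg (Bᴴ * G * B) ≤ sqNeg G := by
  have hB := isHermitian_congr hG B
  set W := ⨆ μ : {μ : ℝ // μ < 0}, realEigenspace (Bᴴ * G * B) μ with hW
  have hneg : ∀ v ∈ W, v ≠ 0 → (matForm G (B *ᵥ v) (B *ᵥ v)).re < 0 := fun v hv hne => by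
    rw [← matForm_congr]
    exact matForm_neg_of_mem hB hv hne
  have hinj : Function.Injective ((mulVecRight B).comp W.subtype) := by
    rw [injective_iff_map_eq_zero]
    intro v hv
    by_contra hne
    have h1 := hneg v v.2 fun h0 => hne (Subtype.ext h0)
    rw [show B *ᵥ (v : Fin m → ℍ[ℝ]) = 0 from hv, (isHermForm_matForm hG).zero_left] at h1
    simp at h1
  rw [sqNeg, ← hW, ← LinearMap.finrank_range_of_inj hinj]
  refine finrank_le_sqNeg hG ?_
  rintro _ ⟨v, rfl⟩ hne
  refine hneg v v.2 fun h0 => hne ?_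
  rw [LinearMap.comp_apply, Submodule.subtype_apply, h0, map_zero]

/-- Sylvester's law for surjective `B`: a linear section of `B` carries the negative eigenspaces of
`G` injectively to a subspace on which `Bᴴ G B` is negative definite. -/
theorem sqNeg_congr_eq {m : ℕ} (hG : G.IsHermitian) (B : Matrix (Fin n) (Fin m) ℍ[ℝ])
    (hB : Function.Surjective (mulVecRight B)) : sqNeg (Bᴴ * G * B) = sqNeg G := by
  refine le_antisymm (sqNeg_congr_le hG B) ?_
  obtain ⟨σ, hσ⟩ := (mulVecRight B).exists_rightInverse_of_surjective
    (LinearMap.range_eq_top.mpr hB)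
  have hσ' : ∀ v, B *ᵥ σ v = v := fun v => LinearMap.congr_fun hσ v
  have hinj : Function.Injective σ := Function.LeftInverse.injective hσ'
  set W := ⨆ μ : {μ : ℝ // μ < 0}, realEigenspace G μ with hW
  rw [sqNeg, ← hW, (Submodule.equivMapOfInjective σ hinj W).finrank_eq]
  refine finrank_le_sqNeg (isHermitian_congr hG B) ?_
  rintro _ ⟨v, hv, rfl⟩ hne
  rw [matForm_congr, hσ']
  exact matForm_neg_of_mem hG hv fun h0 => hne (by rw [h0, map_zero])

theorem matForm_nondegenerate (hu : IsUnit G) (v : Fin n → ℍ[ℝ])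
    (hv : ∀ w, matForm G v w = 0) : v = 0 := by
  have h0 : G *ᵥ v = 0 := by
    by_contra hne
    have h1 := hv (G *ᵥ v)
    rw [matForm, dotProduct_star_self_eq] at h1
    exact (sum_normSq_pos hne).ne' (by simpa using congrArg (fun x : ℍ[ℝ] => x.re) h1)
  obtain ⟨u, rfl⟩ := hu
  rw [← Matrix.one_mulVec v, ← u.inv_mul, ← Matrix.mulVec_mulVec, h0, Matrix.mulVec_zero]

/-- Definite decomposition of `ℍⁿ` for an invertible Hermitian matrix. -/
theorem exists_decomposition_sqNeg (hG : G.IsHermitian) (hu : IsUnit G) :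
    ∃ Pp Pm : Submodule ℍ[ℝ]ᵐᵒᵖ (Fin n → ℍ[ℝ]), Pp ⊔ Pm = ⊤ ∧
      (∀ v ∈ Pp, v ≠ 0 → 0 < (matForm G v v).re) ∧
      (∀ v ∈ Pm, v ≠ 0 → (matForm G v v).re < 0) ∧ Module.finrank ℍ[ℝ]ᵐᵒᵖ Pm = sqNeg G := by
  obtain ⟨Pp, Pm, hc, -, hp, hm⟩ :=
    (isHermForm_matForm hG).exists_decomposition (matForm_nondegenerate hu)
  exact ⟨Pp, Pm, hc.sup_eq_top, hp, hm, le_antisymm (finrank_le_sqNeg hG hm)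
    (finrank_le_of_nonpos hc.sup_eq_top hp fun v hv => by
      by_cases h0 : v = 0
      · rw [h0, (isHermForm_matForm hG).zero_left, Quaternion.re_zero]
      · exact (matForm_neg_of_mem hG hv h0).le)⟩

end Spectral

/-! ### Slice components and star products -/

section Star

/-- Left multiplication by the imaginary unit of `p`, as a real linear map. -/
noncomputable def imMul {N M : ℕ} (p : ℍ[ℝ]) :
    Matrix (Fin N) (Fin M) ℍ[ℝ] →ₗ[ℝ] Matrix (Fin N) (Fin M) ℍ[ℝ] where
  toFun A := imUnit p • A
  map_add' := smul_add _
  map_smul' _ _ := smul_comm _ _ _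

theorem imUnit_smul {N M : ℕ} (p : ℍ[ℝ]) (A : Matrix (Fin N) (Fin M) ℍ[ℝ]) :
    imUnit p • A = imMul p A := rfl

theorem imMul_mul {N M L : ℕ} (p : ℍ[ℝ]) (A : Matrix (Fin N) (Fin M) ℍ[ℝ])
    (B : Matrix (Fin M) (Fin L) ℍ[ℝ]) : imMul p A * B = imMul p (A * B) :=
  Matrix.smul_mul _ _ _

/-- Real points are included: there both sides vanish. -/
theorem norm_im_smul_imUnit (p : ℍ[ℝ]) : ‖p.im‖ • imUnit p = p.im := by
  by_cases h : p.im = 0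
  · simp [imUnit, h]
  · rw [imUnit, smul_smul, mul_inv_cancel₀ (norm_ne_zero_iff.mpr h), one_smul]

/-- Writing left multiplication by `p` as a real combination of the identity and `imMul p` reduces
star product identities to real linear algebra. -/
theorem smul_eq_imMul {N M : ℕ} (p : ℍ[ℝ]) (A : Matrix (Fin N) (Fin M) ℍ[ℝ]) :
    p • A = p.re • A + ‖p.im‖ • imMul p A := by
  rw [← imUnit_smul, ← smul_assoc, norm_im_smul_imUnit]
  conv_lhs => rw [← Quaternion.re_add_im p, add_smul]
  congr 1
  ext1 i j
  simp [Quaternion.coe_mul_eq_smul]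

theorem star_smul_eq_imMul {N M : ℕ} (p : ℍ[ℝ]) (A : Matrix (Fin N) (Fin M) ℍ[ℝ]) :
    star p • A = p.re • A - ‖p.im‖ • imMul p A := by
  have h : star p = (2 * p.re) • (1 : ℍ[ℝ]) - p := by
    rw [Quaternion.star_eq_two_re_sub, ← Algebra.algebraMap_eq_smul_one]
    rfl
  rw [h, sub_smul, smul_assoc, one_smul, smul_eq_imMul]
  module

/-- At real `p` the imaginary unit has the default value `0`, whose square is not `-1`; the
hypothesis makes `A` vanish exactly there. -/
theorem imMul_imMul {N M : ℕ} {p : ℍ[ℝ]} (A : Matrix (Fin N) (Fin M) ℍ[ℝ])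
    (h : p.im = 0 → A = 0) : imMul p (imMul p A) = -A := by
  by_cases hp : p.im = 0
  · simp [h hp]
  · have h1 : imUnit p * imUnit p = -1 := by
      have h2 : p.im * p.im = -((‖p.im‖ ^ 2 : ℝ) : ℍ[ℝ]) := by
        rw [← sq, Quaternion.im_sq, Quaternion.normSq_eq_norm_mul_self, sq]
      rw [imUnit, smul_mul_smul_comm, h2, ← mul_inv, smul_neg, ← sq, ← Quaternion.coe_smul,
        smul_eq_mul, inv_mul_cancel₀ (pow_ne_zero 2 (norm_ne_zero_iff.mpr hp)), Quaternion.coe_one]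
    rw [← imUnit_smul, ← imUnit_smul, smul_smul, h1, neg_one_smul]

/-- `a` and `b` are the slice components of `f` at `p`. -/
structure IsSlicePair {N M : ℕ} (f : ℍ[ℝ] → Matrix (Fin N) (Fin M) ℍ[ℝ]) (p : ℍ[ℝ])
    (a b : Matrix (Fin N) (Fin M) ℍ[ℝ]) : Prop where
  apply_eq : f p = a + imMul p b
  apply_star : f (star p) = a - imMul p b
  snd_eq_zero : p.im = 0 → b = 0

namespace IsSlicePair

variable {N M L : ℕ} {p : ℍ[ℝ]} {f : ℍ[ℝ] → Matrix (Fin N) (Fin M) ℍ[ℝ]}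
  {a b : Matrix (Fin N) (Fin M) ℍ[ℝ]}

theorem sliceFst_eq (h : IsSlicePair f p a b) : sliceFst f p = a := by
  rw [sliceFst, h.apply_eq, h.apply_star]
  module

theorem sliceSnd_eq (h : IsSlicePair f p a b) : sliceSnd f p = b := by
  rw [sliceSnd, h.apply_eq, h.apply_star, imUnit_smul,
    show a - imMul p b - (a + imMul p b) = (-2 : ℝ) • imMul p b by module, map_smul,
    imMul_imMul b h.snd_eq_zero]
  module

theorem const (A : Matrix (Fin N) (Fin M) ℍ[ℝ]) : IsSlicePair (fun _ => A) p A 0 :=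
  ⟨by simp, by simp, fun _ => rfl⟩

theorem starMul_eq (h : IsSlicePair f p a b) {g : ℍ[ℝ] → Matrix (Fin M) (Fin L) ℍ[ℝ]}
    {c d : Matrix (Fin M) (Fin L) ℍ[ℝ]} (hg : IsSlicePair g p c d) :
    starMul f g p = (a * c - b * d) + imMul p (a * d + b * c) := by
  rw [starMul, h.sliceFst_eq, h.sliceSnd_eq, hg.sliceFst_eq, hg.sliceSnd_eq, imUnit_smul]

theorem norm_im_smul (b : Matrix (Fin N) (Fin M) ℍ[ℝ]) (hp : p.im = 0) : ‖p.im‖ • b = 0 := by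
  simp [hp]

/-- `K₀ - p K₁` -/
theorem affine (K₀ K₁ : Matrix (Fin N) (Fin M) ℍ[ℝ]) :
    IsSlicePair (fun r => K₀ - r • K₁) p (K₀ - p.re • K₁) (-(‖p.im‖ • K₁)) where
  apply_eq := by
    rw [smul_eq_imMul, map_neg, map_smul]; module
  apply_star := by
    rw [star_smul_eq_imMul, map_neg, map_smul]; module
  snd_eq_zero hp := by rw [norm_im_smul _ hp, neg_zero]

/-- `f ⋆ (K₀ - p K₁)` -/
theorem starMul_affine (h : IsSlicePair f p a b) (K₀ K₁ : Matrix (Fin M) (Fin L) ℍ[ℝ]) :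
    starMul f (fun r => K₀ - r • K₁) p = f p * K₀ - p • (f p * K₁) := by
  have hb : imMul p (imMul p (b * K₁)) = -(b * K₁) :=
    imMul_imMul _ fun hp => by rw [h.snd_eq_zero hp, Matrix.zero_mul]
  rw [h.starMul_eq (affine K₀ K₁), h.apply_eq, smul_eq_imMul]
  simp only [Matrix.mul_sub, Matrix.mul_neg, Matrix.mul_smul, Matrix.add_mul, imMul_mul, map_add,
    map_sub, map_neg, map_smul, hb]
  module

theorem mul_affine (h : IsSlicePair f p a b) (K₀ K₁ : Matrix (Fin M) (Fin L) ℍ[ℝ]) :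
    IsSlicePair (fun r => f r * K₀ - r • (f r * K₁)) p
      (a * K₀ - p.re • (a * K₁) + ‖p.im‖ • (b * K₁))
      (b * K₀ - p.re • (b * K₁) - ‖p.im‖ • (a * K₁)) := by
  have hb : imMul p (imMul p (b * K₁)) = -(b * K₁) :=
    imMul_imMul _ fun hp => by rw [h.snd_eq_zero hp, Matrix.zero_mul]
  refine ⟨?_, ?_, fun hp => ?_⟩
  · rw [h.apply_eq, smul_eq_imMul]
    simp only [Matrix.add_mul, imMul_mul, map_add, map_sub, map_smul, hb]
    module
  · rw [h.apply_star, star_smul_eq_imMul]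
    simp only [Matrix.sub_mul, imMul_mul, map_sub, map_smul, hb]
    module
  · rw [h.snd_eq_zero hp, norm_im_smul _ hp]; simp

theorem const_starMul (h : IsSlicePair f p a b) (C : Matrix (Fin L) (Fin N) ℍ[ℝ]) :
    starMul (fun _ => C) f p = C * a + imMul p (C * b) := by
  rw [(const C).starMul_eq h]; simp

/-- `C ⋆ (f K₀ - p f K₁) = (C ⋆ f) K₀ - p (C ⋆ f) K₁`. -/
theorem const_starMul_mul_affine {L' : ℕ} (h : IsSlicePair f p a b)
    (C : Matrix (Fin L') (Fin N) ℍ[ℝ]) (K₀ K₁ : Matrix (Fin M) (Fin L) ℍ[ℝ]) :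
    starMul (fun _ => C) (fun r => f r * K₀ - r • (f r * K₁)) p =
      starMul (fun _ => C) f p * K₀ - p • (starMul (fun _ => C) f p * K₁) := by
  have hb : imMul p (imMul p (C * (b * K₁))) = -(C * (b * K₁)) :=
    imMul_imMul _ fun hp => by rw [h.snd_eq_zero hp, Matrix.zero_mul, Matrix.mul_zero]
  rw [(h.mul_affine K₀ K₁).const_starMul, h.const_starMul, smul_eq_imMul]
  simp only [Matrix.add_mul, Matrix.mul_add, Matrix.mul_sub, Matrix.mul_smul, imMul_mul, map_add,
    map_sub, map_smul, Matrix.mul_assoc, hb]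
  module

end IsSlicePair

/-! ### The star resolvent and the colligation identity -/

section Resolvent

variable {n N M L : ℕ}

theorem pencil_star (A : Matrix (Fin n) (Fin n) ℍ[ℝ]) (p : ℍ[ℝ]) :
    pencil A (star p) = pencil A p := by
  simp [pencil]

/-- The function `(C₀ - p̄ C₁) X` with `X` depending only on `Re p` and `|p|`. -/
theorem isSlicePair_sub_star_smul_mul (C₀ C₁ : Matrix (Fin L) (Fin n) ℍ[ℝ])
    {X : ℍ[ℝ] → Matrix (Fin n) (Fin n) ℍ[ℝ]} {p : ℍ[ℝ]} (hX : X (star p) = X p) :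
    IsSlicePair (fun r => (C₀ - star r • C₁) * X r) p ((C₀ - p.re • C₁) * X p)
      (‖p.im‖ • (C₁ * X p)) where
  apply_eq := by
    rw [star_smul_eq_imMul, map_smul, Matrix.sub_mul, Matrix.sub_mul, Matrix.sub_mul,
      Matrix.smul_mul, Matrix.smul_mul, imMul_mul]
    module
  apply_star := by
    rw [hX, star_star, smul_eq_imMul, map_smul, Matrix.sub_mul, Matrix.sub_mul, Matrix.add_mul,
      Matrix.smul_mul, Matrix.smul_mul, imMul_mul]
    module
  snd_eq_zero hp := IsSlicePair.norm_im_smul _ hp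

theorem isSlicePair_starResolvent (A : Matrix (Fin n) (Fin n) ℍ[ℝ]) (p : ℍ[ℝ]) :
    IsSlicePair (starResolvent A) p ((1 - p.re • A) * Ring.inverse (pencil A p))
      (‖p.im‖ • (A * Ring.inverse (pencil A p))) :=
  isSlicePair_sub_star_smul_mul 1 A (X := fun r => Ring.inverse (pencil A r))
    (by rw [pencil_star])

/-- `C ⋆ (I - pA)^{-⋆}` -/
noncomputable def starEval (C : Matrix (Fin N) (Fin n) ℍ[ℝ]) (A : Matrix (Fin n) (Fin n) ℍ[ℝ])
    (p : ℍ[ℝ]) : Matrix (Fin N) (Fin n) ℍ[ℝ] :=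
  (C - star p • (C * A)) * Ring.inverse (pencil A p)

theorem const_starMul_starResolvent (C : Matrix (Fin N) (Fin n) ℍ[ℝ])
    (A : Matrix (Fin n) (Fin n) ℍ[ℝ]) :
    starMul (fun _ => C) (starResolvent A) = starEval C A := by
  ext1 p
  rw [(isSlicePair_starResolvent A p).const_starMul, starEval, star_smul_eq_imMul]
  simp only [Matrix.mul_smul, map_smul, Matrix.sub_mul, Matrix.mul_sub, Matrix.smul_mul, imMul_mul,
    Matrix.one_mul, Matrix.mul_assoc]
  module

theorem isSlicePair_starEval (C : Matrix (Fin N) (Fin n) ℍ[ℝ]) (A : Matrix (Fin n) (Fin n) ℍ[ℝ])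
    (p : ℍ[ℝ]) : IsSlicePair (starEval C A) p ((C - p.re • (C * A)) * Ring.inverse (pencil A p))
      (‖p.im‖ • (C * A * Ring.inverse (pencil A p))) :=
  isSlicePair_sub_star_smul_mul C (C * A) (X := fun r => Ring.inverse (pencil A r))
    (by rw [pencil_star])

theorem transferFunction_eq (A : Matrix (Fin n) (Fin n) ℍ[ℝ]) (B : Matrix (Fin n) (Fin M) ℍ[ℝ])
    (C : Matrix (Fin N) (Fin n) ℍ[ℝ]) (D : Matrix (Fin N) (Fin M) ℍ[ℝ]) (p : ℍ[ℝ]) :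
    transferFunction A B C D p = D + p • (starEval C A p * B) := by
  rw [transferFunction, const_starMul_starResolvent]

/-- `x² - 2 Re(p) x + |p|²` annihilates `p`. -/
theorem two_re_smul_sub_eq {p : ℍ[ℝ]} (E : Matrix (Fin N) (Fin n) ℍ[ℝ]) :
    p • E + star p • E = (2 * p.re) • E ∧ star p • p • E = (‖p‖ ^ 2) • E ∧
      p • star p • E = (‖p‖ ^ 2) • E := by
  refine ⟨?_, ?_, ?_⟩
  · rw [smul_eq_imMul, star_smul_eq_imMul]; module
  · rw [smul_smul, Quaternion.star_mul_self, Quaternion.normSq_eq_norm_mul_self, ← sq]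
    ext1 i j
    exact Quaternion.coe_mul_eq_smul _ _
  · rw [smul_smul, Quaternion.self_mul_star, Quaternion.normSq_eq_norm_mul_self, ← sq]
    ext1 i j
    exact Quaternion.coe_mul_eq_smul _ _

/-- Left multiplication by `p` or `p̄` commutes with right multiplication by `A`, so the real
quadratic polynomial splits into its two linear factors. -/
theorem mul_pencil (E : Matrix (Fin N) (Fin n) ℍ[ℝ]) (A : Matrix (Fin n) (Fin n) ℍ[ℝ]) (p : ℍ[ℝ]) :
    E * pencil A p = (E - p • (E * A)) - star p • ((E - p • (E * A)) * A) := by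
  obtain ⟨h1, -, -⟩ := two_re_smul_sub_eq (p := p) (E * A)
  obtain ⟨-, h2, -⟩ := two_re_smul_sub_eq (p := p) (E * A * A)
  rw [pencil, Matrix.mul_add, Matrix.mul_sub, Matrix.mul_smul, Matrix.mul_smul, ← h1,
    ← Matrix.mul_assoc, ← h2, Matrix.mul_one, Matrix.sub_mul, smul_sub, Matrix.smul_mul]
  abel

/-- A solution of `E = C + p E A` is `C ⋆ (I - pA)^{-⋆}`. -/
theorem eq_starEval {E C : Matrix (Fin N) (Fin n) ℍ[ℝ]} {A : Matrix (Fin n) (Fin n) ℍ[ℝ]} {p : ℍ[ℝ]}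
    (hp : IsUnit (pencil A p)) (h : E = C + p • (E * A)) : E = starEval C A p := by
  have h1 := mul_pencil E A p
  rw [← eq_sub_iff_add_eq.mpr h.symm] at h1
  rw [starEval, ← h1, Matrix.mul_assoc, Ring.mul_inverse_cancel _ hp, Matrix.mul_one]

/-- Converse of `eq_starEval`. It holds because `A` commutes with its pencil, hence with the
inverse. This fixed point equation drives the colligation identity, slice hyperholomorphy and the
observability argument. -/
theorem starEval_eq (C : Matrix (Fin N) (Fin n) ℍ[ℝ]) {A : Matrix (Fin n) (Fin n) ℍ[ℝ]} {p : ℍ[ℝ]}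
    (hp : IsUnit (pencil A p)) : starEval C A p = C + p • (starEval C A p * A) := by
  have hc : A * pencil A p = pencil A p * A := by
    simp [pencil, mul_add, mul_sub, add_mul, sub_mul, mul_assoc]
  have hc' : Ring.inverse (pencil A p) * A = A * Ring.inverse (pencil A p) := by
    calc _ = Ring.inverse (pencil A p) * (A * pencil A p) * Ring.inverse (pencil A p) := by
          rw [mul_assoc, mul_assoc, Ring.mul_inverse_cancel _ hp, mul_one]
      _ = _ := by rw [hc, ← mul_assoc, Ring.inverse_mul_cancel _ hp, one_mul]
  obtain ⟨-, h2, h3⟩ := two_re_smul_sub_eq (p := p) (C * A * A)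
  have h4 : C - star p • (C * A) = C * pencil A p + p • ((C - star p • (C * A)) * A) := by
    rw [mul_pencil]
    simp only [Matrix.sub_mul, smul_sub, Matrix.smul_mul, h2, h3]
    abel
  have h5 : starEval C A p * A = (C - star p • (C * A)) * A * Ring.inverse (pencil A p) := by
    rw [starEval, Matrix.mul_assoc, hc', ← Matrix.mul_assoc]
  rw [h5, ← Matrix.smul_mul]
  nth_rewrite 1 [starEval]
  nth_rewrite 1 [h4]
  rw [Matrix.add_mul, Matrix.mul_assoc C, Ring.mul_inverse_cancel _ hp, Matrix.mul_one]

theorem conjTranspose_smul_eq (q : ℍ[ℝ]) (K : Matrix (Fin N) (Fin M) ℍ[ℝ]) :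
    (q • K)ᴴ = MulOpposite.op (star q) • Kᴴ := by
  ext1 i j
  simp

theorem conjTranspose_op_smul_eq (q : ℍ[ℝ]) (K : Matrix (Fin N) (Fin M) ℍ[ℝ]) :
    (MulOpposite.op (star q) • K)ᴴ = q • Kᴴ := by
  ext1 i j
  simp

theorem add_smul_mul_mul_add_smul (p : ℍ[ℝ]) (q : ℍ[ℝ]ᵐᵒᵖ) (X U : Matrix (Fin N) (Fin n) ℍ[ℝ])
    (K : Matrix (Fin n) (Fin n) ℍ[ℝ]) (Y W : Matrix (Fin n) (Fin N) ℍ[ℝ]) :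
    (X + p • U) * K * (Y + q • W) =
      X * K * Y + p • (U * K * Y) + q • (X * K * W) + p • q • (U * K * W) := by
  simp only [Matrix.add_mul, Matrix.mul_add, Matrix.smul_mul, Matrix.mul_smul]
  rw [smul_add, smul_comm q p]
  abel

/-- The basic identity for coisometric colligations. -/
theorem colligation_identity {m : ℕ} {H A : Matrix (Fin n) (Fin n) ℍ[ℝ]}
    {J₂ : Matrix (Fin N) (Fin N) ℍ[ℝ]}
    {J₁ : Matrix (Fin m) (Fin m) ℍ[ℝ]} {B : Matrix (Fin n) (Fin m) ℍ[ℝ]}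
    {C : Matrix (Fin N) (Fin n) ℍ[ℝ]} {D : Matrix (Fin N) (Fin m) ℍ[ℝ]}
    (hrel : ColligationRelation H J₁ J₂ A B C D) {p q : ℍ[ℝ]} {E F : Matrix (Fin N) (Fin n) ℍ[ℝ]}
    (hE : E = C + p • (E * A)) (hF : F = C + q • (F * A)) :
    J₂ - (D + p • (E * B)) * J₁ * (D + q • (F * B))ᴴ =
      E * H * Fᴴ - p • MulOpposite.op (star q) • (E * H * Fᴴ) := by
  rw [ColligationRelation, Matrix.fromBlocks_conjTranspose, Matrix.fromBlocks_multiply,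
    Matrix.fromBlocks_multiply, Matrix.fromBlocks_inj] at hrel
  simp only [Matrix.mul_zero, add_zero, zero_add] at hrel
  obtain ⟨h11, h12, h21, h22⟩ := hrel
  have hF' : Fᴴ = Cᴴ + MulOpposite.op (star q) • (Aᴴ * Fᴴ) := by
    conv_lhs => rw [hF]
    rw [Matrix.conjTranspose_add, conjTranspose_smul_eq, Matrix.conjTranspose_mul]
  have e1 : E * H * Fᴴ = (C + p • (E * A)) * H * (Cᴴ + MulOpposite.op (star q) • (Aᴴ * Fᴴ)) := by
    rw [← hF', ← hE]
  -- The block relations trade each product through `J₁` for one through `H`. What remains is the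
  -- expansion of `E H Fᴴ` and one shifted copy `p E H Fᴴ q̄`.
  have b1 : E * B * J₁ * Dᴴ = -(E * A * H * Cᴴ) := by
    rw [eq_neg_iff_add_eq_zero, Matrix.mul_assoc E, Matrix.mul_assoc E, Matrix.mul_assoc E,
      Matrix.mul_assoc E, ← Matrix.mul_add, add_comm, h12, Matrix.mul_zero]
  have b2 : D * J₁ * (Bᴴ * Fᴴ) = -(C * H * (Aᴴ * Fᴴ)) := by
    rw [eq_neg_iff_add_eq_zero, ← Matrix.mul_assoc, ← Matrix.mul_assoc, ← Matrix.add_mul, add_comm,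
      h21, Matrix.zero_mul]
  have b3 : E * B * J₁ * (Bᴴ * Fᴴ) = E * H * Fᴴ - E * A * H * (Aᴴ * Fᴴ) := by
    have : E * H * Fᴴ = E * (A * H * Aᴴ + B * J₁ * Bᴴ) * Fᴴ := by rw [h11]
    rw [this]
    simp only [Matrix.mul_add, Matrix.add_mul, Matrix.mul_assoc]
    abel
  have e2 : (D + p • (E * B)) * J₁ * (D + q • (F * B))ᴴ = D * J₁ * Dᴴ + p • (E * B * J₁ * Dᴴ)
      + MulOpposite.op (star q) • (D * J₁ * (Bᴴ * Fᴴ))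
      + p • MulOpposite.op (star q) • (E * B * J₁ * (Bᴴ * Fᴴ)) := by
    rw [Matrix.conjTranspose_add, conjTranspose_smul_eq, Matrix.conjTranspose_mul,
      add_smul_mul_mul_add_smul]
  rw [e2, b1, b2, b3, ← h22, e1, add_smul_mul_mul_add_smul, ← add_smul_mul_mul_add_smul, ← e1]
  rw [smul_sub, smul_sub, smul_neg, smul_neg, e1, add_smul_mul_mul_add_smul]
  abel

theorem starEval_identity {H A : Matrix (Fin n) (Fin n) ℍ[ℝ]} {J₂ : Matrix (Fin N) (Fin N) ℍ[ℝ]}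
    {J₁ : Matrix (Fin M) (Fin M) ℍ[ℝ]} {B : Matrix (Fin n) (Fin M) ℍ[ℝ]}
    {C : Matrix (Fin N) (Fin n) ℍ[ℝ]} {D : Matrix (Fin N) (Fin M) ℍ[ℝ]}
    (hrel : ColligationRelation H J₁ J₂ A B C D) {p q : ℍ[ℝ]} (hp : IsUnit (pencil A p))
    (hq : IsUnit (pencil A q)) :
    J₂ - transferFunction A B C D p * J₁ * (transferFunction A B C D q)ᴴ =
      starEval C A p * H * (starEval C A q)ᴴ
        - p • MulOpposite.op (star q) • (starEval C A p * H * (starEval C A q)ᴴ) := by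
  rw [transferFunction_eq, transferFunction_eq]
  exact colligation_identity hrel (starEval_eq C hp) (starEval_eq C hq)

/-- The star products unwind from the inside. After adjoints, each right product has a factor of the
form `K₀ - r K₁` in the remaining variable, so the affine rules for `⋆` apply at every stage and
lead to `starEval_identity`. -/
theorem key_identity {H A : Matrix (Fin n) (Fin n) ℍ[ℝ]} {J₂ : Matrix (Fin N) (Fin N) ℍ[ℝ]}
    {J₁ : Matrix (Fin M) (Fin M) ℍ[ℝ]} {B : Matrix (Fin n) (Fin M) ℍ[ℝ]}
    {C : Matrix (Fin N) (Fin n) ℍ[ℝ]} {D : Matrix (Fin N) (Fin M) ℍ[ℝ]}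
    (hrel : ColligationRelation H J₁ J₂ A B C D) {p q : ℍ[ℝ]} (hp : IsUnit (pencil A p))
    (hq : IsUnit (pencil A q)) :
    J₂ - transferFunction A B C D p * J₁ * (transferFunction A B C D q)ᴴ =
      starMulRight
        (starMulRight
          (fun q' => starMul (starMul (fun _ => C) (starResolvent A))
            (fun p' => H - p' • (MulOpposite.op (star q') • H)) p)
          (fun q' => (starResolvent A q')ᴴ))
        (fun _ => Cᴴ) q := by
  have h1 : ∀ r : ℍ[ℝ], (starMul (starEval C A)
      (fun p' => H - p' • (MulOpposite.op (star r) • H)) p)ᴴ =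
      (starEval C A p * H)ᴴ - r • (p • (starEval C A p * H))ᴴ := by
    intro r
    rw [(isSlicePair_starEval C A p).starMul_affine H (MulOpposite.op (star r) • H), Matrix.mul_smul,
      smul_comm, Matrix.conjTranspose_sub]
    rw [conjTranspose_op_smul_eq]
  have h2 : ∀ r : ℍ[ℝ], (starMulRight
      (fun q' => starMul (starEval C A) (fun p' => H - p' • (MulOpposite.op (star q') • H)) p)
      (fun q' => (starResolvent A q')ᴴ) r)ᴴ = starResolvent A r * (starEval C A p * H)ᴴ
        - r • (starResolvent A r * (p • (starEval C A p * H))ᴴ) := by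
    intro r
    simp only [starMulRight, Matrix.conjTranspose_conjTranspose, h1]
    exact (isSlicePair_starResolvent A r).starMul_affine _ _
  rw [starEval_identity hrel hp hq, starMulRight, const_starMul_starResolvent]
  simp only [h2, Matrix.conjTranspose_conjTranspose]
  rw [(isSlicePair_starResolvent A q).const_starMul_mul_affine, const_starMul_starResolvent,
    Matrix.conjTranspose_sub, conjTranspose_smul_eq, Matrix.conjTranspose_mul,
    Matrix.conjTranspose_mul (starEval C A q), Matrix.conjTranspose_conjTranspose,
    Matrix.conjTranspose_conjTranspose, Matrix.smul_mul, smul_comm]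

end Resolvent

end Star

/-! ### Points where the pencil is invertible -/

section PencilUnits

variable {n : ℕ}

/-- Invertibility of the pencil is detected by a real determinant. -/
theorem exists_isUnit_pencil_iff (A : Matrix (Fin n) (Fin n) ℍ[ℝ]) :
    ∃ (k : ℕ) (T : Matrix (Fin k) (Fin k) ℝ), ∀ p : ℍ[ℝ], IsUnit (pencil A p) ↔
      (1 - (2 * p.re) • T + (‖p‖ ^ 2) • (T * T)).det ≠ 0 := by
  let e := Module.finBasis ℝ (Matrix (Fin n) (Fin n) ℍ[ℝ])
  -- The coefficients of the pencil are real, so the real left regular representation carries it to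
  -- the same polynomial in a real matrix, which has a determinant.
  let φ := Algebra.leftMulMatrix e
  refine ⟨_, φ A, fun p => ?_⟩
  have h1 : 1 - (2 * p.re) • φ A + (‖p‖ ^ 2) • (φ A * φ A) = φ (pencil A p) := by
    simp [pencil]
  rw [h1]
  constructor
  · intro h
    exact ((Matrix.isUnit_iff_isUnit_det _).mp (h.map φ)).ne_zero
  · intro h
    have hinj : Function.Injective (LinearMap.mulLeft ℝ (pencil A p)) := by
      rw [injective_iff_map_eq_zero]
      intro x hx
      have h2 : φ (pencil A p) *ᵥ e.repr x = 0 := by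
        rw [Algebra.leftMulMatrix_mulVec_repr, show pencil A p * x = 0 from hx]
        simp
      have h3 := Matrix.eq_zero_of_mulVec_eq_zero h h2
      exact e.repr.map_eq_zero_iff.mp (Finsupp.ext fun i => congrFun h3 i)
    obtain ⟨y, hy⟩ := LinearMap.surjective_of_injective hinj 1
    have hy : pencil A p * y = 1 := hy
    refine ⟨⟨pencil A p, y, hy, hinj ?_⟩, rfl⟩
    simp [← mul_assoc, hy]

theorem isOpen_isUnit_pencil (A : Matrix (Fin n) (Fin n) ℍ[ℝ]) :
    IsOpen {p : ℍ[ℝ] | IsUnit (pencil A p)} := by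
  obtain ⟨k, T, hT⟩ := exists_isUnit_pencil_iff A
  simp only [hT]
  refine isOpen_ne_fun (Continuous.matrix_det ?_) continuous_const
  have := Quaternion.continuous_re
  fun_prop

theorem isUnit_pencil_zero (A : Matrix (Fin n) (Fin n) ℍ[ℝ]) : IsUnit (pencil A 0) := by
  simp [pencil]

/-- Near every point there are points at which the pencil is invertible. -/
theorem mem_closure_isUnit_pencil (A : Matrix (Fin n) (Fin n) ℍ[ℝ]) {V : Set ℍ[ℝ]} (hV : IsOpen V)
    {p : ℍ[ℝ]} (hp : p ∈ V) : p ∈ closure {q ∈ V | IsUnit (pencil A q)} := by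
  obtain ⟨k, T, hT⟩ := exists_isUnit_pencil_iff A
  obtain ⟨S, hS⟩ : ∃ S, S = T * T := ⟨_, rfl⟩
  simp only [← hS] at hT
  -- Along the ray `t ↦ t • p` the determinant is a polynomial in `t` with value `1` at `t = 0`. It
  -- has finitely many roots, so `t → 1` can avoid them.
  let Q : Polynomial ℝ := Matrix.det
    (1 - (Polynomial.X * Polynomial.C (2 * p.re)) • T.map Polynomial.C
      + (Polynomial.X ^ 2 * Polynomial.C (‖p‖ ^ 2)) • S.map Polynomial.C)
  have hQ : ∀ t : ℝ, Q.eval t =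
      (1 - (2 * (t • p).re) • T + (‖t • p‖ ^ 2) • S).det := by
    intro t
    rw [← Polynomial.coe_evalRingHom, RingHom.map_det]
    congr 1
    ext1 i j
    have : ‖t • p‖ ^ 2 = t ^ 2 * ‖p‖ ^ 2 := by
      rw [norm_smul, mul_pow, Real.norm_eq_abs, sq_abs]
    rw [this]
    simp only [Matrix.add_apply, Matrix.sub_apply, Matrix.smul_apply, Matrix.one_apply,
      RingHom.mapMatrix_apply, Matrix.map_apply, smul_eq_mul, Polynomial.coe_evalRingHom,
      Polynomial.eval_add, Polynomial.eval_sub, Polynomial.eval_mul, Polynomial.eval_X,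
      Polynomial.eval_C, Polynomial.eval_pow, Quaternion.re_smul]
    split_ifs <;> simp <;> exact Or.inl (by ring)
  have hQ0 : Q ≠ 0 := by
    intro h0
    have := hQ 0
    simp [h0] at this
  have hev : ∀ᶠ t in 𝓝[≠] (1 : ℝ), IsUnit (pencil A (t • p)) := by
    have : ∀ᶠ t in 𝓝[≠] (1 : ℝ), t ∉ (Q.roots.toFinset : Set ℝ) :=
      nhdsNE_le_cofinite 1 Q.roots.toFinset.finite_toSet.compl_mem_cofinite
    filter_upwards [this] with t ht
    rw [hT, ← hQ]
    intro h
    exact ht (by simp [hQ0, h])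
  have hcont : Filter.Tendsto (fun t : ℝ => t • p) (𝓝[≠] 1) (𝓝 p) := by
    have : Filter.Tendsto (fun t : ℝ => t • p) (𝓝 1) (𝓝 ((1 : ℝ) • p)) := by
      exact (continuous_id.smul continuous_const).tendsto _
    rw [one_smul] at this
    exact this.mono_left nhdsWithin_le_nhds
  exact mem_closure_of_tendsto hcont ((hcont.eventually (hV.mem_nhds hp)).and hev)

end PencilUnits

/-! ### Slice hyperholomorphy of transfer functions -/

section Differentiability

variable {n N M : ℕ}

theorem differentiable_re : Differentiable ℝ fun q : ℍ[ℝ] => q.re := by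
  let f : ℍ[ℝ] →ₗ[ℝ] ℝ :=
    { toFun := fun q => q.re
      map_add' := fun _ _ => rfl
      map_smul' := fun _ _ => rfl }
  exact (LinearMap.toContinuousLinearMap f).differentiable

theorem differentiable_star : Differentiable ℝ fun q : ℍ[ℝ] => star q := by
  have h : (fun q : ℍ[ℝ] => star q) = fun q => (2 * q.re) • (1 : ℍ[ℝ]) - q := by
    ext1 q
    rw [Quaternion.star_eq_two_re_sub, ← Algebra.algebraMap_eq_smul_one]
    rfl
  rw [h]
  exact ((differentiable_re.const_mul 2).smul_const 1).sub differentiable_id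

theorem differentiableAt_inverse_pencil {A : Matrix (Fin n) (Fin n) ℍ[ℝ]} {p : ℍ[ℝ]}
    (hp : IsUnit (pencil A p)) (i j : Fin n) :
    DifferentiableAt ℝ (fun q => Ring.inverse (pencil A q) i j) p := by
  let _ : NormedRing (Matrix (Fin n) (Fin n) ℍ[ℝ]) := Matrix.linftyOpNormedRing
  let _ : NormedAlgebra ℝ (Matrix (Fin n) (Fin n) ℍ[ℝ]) := Matrix.linftyOpNormedAlgebra
  have : CompleteSpace (Matrix (Fin n) (Fin n) ℍ[ℝ]) := FiniteDimensional.complete ℝ _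
  have hre : DifferentiableAt ℝ (fun q : ℍ[ℝ] => q.re) p := differentiable_re p
  have h1 : DifferentiableAt ℝ (fun q => pencil A q) p := by
    unfold pencil
    have : DifferentiableAt ℝ (fun q : ℍ[ℝ] => ‖q‖ ^ 2) p := differentiableAt_id.norm_sq ℝ
    fun_prop
  have h2 : DifferentiableAt ℝ (fun q => Ring.inverse (pencil A q)) p :=
    (differentiableAt_inverse (𝕜 := ℝ) hp).comp p h1
  let entry : Matrix (Fin n) (Fin n) ℍ[ℝ] →ₗ[ℝ] ℍ[ℝ] :=
    { toFun := fun X => X i j, map_add' := fun _ _ => rfl, map_smul' := fun _ _ => rfl }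
  exact (LinearMap.toContinuousLinearMap entry).differentiableAt.comp p h2

theorem differentiableAt_starEval {A : Matrix (Fin n) (Fin n) ℍ[ℝ]} {p : ℍ[ℝ]}
    (hp : IsUnit (pencil A p)) (C : Matrix (Fin N) (Fin n) ℍ[ℝ]) (i : Fin N) (j : Fin n) :
    DifferentiableAt ℝ (fun q => starEval C A q i j) p := by
  simp only [starEval, Matrix.mul_apply, Matrix.sub_apply, Matrix.smul_apply, smul_eq_mul]
  exact DifferentiableAt.fun_sum fun k _ => ((differentiableAt_const _).sub
    ((differentiable_star p).mul (differentiableAt_const _))).mul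
      (differentiableAt_inverse_pencil hp k j)

/-- The conjugated Cauchy–Riemann operator of `p ↦ D + p E(p)` is `p` times that of `E`. -/
theorem cauchyRiemann_add_mul {I p D : ℍ[ℝ]} (hI : I ∈ imSphere) (hpI : Commute I p)
    {f : ℍ[ℝ] → ℍ[ℝ]} (hf : DifferentiableAt ℝ f p) :
    fderiv ℝ (fun q => D + q * f q) p 1 + I * fderiv ℝ (fun q => D + q * f q) p I =
      p * (fderiv ℝ f p 1 + I * fderiv ℝ f p I) := by
  have h1 : HasFDerivAt (fun q => D + q * f q) _ p :=
    ((hasFDerivAt_id p).mul' hf.hasFDerivAt).const_add D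
  have hII : I * I = -1 := by
    rw [← neg_eq_iff_eq_neg, ← neg_mul, ← Quaternion.star_eq_neg.mpr hI.1, Quaternion.star_mul_self,
      Quaternion.normSq_eq_norm_mul_self, hI.2]
    simp
  rw [h1.fderiv]
  simp only [id, add_apply, smul_apply, smul_eq_mul,
    ContinuousLinearMap.coe_id', MulOpposite.smul_eq_mul_unop, MulOpposite.unop_op]
  -- Differentiating the factor `q` contributes `f p` and `I * (I * f p)`, which cancel; `I`
  -- commutes with `p`, so `p` factors out on the left.
  rw [mul_add, mul_add, ← mul_assoc, ← mul_assoc I, ← mul_assoc p, hpI.eq, hII]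
  noncomm_ring

theorem cauchyRiemann_sum_mul {ι : Type*} (s : Finset ι) {I p : ℍ[ℝ]} {f : ι → ℍ[ℝ] → ℍ[ℝ]}
    (hf : ∀ k ∈ s, DifferentiableAt ℝ (f k) p) (a : ι → ℍ[ℝ]) :
    fderiv ℝ (fun q => ∑ k ∈ s, f k q * a k) p 1
      + I * fderiv ℝ (fun q => ∑ k ∈ s, f k q * a k) p I =
        ∑ k ∈ s, (fderiv ℝ (f k) p 1 + I * fderiv ℝ (f k) p I) * a k := by
  have h1 : HasFDerivAt (fun q => ∑ k ∈ s, f k q * a k) _ p :=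
    HasFDerivAt.fun_sum fun k hk => (hf k hk).hasFDerivAt.mul_const' (a k)
  rw [h1.fderiv]
  simp [Finset.mul_sum, ← Finset.sum_add_distrib, add_mul, mul_assoc]

/-- Slice hyperholomorphy of transfer functions. -/
theorem sliceHyperholomorphic_transferFunction {A : Matrix (Fin n) (Fin n) ℍ[ℝ]}
    {V : Set ℍ[ℝ]} (hV : IsOpen V) (hu : ∀ p ∈ V, IsUnit (pencil A p))
    (B : Matrix (Fin n) (Fin M) ℍ[ℝ]) (C : Matrix (Fin N) (Fin n) ℍ[ℝ])
    (D : Matrix (Fin N) (Fin M) ℍ[ℝ]) :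
    MatrixSliceHyperholomorphicOn (transferFunction A B C D) V := by
  intro i j
  have hs : (fun p => transferFunction A B C D p i j) =
      fun p => D i j + p * ∑ k, starEval C A p i k * B k j := by
    ext1 p
    rw [transferFunction_eq]
    simp [Matrix.mul_apply]
  have hdE : ∀ p ∈ V, ∀ i k, DifferentiableAt ℝ (fun q => starEval C A q i k) p :=
    fun p hp i k => differentiableAt_starEval (hu p hp) C i k
  have hdS : ∀ p ∈ V, ∀ (m : ℕ) (X : Matrix (Fin n) (Fin m) ℍ[ℝ]) i k,
      DifferentiableAt ℝ (fun q => ∑ l, starEval C A q i l * X l k) p :=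
    fun p hp m X i k => DifferentiableAt.fun_sum fun l _ => (hdE p hp i l).mul_const _
  rw [hs]
  refine ⟨fun p hp => ((differentiableAt_const _).add
    (differentiableAt_id.mul (hdS p hp _ B i j))).differentiableWithinAt, ?_⟩
  intro I hI x y hp
  set p := (x : ℍ[ℝ]) + y • I with hpdef
  have hcomm : Commute I p := by
    rw [hpdef]
    exact ((Quaternion.coe_commute x I).symm).add_right ((Commute.refl I).smul_right y)
  -- Applying the Cauchy–Riemann operator to `E = C + pEA` gives `Z = pZA`, the same fixed point
  -- equation with constant term `0`. Uniqueness forces `Z = 0`, and the inverse need not be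
  -- differentiated explicitly.
  let Z : Matrix (Fin N) (Fin n) ℍ[ℝ] := Matrix.of fun i k =>
    fderiv ℝ (fun q => starEval C A q i k) p 1 + I * fderiv ℝ (fun q => starEval C A q i k) p I
  have hZ : Z = 0 + p • (Z * A) := by
    ext1 i k
    have heq : (fun q => starEval C A q i k) =ᶠ[𝓝 p]
        fun q => C i k + q * ∑ l, starEval C A q i l * A l k := by
      filter_upwards [hV.mem_nhds hp] with q hq
      conv_lhs => rw [starEval_eq C (hu q hq)]
      simp [Matrix.mul_apply]
    change fderiv ℝ (fun q => starEval C A q i k) p 1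
      + I * fderiv ℝ (fun q => starEval C A q i k) p I = _
    rw [heq.fderiv_eq, cauchyRiemann_add_mul hI hcomm (hdS p hp _ A i k),
      cauchyRiemann_sum_mul _ fun l _ => hdE p hp i l]
    simp [Matrix.mul_apply, Z]
  have hZ0 : Z = 0 := by
    rw [eq_starEval (hu p hp) hZ, starEval]
    simp
  rw [cauchyRiemann_add_mul hI hcomm (hdS p hp _ B i j), cauchyRiemann_sum_mul _ fun l _ =>
    hdE p hp i l]
  have hz : ∀ l, fderiv ℝ (fun q => starEval C A q i l) p 1
      + I * fderiv ℝ (fun q => starEval C A q i l) p I = 0 := fun l => congrFun (congrFun hZ0 i) l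
  simp [hz]

end Differentiability

/-! ### The Stein equation for the kernel -/

section Stein

variable {N M : ℕ}

theorem summable_pow_mul_mul_pow {p q : ℍ[ℝ]} (hp : ‖p‖ ≤ 1) (hq : ‖q‖ < 1) (x : ℍ[ℝ]) :
    Summable fun l : ℕ => p ^ l * (x * star q ^ l) := by
  refine Summable.of_norm_bounded ((summable_geometric_of_lt_one (norm_nonneg q) hq).mul_left ‖x‖)
    fun l => ?_
  rw [norm_mul, norm_mul, norm_pow, norm_pow, norm_star]
  exact mul_le_of_le_one_left (by positivity) (pow_le_one₀ (norm_nonneg p) hp)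

theorem schurKernel_apply {J₂ : Matrix (Fin N) (Fin N) ℍ[ℝ]} {J₁ : Matrix (Fin M) (Fin M) ℍ[ℝ]}
    {s : ℍ[ℝ] → Matrix (Fin N) (Fin M) ℍ[ℝ]} {p q : ℍ[ℝ]} (hp : ‖p‖ ≤ 1) (hq : ‖q‖ < 1)
    (i j : Fin N) : schurKernel J₂ J₁ s p q i j =
      ∑' l : ℕ, p ^ l * ((J₂ - s p * J₁ * (s q)ᴴ) i j * star q ^ l) := by
  have hs : ∀ i j, Summable fun l : ℕ =>
      (p ^ l • (MulOpposite.op (star q ^ l) • (J₂ - s p * J₁ * (s q)ᴴ))) i j :=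
    fun i j => summable_pow_mul_mul_pow hp hq _
  have h1 : Summable fun l : ℕ =>
      (p ^ l • (MulOpposite.op (star q ^ l) • (J₂ - s p * J₁ * (s q)ᴴ))) :=
    Pi.summable.mpr fun i => Pi.summable.mpr (hs i)
  rw [schurKernel]
  erw [tsum_apply h1, tsum_apply (Pi.summable.mpr (hs i))]
  rfl

/-- The kernel solves a Stein equation. -/
theorem schurKernel_sub {J₂ : Matrix (Fin N) (Fin N) ℍ[ℝ]} {J₁ : Matrix (Fin M) (Fin M) ℍ[ℝ]}
    {s : ℍ[ℝ] → Matrix (Fin N) (Fin M) ℍ[ℝ]} {p q : ℍ[ℝ]} (hp : ‖p‖ ≤ 1) (hq : ‖q‖ < 1) :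
    schurKernel J₂ J₁ s p q - p • MulOpposite.op (star q) • schurKernel J₂ J₁ s p q =
      J₂ - s p * J₁ * (s q)ᴴ := by
  ext1 i j
  simp only [Matrix.sub_apply, Matrix.smul_apply, smul_eq_mul, MulOpposite.smul_eq_mul_unop,
    MulOpposite.unop_op]
  rw [schurKernel_apply hp hq]
  set x := (J₂ - s p * J₁ * (s q)ᴴ) i j with hx
  have hsum := summable_pow_mul_mul_pow hp hq x
  conv_lhs => enter [1]; rw [hsum.tsum_eq_zero_add]
  rw [← tsum_mul_right, ← tsum_mul_left]
  have : ∀ l : ℕ, p * (p ^ l * (x * star q ^ l) * star q) = p ^ (l + 1) * (x * star q ^ (l + 1)) :=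
    fun l => by rw [pow_succ', pow_succ]; simp only [mul_assoc]
  simp only [this]
  simp [hx]

/-- Each entry `x` of the difference satisfies `x = p x q̄`, and `|p||q| < 1`. This is how the
kernel is computed from a realization without handling its series. -/
theorem eq_of_stein {p q : ℍ[ℝ]} (hp : ‖p‖ ≤ 1) (hq : ‖q‖ < 1) {X Y : Matrix (Fin N) (Fin N) ℍ[ℝ]}
    (h : X - p • MulOpposite.op (star q) • X = Y - p • MulOpposite.op (star q) • Y) : X = Y := by
  ext1 i j
  have h1 := congrFun (congrFun h i) j
  simp only [Matrix.sub_apply, Matrix.smul_apply, smul_eq_mul, MulOpposite.smul_eq_mul_unop,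
    MulOpposite.unop_op] at h1
  have h2 : X i j - Y i j = p * ((X i j - Y i j) * star q) := by
    rw [sub_mul, mul_sub]
    exact sub_eq_sub_iff_sub_eq_sub.mp h1
  have h3 := congrArg norm h2
  rw [norm_mul, norm_mul, norm_star] at h3
  have h4 : ‖X i j - Y i j‖ = 0 := by
    have := mul_le_of_le_one_left (by positivity : 0 ≤ ‖X i j - Y i j‖ * ‖q‖) hp
    nlinarith [norm_nonneg (X i j - Y i j)]
  exact sub_eq_zero.mp (norm_eq_zero.mp h4)

theorem continuousOn_schurKernel {J₂ : Matrix (Fin N) (Fin N) ℍ[ℝ]}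
    {J₁ : Matrix (Fin M) (Fin M) ℍ[ℝ]} {s : ℍ[ℝ] → Matrix (Fin N) (Fin M) ℍ[ℝ]} {V : Set ℍ[ℝ]}
    (hVo : IsOpen V) (hV : V ⊆ Metric.ball 0 1) (hs : MatrixSliceHyperholomorphicOn s V) {q : ℍ[ℝ]}
    (hq : ‖q‖ < 1) (i j : Fin N) : ContinuousOn (fun p => schurKernel J₂ J₁ s p q i j) V := by
  have hV' : ∀ p ∈ V, ‖p‖ ≤ 1 := fun p hp => (mem_ball_zero_iff.mp (hV hp)).le
  have hx : ContinuousOn (fun p => (J₂ - s p * J₁ * (s q)ᴴ) i j) V := by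
    have hsc : ∀ a b, ContinuousOn (fun p => s p a b) V := fun a b => (hs a b).1.continuousOn
    simp only [Matrix.sub_apply, Matrix.mul_apply]
    fun_prop
  intro p₀ hp₀
  refine ContinuousAt.continuousWithinAt ?_
  -- A bound for the entry near `p₀`; since `‖p‖ ≤ 1`, the series is then dominated near `p₀` by a
  -- geometric series in `‖q‖`.
  set C := ‖(J₂ - s p₀ * J₁ * (s q)ᴴ) i j‖ + 1
  have hxa := hx.continuousAt (hVo.mem_nhds hp₀)
  have hbound : ∀ᶠ p in 𝓝 p₀, ‖(J₂ - s p * J₁ * (s q)ᴴ) i j‖ < C :=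
    hxa.norm.eventually_lt continuousAt_const (lt_add_one _)
  obtain ⟨W, hWsub, hWo, hpW⟩ := mem_nhds_iff.mp (hbound.and (hVo.mem_nhds hp₀))
  have hcont : ContinuousOn (fun p => ∑' l : ℕ, p ^ l * ((J₂ - s p * J₁ * (s q)ᴴ) i j * star q ^ l))
      W := by
    refine continuousOn_tsum (u := fun l => C * ‖q‖ ^ l) (fun l => ?_)
      ((summable_geometric_of_lt_one (norm_nonneg q) hq).mul_left C) fun l p hp => ?_
    · exact (continuousOn_pow l).mul ((hx.mono fun p hp => (hWsub hp).2).mul continuousOn_const)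
    · rw [norm_mul, norm_mul, norm_pow, norm_pow, norm_star]
      calc _ ≤ 1 * (C * ‖q‖ ^ l) := by
            gcongr
            · exact pow_le_one₀ (norm_nonneg p) (hV' p (hWsub hp).2)
            · exact (hWsub hp).1.le
        _ = _ := one_mul _
  refine (hcont.continuousAt (hWo.mem_nhds hpW)).congr ?_
  filter_upwards [hWo.mem_nhds hpW] with p hp
  rw [schurKernel_apply (hV' p (hWsub hp).2) hq]

end Stein

/-! ### Counting negative squares through a feature map -/

section NegativeSquares

variable {N n : ℕ} {K : ℍ[ℝ] → ℍ[ℝ] → Matrix (Fin N) (Fin N) ℍ[ℝ]} {V : Set ℍ[ℝ]}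
  {G : Matrix (Fin n) (Fin n) ℍ[ℝ]} {ψ : ℍ[ℝ] → (Fin N → ℍ[ℝ]) → Fin n → ℍ[ℝ]}

/-- The Gram matrices of a kernel with the feature map `ψ`. -/
theorem gram_eq_congr
    (hψ : ∀ z ∈ V, ∀ w ∈ V, ∀ c d, star c ⬝ᵥ (K z w *ᵥ d) = matForm G (ψ w d) (ψ z c))
    {m : ℕ} {z : Fin m → ℍ[ℝ]} (hz : ∀ l, z l ∈ V) (c : Fin m → Fin N → ℍ[ℝ]) :
    (Matrix.of fun l j => star (c l) ⬝ᵥ (K (z l) (z j) *ᵥ c j)) =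
      (Matrix.of fun i l => ψ (z l) (c l) i)ᴴ * G * Matrix.of fun i l => ψ (z l) (c l) i := by
  ext1 l j
  rw [Matrix.of_apply, hψ _ (hz l) _ (hz j), Matrix.mul_assoc]
  rfl

/-- All Gram matrices are congruences of `G`, so their counts are bounded and the largest is
attained. It may be smaller than `sqNeg G` when the features do not span. -/
theorem exists_hasNegativeSquares (hG : G.IsHermitian)
    (hK : ∀ z ∈ V, ∀ w ∈ V, K z w = (K w z)ᴴ)
    (hψ : ∀ z ∈ V, ∀ w ∈ V, ∀ c d, star c ⬝ᵥ (K z w *ᵥ d) = matForm G (ψ w d) (ψ z c)) :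
    ∃ κ, HasNegativeSquares K V κ := by
  let S : Set ℕ := {k | ∃ (m : ℕ) (z : Fin m → ℍ[ℝ]) (c : Fin m → Fin N → ℍ[ℝ]), (∀ l, z l ∈ V) ∧
    sqNeg (Matrix.of fun l j => star (c l) ⬝ᵥ (K (z l) (z j) *ᵥ c j)) = k}
  have hne : S.Nonempty := ⟨_, 0, Fin.elim0, Fin.elim0, fun l => l.elim0, rfl⟩
  have hbdd : BddAbove S := by
    refine ⟨sqNeg G, ?_⟩
    rintro _ ⟨m, z, c, hz, rfl⟩
    rw [gram_eq_congr hψ hz]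
    exact sqNeg_congr_le hG _
  exact ⟨sSup S, hK, fun m z c hz => le_csSup hbdd ⟨m, z, c, hz, rfl⟩, Nat.sSup_mem hne hbdd⟩

/-- Finitely many features already span; the matrix having them as columns is surjective, so the law
of inertia makes its Gram matrix attain `sqNeg G`. -/
theorem hasNegativeSquares_of_span (hG : G.IsHermitian)
    (hK : ∀ z ∈ V, ∀ w ∈ V, K z w = (K w z)ᴴ)
    (hψ : ∀ z ∈ V, ∀ w ∈ V, ∀ c d, star c ⬝ᵥ (K z w *ᵥ d) = matForm G (ψ w d) (ψ z c))
    (hspan : Submodule.span ℍ[ℝ]ᵐᵒᵖ {x | ∃ z ∈ V, ∃ c, ψ z c = x} = ⊤) :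
    HasNegativeSquares K V (sqNeg G) := by
  refine ⟨hK, fun m z c hz => ?_, ?_⟩
  · rw [gram_eq_congr hψ hz]
    exact sqNeg_congr_le hG _
  · obtain ⟨t, ht, htop⟩ := Submodule.fg_span_iff_fg_span_finset_subset _ |>.mp
      (hspan ▸ Module.Finite.fg_top : (Submodule.span ℍ[ℝ]ᵐᵒᵖ {x | ∃ z ∈ V, ∃ c, ψ z c = x}).FG)
    have hx : ∀ x : t, ∃ z ∈ V, ∃ c, ψ z c = x := fun x => ht x.2
    choose z hz c hc using hx
    refine ⟨t.card, fun l => z (t.equivFin.symm l), fun l => c (t.equivFin.symm l),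
      fun l => hz _, ?_⟩
    rw [gram_eq_congr hψ (fun l => hz _)]
    refine sqNeg_congr_eq hG _ ?_
    rw [← LinearMap.range_eq_top, eq_top_iff, ← hspan, htop, Submodule.span_le]
    intro x hx
    refine ⟨Pi.single (t.equivFin ⟨x, hx⟩) 1, ?_⟩
    rw [mulVecRight_apply, Matrix.mulVec_single_one]
    ext1 i
    simp [hc]

theorem HasNegativeSquares.unique {κ κ' : ℕ} (h : HasNegativeSquares K V κ)
    (h' : HasNegativeSquares K V κ') : κ = κ' := by
  obtain ⟨-, h1, n, z, c, hz, h2⟩ := h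
  obtain ⟨-, h1', n', z', c', hz', h2'⟩ := h'
  exact le_antisymm (h2 ▸ h1' n z c hz) (h2' ▸ h1 n' z' c' hz')

end NegativeSquares

/-! ### Finite dimensional reproducing kernel Pontryagin spaces -/

section ReproducingKernel

variable {N : ℕ} {V : Set ℍ[ℝ]} {K : ℍ[ℝ] → ℍ[ℝ] → Matrix (Fin N) (Fin N) ℍ[ℝ]}

/-- The kernel functions. -/
noncomputable def kernelFun (V : Set ℍ[ℝ]) (K : ℍ[ℝ] → ℍ[ℝ] → Matrix (Fin N) (Fin N) ℍ[ℝ])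
    (x : V × (Fin N → ℍ[ℝ])) (p : V) : Fin N → ℍ[ℝ] := K p x.1 *ᵥ x.2

/-- The span of the kernel functions. -/
noncomputable def kernelSpan (V : Set ℍ[ℝ]) (K : ℍ[ℝ] → ℍ[ℝ] → Matrix (Fin N) (Fin N) ℍ[ℝ]) :
    Submodule ℍ[ℝ]ᵐᵒᵖ (V → Fin N → ℍ[ℝ]) :=
  Submodule.span ℍ[ℝ]ᵐᵒᵖ (Set.range (kernelFun V K))

/-- The pairing of a function with a formal combination of kernel functions. -/
noncomputable def formalPairing (f : V → Fin N → ℍ[ℝ])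
    (c : V × (Fin N → ℍ[ℝ]) →₀ ℍ[ℝ]ᵐᵒᵖ) : ℍ[ℝ] :=
  c.sum fun x a => star a.unop * (star x.2 ⬝ᵥ f x.1)

theorem formalPairing_linearCombination (c d : V × (Fin N → ℍ[ℝ]) →₀ ℍ[ℝ]ᵐᵒᵖ) :
    formalPairing (Finsupp.linearCombination ℍ[ℝ]ᵐᵒᵖ (kernelFun V K) d) c =
      ∑ x ∈ c.support, ∑ y ∈ d.support,
        star (c x).unop * (star x.2 ⬝ᵥ (K x.1 y.1 *ᵥ y.2)) * (d y).unop := by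
  refine Finset.sum_congr rfl fun x _ => ?_
  dsimp only
  rw [Finsupp.linearCombination_apply, Finsupp.sum, Finset.sum_apply, dotProduct_sum,
    Finset.mul_sum]
  refine Finset.sum_congr rfl fun y _ => ?_
  rw [mul_assoc]
  congr 1
  exact dotProduct_op_smul _ _ (d y).unop

theorem star_dotProduct_kernel (hK : ∀ z ∈ V, ∀ w ∈ V, K z w = (K w z)ᴴ) (z w : V)
    (c d : Fin N → ℍ[ℝ]) : star (star c ⬝ᵥ (K z w *ᵥ d)) = star d ⬝ᵥ (K w z *ᵥ c) := by
  rw [star_dotProduct_star, hK z z.2 w w.2, star_dotProduct_mulVec]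

theorem formalPairing_symm (hK : ∀ z ∈ V, ∀ w ∈ V, K z w = (K w z)ᴴ)
    (c d : V × (Fin N → ℍ[ℝ]) →₀ ℍ[ℝ]ᵐᵒᵖ) :
    formalPairing (Finsupp.linearCombination ℍ[ℝ]ᵐᵒᵖ (kernelFun V K) d) c =
      star (formalPairing (Finsupp.linearCombination ℍ[ℝ]ᵐᵒᵖ (kernelFun V K) c) d) := by
  rw [formalPairing_linearCombination, formalPairing_linearCombination, star_sum, Finset.sum_comm]
  refine Finset.sum_congr rfl fun y _ => ?_
  rw [star_sum]
  refine Finset.sum_congr rfl fun x _ => ?_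
  rw [star_mul, star_mul, star_star, star_dotProduct_kernel hK, mul_assoc]

/-- Formal representations of the elements of the span of the kernel functions. -/
theorem exists_formal (f : kernelSpan V K) :
    ∃ c, Finsupp.linearCombination ℍ[ℝ]ᵐᵒᵖ (kernelFun V K) c = f :=
  (Finsupp.mem_span_range_iff_exists_finsupp).mp f.2

/-- The form chooses a formal combination representing its second argument. The choice is harmless:
by `formalPairing_symm` the value is the conjugate of an expression in which that argument enters
only as a function. -/
theorem isHermForm_formalPairing (hK : ∀ z ∈ V, ∀ w ∈ V, K z w = (K w z)ᴴ) :
    IsHermForm fun f g : kernelSpan V K => formalPairing (f : V → Fin N → ℍ[ℝ])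
      (exists_formal g).choose where
  add_left u v w := by
    simp [formalPairing, Finsupp.sum, dotProduct_add, mul_add, Finset.sum_add_distrib]
  smul_left a v w := by
    simp only [formalPairing, Finsupp.sum, Submodule.coe_smul, Pi.smul_apply, Finset.sum_mul,
      dotProduct_op_smul, mul_assoc]
  conj_symm v w := by
    have h := formalPairing_symm hK (exists_formal v).choose (exists_formal w).choose
    rwa [(exists_formal v).choose_spec, (exists_formal w).choose_spec] at h

theorem kernelFun_mem (x : V × (Fin N → ℍ[ℝ])) : kernelFun V K x ∈ kernelSpan V K :=
  Submodule.subset_span ⟨x, rfl⟩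

theorem formalPairing_kernelFun (hK : ∀ z ∈ V, ∀ w ∈ V, K z w = (K w z)ᴴ) (f : kernelSpan V K)
    (x : V × (Fin N → ℍ[ℝ])) :
    formalPairing (f : V → Fin N → ℍ[ℝ])
      (exists_formal ⟨kernelFun V K x, kernelFun_mem x⟩).choose =
        star x.2 ⬝ᵥ (f : V → Fin N → ℍ[ℝ]) x.1 := by
  have h := formalPairing_symm hK (exists_formal ⟨kernelFun V K x, kernelFun_mem x⟩).choose
    (exists_formal f).choose
  have h1 : Finsupp.linearCombination ℍ[ℝ]ᵐᵒᵖ (kernelFun V K) (Finsupp.single x 1) =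
      kernelFun V K x := by simp
  have h2 := formalPairing_symm hK (Finsupp.single x 1) (exists_formal f).choose
  rw [(exists_formal f).choose_spec] at h h2
  rw [h, (exists_formal ⟨kernelFun V K x, kernelFun_mem x⟩).choose_spec]
  change star (formalPairing (kernelFun V K x) _) = _
  rw [← h1, ← h2, formalPairing, Finsupp.sum_single_index (by simp)]
  simp

theorem eq_zero_of_star_dotProduct {v : Fin N → ℍ[ℝ]} (h : ∀ a, star a ⬝ᵥ v = 0) : v = 0 := by
  ext1 i
  have := h (Pi.single i 1)
  simpa using this

/-- A Hermitian kernel of finite rank has a finite dimensional reproducing kernel Pontryagin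
space. -/
theorem exists_reproducingKernelPontryaginSpace (hK : ∀ z ∈ V, ∀ w ∈ V, K z w = (K w z)ᴴ)
    [Module.Finite ℍ[ℝ]ᵐᵒᵖ (kernelSpan V K)] :
    ∃ R : ReproducingKernelPontryaginSpace V K, Module.Finite ℍ[ℝ]ᵐᵒᵖ R.carrier :=
  ⟨{ carrier := kernelSpan V K
     inner := (isHermForm_formalPairing hK).pontryaginForm fun f hf => by
       ext1
       funext q
       exact eq_zero_of_star_dotProduct fun a =>
         (formalPairing_kernelFun hK f (q, a)).symm.trans (hf _)
     kernel_mem := fun q a => kernelFun_mem (q, a)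
     reproducing := fun f q a => formalPairing_kernelFun hK f (q, a) }, inferInstance⟩

namespace ReproducingKernelPontryaginSpace

variable (R : ReproducingKernelPontryaginSpace V K)

/-- The kernel functions as elements of the reproducing kernel space. -/
noncomputable def kernelElem (x : V × (Fin N → ℍ[ℝ])) : R.carrier := ⟨kernelFun V K x, R.kernel_mem x.1 x.2⟩

theorem form_kernelElem (f : R.carrier) (q : V) (a : Fin N → ℍ[ℝ]) :
    R.inner.form f (R.kernelElem (q, a)) = star a ⬝ᵥ (f : V → Fin N → ℍ[ℝ]) q :=
  R.reproducing f q a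

theorem eq_zero_of_orthogonal (f : R.carrier)
    (h : ∀ g ∈ Submodule.span ℍ[ℝ]ᵐᵒᵖ (Set.range R.kernelElem), R.inner.form f g = 0) : f = 0 := by
  ext1
  funext q
  exact eq_zero_of_star_dotProduct fun a =>
    (R.form_kernelElem f q a).symm.trans (h _ (Submodule.subset_span ⟨(q, a), rfl⟩))

/-- By the reproducing property nothing nonzero is orthogonal to all kernel functions, so a finite
dimensional span of them exhausts the space. This settles the claim about every space with the given
kernel. -/
theorem finite_of_finite_kernelSpan [Module.Finite ℍ[ℝ]ᵐᵒᵖ (kernelSpan V K)] :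
    Module.Finite ℍ[ℝ]ᵐᵒᵖ R.carrier := by
  have hmap : (Submodule.span ℍ[ℝ]ᵐᵒᵖ (Set.range R.kernelElem)).map R.carrier.subtype =
      kernelSpan V K := by
    rw [Submodule.map_span, ← Set.range_comp]
    rfl
  have : Module.Finite ℍ[ℝ]ᵐᵒᵖ (Submodule.span ℍ[ℝ]ᵐᵒᵖ (Set.range R.kernelElem)) := by
    have h := Submodule.equivMapOfInjective R.carrier.subtype R.carrier.injective_subtype
      (Submodule.span ℍ[ℝ]ᵐᵒᵖ (Set.range R.kernelElem))
    rw [hmap] at h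
    exact Module.Finite.equiv h.symm
  exact (R.inner.isHermForm.finite_and_eq_top_of_orthogonal _ R.eq_zero_of_orthogonal).1

theorem span_kernelElem [Module.Finite ℍ[ℝ]ᵐᵒᵖ R.carrier] :
    Submodule.span ℍ[ℝ]ᵐᵒᵖ (Set.range R.kernelElem) = ⊤ :=
  (R.inner.isHermForm.finite_and_eq_top_of_orthogonal _ R.eq_zero_of_orthogonal).2

/-- The elements of a finite dimensional space with separately continuous kernel are continuous. -/
theorem continuous_of_finite [Module.Finite ℍ[ℝ]ᵐᵒᵖ R.carrier]
    (hc : ∀ q ∈ V, ∀ i j, ContinuousOn (fun p => K p q i j) V) (f : R.carrier) :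
    Continuous (f : V → Fin N → ℍ[ℝ]) := by
  have hf : f ∈ Submodule.span ℍ[ℝ]ᵐᵒᵖ (Set.range R.kernelElem) := R.span_kernelElem ▸ trivial
  induction hf using Submodule.span_induction with
  | mem x hx =>
    obtain ⟨⟨q, a⟩, rfl⟩ := hx
    refine continuous_pi fun i => ?_
    have h : ∀ j, Continuous fun p : V => K p q i j := fun j => (hc q q.2 i j).domRestrict
    change Continuous fun p : V => ∑ j, K p q i j * a j
    exact continuous_finsetSum _ fun j _ => (h j).mul continuous_const
  | zero => exact continuous_zero
  | add x y _ _ hx hy => exact hx.add hy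
  | smul a x _ hx => exact hx.const_smul a

end ReproducingKernelPontryaginSpace

end ReproducingKernel

/-! ### From operators on a Pontryagin space to matrices -/

section Coordinates

/-- The matrix of a right linear map. -/
noncomputable def matrixOf {m n : ℕ} (T : (Fin m → ℍ[ℝ]) →ₗ[ℍ[ℝ]ᵐᵒᵖ] (Fin n → ℍ[ℝ])) :
    Matrix (Fin n) (Fin m) ℍ[ℝ] :=
  Matrix.of fun i j => T (Pi.single j 1) i

theorem matrixOf_mulVec {m n : ℕ} (T : (Fin m → ℍ[ℝ]) →ₗ[ℍ[ℝ]ᵐᵒᵖ] (Fin n → ℍ[ℝ]))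
    (v : Fin m → ℍ[ℝ]) : matrixOf T *ᵥ v = T v := by
  have hv : v = ∑ j, MulOpposite.op (v j) • (Pi.single j 1 : Fin m → ℍ[ℝ]) := by
    ext1 i
    simp [Finset.sum_apply, Pi.single_apply]
  conv_rhs => rw [hv]
  rw [map_sum]
  ext1 i
  simp [Matrix.mulVec, dotProduct, matrixOf, map_smul]

theorem matrix_ext_mulVec {m n : ℕ} {X Y : Matrix (Fin n) (Fin m) ℍ[ℝ]}
    (h : ∀ v, X *ᵥ v = Y *ᵥ v) : X = Y := by
  ext1 i j
  have := congrFun (h (Pi.single j 1)) i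
  simpa using this

theorem isUnit_of_mulVec_injective {n : ℕ} {X : Matrix (Fin n) (Fin n) ℍ[ℝ]}
    (h : ∀ v, X *ᵥ v = 0 → v = 0) : IsUnit X := by
  have hinj : Function.Injective (mulVecRight X) := (injective_iff_map_eq_zero _).mpr h
  let e := LinearEquiv.ofInjectiveEndo (mulVecRight X) hinj
  have h1 : X * matrixOf (e.symm : (Fin n → ℍ[ℝ]) →ₗ[ℍ[ℝ]ᵐᵒᵖ] (Fin n → ℍ[ℝ])) = 1 := by
    refine matrix_ext_mulVec fun v => ?_
    rw [← Matrix.mulVec_mulVec, matrixOf_mulVec, Matrix.one_mulVec]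
    exact e.apply_symm_apply v
  refine ⟨⟨X, _, h1, matrix_ext_mulVec fun v => hinj ?_⟩, rfl⟩
  rw [mulVecRight_apply, Matrix.mulVec_mulVec, ← mul_assoc, h1, one_mul, Matrix.one_mulVec,
    mulVecRight_apply]

theorem matrix_ext_dotProduct {m n : ℕ} {X Y : Matrix (Fin n) (Fin m) ℍ[ℝ]}
    (h : ∀ v w, star w ⬝ᵥ (X *ᵥ v) = star w ⬝ᵥ (Y *ᵥ v)) : X = Y :=
  matrix_ext_mulVec fun v => sub_eq_zero.mp <| eq_zero_of_star_dotProduct fun w => by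
    rw [dotProduct_sub, h, sub_self]

variable {P : Type*} [AddCommGroup P] [Module ℍ[ℝ]ᵐᵒᵖ P] {n : ℕ}

/-- The Gram matrix of a form in a basis. -/
noncomputable def gramMatrix (b : P → P → ℍ[ℝ]) (e : Module.Basis (Fin n) ℍ[ℝ]ᵐᵒᵖ P) :
    Matrix (Fin n) (Fin n) ℍ[ℝ] :=
  Matrix.of fun i j => b (e j) (e i)

variable {b : P → P → ℍ[ℝ]} (hb : IsHermForm b) (e : Module.Basis (Fin n) ℍ[ℝ]ᵐᵒᵖ P)
include hb

theorem isHermitian_gramMatrix : (gramMatrix b e).IsHermitian := by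
  ext1 i j
  exact (hb.conj_symm _ _).symm

theorem matForm_gramMatrix (v w : P) :
    matForm (gramMatrix b e) (coordEquiv e v) (coordEquiv e w) = b v w := by
  conv_rhs => rw [← sum_coordEquiv e v, ← sum_coordEquiv e w, hb.sum_right]
  simp only [hb.sum_left, hb.smul_left, hb.smul_right, matForm, dotProduct, Matrix.mulVec,
    Finset.mul_sum, gramMatrix, Matrix.of_apply, Pi.star_apply, mul_assoc]

theorem isUnit_gramMatrix (h : ∀ v, (∀ w, b v w = 0) → v = 0) : IsUnit (gramMatrix b e) := by
  refine isUnit_of_mulVec_injective fun v hv => ?_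
  obtain ⟨v, rfl⟩ := (coordEquiv e).surjective v
  rw [h v fun w => ?_, map_zero]
  rw [← matForm_gramMatrix hb e, matForm, hv, dotProduct_zero]

omit hb

variable {N M : ℕ}

/-- The matrices of the blocks of a colligation. -/
noncomputable def coordA (e : Module.Basis (Fin n) ℍ[ℝ]ᵐᵒᵖ P) (A : P →ₗ[ℍ[ℝ]ᵐᵒᵖ] P) :
    Matrix (Fin n) (Fin n) ℍ[ℝ] :=
  matrixOf ((coordEquiv e).toLinearMap ∘ₗ A ∘ₗ (coordEquiv e).symm.toLinearMap)

noncomputable def coordB (e : Module.Basis (Fin n) ℍ[ℝ]ᵐᵒᵖ P)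
    (B : (Fin M → ℍ[ℝ]) →ₗ[ℍ[ℝ]ᵐᵒᵖ] P) : Matrix (Fin n) (Fin M) ℍ[ℝ] :=
  matrixOf ((coordEquiv e).toLinearMap ∘ₗ B)

noncomputable def coordC (e : Module.Basis (Fin n) ℍ[ℝ]ᵐᵒᵖ P)
    (C : P →ₗ[ℍ[ℝ]ᵐᵒᵖ] (Fin N → ℍ[ℝ])) : Matrix (Fin N) (Fin n) ℍ[ℝ] :=
  matrixOf (C ∘ₗ (coordEquiv e).symm.toLinearMap)

theorem coordA_mulVec (A : P →ₗ[ℍ[ℝ]ᵐᵒᵖ] P) (x : P) :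
    coordA e A *ᵥ coordEquiv e x = coordEquiv e (A x) := by
  simp [coordA, matrixOf_mulVec]

theorem coordB_mulVec (B : (Fin M → ℍ[ℝ]) →ₗ[ℍ[ℝ]ᵐᵒᵖ] P) (u : Fin M → ℍ[ℝ]) :
    coordB e B *ᵥ u = coordEquiv e (B u) := by
  simp [coordB, matrixOf_mulVec]

theorem coordC_mulVec (C : P →ₗ[ℍ[ℝ]ᵐᵒᵖ] (Fin N → ℍ[ℝ])) (x : P) :
    coordC e C *ᵥ coordEquiv e x = C x := by
  simp [coordC, matrixOf_mulVec]

theorem op_coe_smul_eq {m : ℕ} (r : ℝ) (v : Fin m → ℍ[ℝ]) :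
    MulOpposite.op (r : ℍ[ℝ]) • v = r • v := by
  ext1 i
  simp [← Quaternion.coe_commutes, Quaternion.coe_mul_eq_smul]

theorem pencil_coordA_mulVec (A : P →ₗ[ℍ[ℝ]ᵐᵒᵖ] P) (p : ℍ[ℝ]) (x : P) :
    pencil (coordA e A) p *ᵥ coordEquiv e x = coordEquiv e (opPencil A p x) := by
  change _ = coordEquiv e (x - MulOpposite.op ((2 * p.re : ℝ) : ℍ[ℝ]) • A x
    + MulOpposite.op ((‖p‖ ^ 2 : ℝ) : ℍ[ℝ]) • A (A x))
  rw [map_add, map_sub, map_smul, map_smul, op_coe_smul_eq, op_coe_smul_eq, pencil,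
    Matrix.add_mulVec, Matrix.sub_mulVec, Matrix.smul_mulVec, Matrix.smul_mulVec,
    ← Matrix.mulVec_mulVec, coordA_mulVec, coordA_mulVec, Matrix.one_mulVec]

theorem isUnit_opPencil {A : P →ₗ[ℍ[ℝ]ᵐᵒᵖ] P} {p : ℍ[ℝ]} (hp : IsUnit (pencil (coordA e A) p)) :
    IsUnit (opPencil A p : Module.End ℍ[ℝ]ᵐᵒᵖ P) := by
  have : Module.Finite ℍ[ℝ]ᵐᵒᵖ P := Module.Finite.of_basis e
  have hinj : Function.Injective (opPencil A p) := by
    rw [injective_iff_map_eq_zero]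
    intro x hx
    have h1 := pencil_coordA_mulVec e A p x
    rw [hx, map_zero] at h1
    obtain ⟨u, hu⟩ := hp
    rw [← hu] at h1
    have h2 := congrArg (fun y => (↑u⁻¹ : Matrix (Fin n) (Fin n) ℍ[ℝ]) *ᵥ y) h1
    simpa [Matrix.mulVec_mulVec] using h2
  exact (Module.End.isUnit_iff _).mpr ⟨hinj, LinearMap.surjective_of_injective hinj⟩

theorem starEval_mulVec {A : P →ₗ[ℍ[ℝ]ᵐᵒᵖ] P} {p : ℍ[ℝ]} (hp : IsUnit (pencil (coordA e A) p))
    (C : P →ₗ[ℍ[ℝ]ᵐᵒᵖ] (Fin N → ℍ[ℝ])) (x : P) :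
    starEval (coordC e C) (coordA e A) p *ᵥ coordEquiv e x = opStarResolvent C A p x := by
  have hu := isUnit_opPencil e hp
  set y := Ring.inverse (opPencil A p : Module.End ℍ[ℝ]ᵐᵒᵖ P) x with hy
  have hx : opPencil A p y = x :=
    LinearMap.congr_fun (Ring.mul_inverse_cancel (opPencil A p : Module.End ℍ[ℝ]ᵐᵒᵖ P) hu) x
  have h1 : Ring.inverse (pencil (coordA e A) p) *ᵥ coordEquiv e x = coordEquiv e y := by
    conv_lhs => rw [← hx]
    rw [← pencil_coordA_mulVec, Matrix.mulVec_mulVec, Ring.inverse_mul_cancel _ hp,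
      Matrix.one_mulVec]
  rw [starEval, ← Matrix.mulVec_mulVec, h1, Matrix.sub_mulVec, Matrix.smul_mulVec,
    ← Matrix.mulVec_mulVec, coordA_mulVec, coordC_mulVec, coordC_mulVec, opStarResolvent]

theorem transferFunction_of_realization {V : Set ℍ[ℝ]} {s : ℍ[ℝ] → Matrix (Fin N) (Fin M) ℍ[ℝ]}
    {A : P →ₗ[ℍ[ℝ]ᵐᵒᵖ] P} {B : (Fin M → ℍ[ℝ]) →ₗ[ℍ[ℝ]ᵐᵒᵖ] P} {C : P →ₗ[ℍ[ℝ]ᵐᵒᵖ] (Fin N → ℍ[ℝ])}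
    {D : (Fin M → ℍ[ℝ]) →ₗ[ℍ[ℝ]ᵐᵒᵖ] (Fin N → ℍ[ℝ])} (h : IsOpRealizationOn V s A B C D) {p : ℍ[ℝ]}
    (hp : p ∈ V) (hu : IsUnit (pencil (coordA e A) p)) :
    s p = transferFunction (coordA e A) (coordB e B) (coordC e C) (matrixOf D) p := by
  refine matrix_ext_mulVec fun u => ?_
  rw [h p hp (isUnit_opPencil e hu), transferFunction_eq, Matrix.add_mulVec, Matrix.smul_mulVec,
    ← Matrix.mulVec_mulVec, coordB_mulVec, starEval_mulVec e hu, matrixOf_mulVec]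

/-- The matrices of a coisometric colligation. -/
theorem colligationRelation_of_isCoisometric {Φ : PontryaginForm P}
    {J₁ : Matrix (Fin M) (Fin M) ℍ[ℝ]} {J₂ : Matrix (Fin N) (Fin N) ℍ[ℝ]}
    {A : P →ₗ[ℍ[ℝ]ᵐᵒᵖ] P} {B : (Fin M → ℍ[ℝ]) →ₗ[ℍ[ℝ]ᵐᵒᵖ] P} {C : P →ₗ[ℍ[ℝ]ᵐᵒᵖ] (Fin N → ℍ[ℝ])}
    {D : (Fin M → ℍ[ℝ]) →ₗ[ℍ[ℝ]ᵐᵒᵖ] (Fin N → ℍ[ℝ])}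
    (h : IsCoisometric Φ J₁ J₂ ((A.coprod B).prod (C.coprod D))) :
    ColligationRelation (Ring.inverse (gramMatrix Φ.form e)) J₁ J₂ (coordA e A) (coordB e B)
      (coordC e C) (matrixOf D) := by
  obtain ⟨T', hadj, hT⟩ := h
  have hb := Φ.isHermForm
  have hG := isHermitian_gramMatrix hb e
  have hu := isUnit_gramMatrix hb e Φ.nondegenerate
  have hf := matForm_gramMatrix hb e
  set G := gramMatrix Φ.form e
  set a := coordA e A
  set b := coordB e B
  set c := coordC e C
  set d := matrixOf D
  set a' := coordA e (LinearMap.fst _ _ _ ∘ₗ T' ∘ₗ LinearMap.inl _ _ _)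
  set b' := coordC e (LinearMap.snd _ _ _ ∘ₗ T' ∘ₗ LinearMap.inl _ _ _)
  set c' := coordB e (LinearMap.fst _ _ _ ∘ₗ T' ∘ₗ LinearMap.inr _ _ _)
  set d' := matrixOf (LinearMap.snd _ _ _ ∘ₗ T' ∘ₗ LinearMap.inr _ _ _)
  have ea : ∀ x, a *ᵥ coordEquiv e x = coordEquiv e (A x) := coordA_mulVec e A
  have eb : ∀ u, b *ᵥ u = coordEquiv e (B u) := coordB_mulVec e B
  have ec : ∀ x, c *ᵥ coordEquiv e x = C x := coordC_mulVec e C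
  have ed : ∀ u, d *ᵥ u = D u := matrixOf_mulVec D
  have ea' : ∀ y, a' *ᵥ coordEquiv e y = coordEquiv e (T' (y, 0)).1 := coordA_mulVec e _
  have eb' : ∀ y, b' *ᵥ coordEquiv e y = (T' (y, 0)).2 := coordC_mulVec e _
  have ec' : ∀ v, c' *ᵥ v = coordEquiv e (T' (0, v)).1 := coordB_mulVec e _
  have ed' : ∀ v, d' *ᵥ v = (T' (0, v)).2 := matrixOf_mulVec _
  have hsurj := (coordEquiv e).surjective
  -- The adjoint relation in coordinates, block by block: `G` appears on the state space, the
  -- identity on `ℍᴺ` and `ℍᴹ`.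
  have r1 : G * a = a'ᴴ * G := by
    refine matrix_ext_dotProduct fun v w => ?_
    obtain ⟨x, rfl⟩ := hsurj v
    obtain ⟨y, rfl⟩ := hsurj w
    have := hadj (x, 0) (y, 0)
    simp only [sumForm, LinearMap.prod_apply, Function.prod_apply, LinearMap.coprod_apply, map_zero, add_zero,
      star_zero, zero_dotProduct, dotProduct_zero, ← hf, matForm, dotProduct_zero] at this
    rw [← Matrix.mulVec_mulVec, ← Matrix.mulVec_mulVec, star_dotProduct_mulVec a'ᴴ,
      Matrix.conjTranspose_conjTranspose, ea, ea', this]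
  have r2 : G * b = b'ᴴ := by
    refine matrix_ext_dotProduct fun v w => ?_
    obtain ⟨y, rfl⟩ := hsurj w
    have := hadj (0, v) (y, 0)
    simp only [sumForm, LinearMap.prod_apply, Function.prod_apply, LinearMap.coprod_apply, map_zero,
      add_zero, zero_add, star_zero, zero_dotProduct, ← hf, matForm, Matrix.mulVec_zero,
      dotProduct_zero] at this
    rw [← Matrix.mulVec_mulVec, star_dotProduct_mulVec b'ᴴ,
      Matrix.conjTranspose_conjTranspose, eb, eb', this]
  have r3 : c = c'ᴴ * G := by
    refine matrix_ext_dotProduct fun v w => ?_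
    obtain ⟨x, rfl⟩ := hsurj v
    have := hadj (x, 0) (0, w)
    simp only [sumForm, LinearMap.prod_apply, Function.prod_apply, LinearMap.coprod_apply, map_zero,
      add_zero, zero_add, star_zero, zero_dotProduct, ← hf, matForm, dotProduct_zero] at this
    rw [← Matrix.mulVec_mulVec, star_dotProduct_mulVec c'ᴴ,
      Matrix.conjTranspose_conjTranspose, ec, ec', this]
  have r4 : d = d'ᴴ := by
    refine matrix_ext_dotProduct fun v w => ?_
    have := hadj (0, v) (0, w)
    simp only [sumForm, LinearMap.prod_apply, Function.prod_apply, LinearMap.coprod_apply, map_zero,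
      zero_add, star_zero, zero_dotProduct, ← hf, matForm, Matrix.mulVec_zero, dotProduct_zero]
      at this
    rw [star_dotProduct_mulVec d'ᴴ, Matrix.conjTranspose_conjTranspose, ed, ed', this]
  have k1 : a * a' + b * J₁ * b' = 1 := by
    refine matrix_ext_mulVec fun v => ?_
    obtain ⟨y, rfl⟩ := hsurj v
    have := congrArg (fun z => coordEquiv e z.1) (hT (y, 0))
    simp only [LinearMap.prod_apply, Function.prod_apply, LinearMap.coprod_apply, map_add] at this
    simp only [Matrix.add_mulVec, ← Matrix.mulVec_mulVec, ea', eb', ea, eb, this, Matrix.one_mulVec]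
  have k2 : c * a' + d * J₁ * b' = 0 := by
    refine matrix_ext_mulVec fun v => ?_
    obtain ⟨y, rfl⟩ := hsurj v
    have := congrArg Prod.snd (hT (y, 0))
    simp only [LinearMap.prod_apply, Function.prod_apply, LinearMap.coprod_apply, Matrix.mulVec_zero] at this
    simp only [Matrix.add_mulVec, ← Matrix.mulVec_mulVec, ea', eb', ec, ed, this, Matrix.zero_mulVec]
  have k3 : a * c' + b * J₁ * d' = 0 := by
    refine matrix_ext_mulVec fun v => ?_
    have := congrArg (fun z => coordEquiv e z.1) (hT (0, v))
    simp only [LinearMap.prod_apply, Function.prod_apply, LinearMap.coprod_apply, map_add, map_zero] at this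
    simp only [Matrix.add_mulVec, ← Matrix.mulVec_mulVec, ec', ed', ea, eb, this, Matrix.zero_mulVec]
  have k4 : c * c' + d * J₁ * d' = J₂ := by
    refine matrix_ext_mulVec fun v => ?_
    have := congrArg Prod.snd (hT (0, v))
    simp only [LinearMap.prod_apply, Function.prod_apply, LinearMap.coprod_apply] at this
    simp only [Matrix.add_mulVec, ← Matrix.mulVec_mulVec, ec', ed', ec, ed, this]
  -- Adjoints on the state space are conjugated by `G`, so rewriting the primed blocks through
  -- conjugate transposes puts `G⁻¹`, not `G`, in the colligation relation.
  set H := Ring.inverse G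
  have hHG : H * G = 1 := Ring.inverse_mul_cancel G hu
  have hGH : G * H = 1 := Ring.mul_inverse_cancel G hu
  have s1 : H * aᴴ = a' * H := by
    have := congrArg Matrix.conjTranspose r1
    rw [Matrix.conjTranspose_mul, Matrix.conjTranspose_mul, hG.eq,
      Matrix.conjTranspose_conjTranspose] at this
    calc H * aᴴ = H * (aᴴ * G) * H := by rw [mul_assoc, mul_assoc, hGH, mul_one]
      _ = a' * H := by rw [this, ← mul_assoc, hHG, one_mul]
  have s2 : bᴴ = b' * H := by
    have := congrArg Matrix.conjTranspose r2
    rw [Matrix.conjTranspose_mul, hG.eq, Matrix.conjTranspose_conjTranspose] at this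
    rw [← this, Matrix.mul_assoc, hGH, Matrix.mul_one]
  have s3 : H * cᴴ = c' := by
    rw [r3, Matrix.conjTranspose_mul, hG.eq, Matrix.conjTranspose_conjTranspose,
      ← Matrix.mul_assoc, hHG, Matrix.one_mul]
  have s4 : dᴴ = d' := by rw [r4, Matrix.conjTranspose_conjTranspose]
  rw [ColligationRelation, Matrix.fromBlocks_conjTranspose, Matrix.fromBlocks_multiply,
    Matrix.fromBlocks_multiply, Matrix.fromBlocks_inj]
  simp only [Matrix.mul_zero, add_zero, zero_add]
  refine ⟨?_, ?_, ?_, ?_⟩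
  · rw [Matrix.mul_assoc, s1, s2, ← Matrix.mul_assoc, ← Matrix.mul_assoc, ← Matrix.add_mul, k1,
      Matrix.one_mul]
  · rw [Matrix.mul_assoc, s3, s4, k3]
  · rw [Matrix.mul_assoc, s1, s2, ← Matrix.mul_assoc, ← Matrix.mul_assoc, ← Matrix.add_mul, k2,
      Matrix.zero_mul]
  · rw [Matrix.mul_assoc, s3, s4, k4]

end Coordinates

/-! ### Isometric relations between spaces of equal negative index -/

section Relations

variable {X Y : Type*} [AddCommGroup X] [Module ℍ[ℝ]ᵐᵒᵖ X] [AddCommGroup Y] [Module ℍ[ℝ]ᵐᵒᵖ Y]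
  {b : X → X → ℍ[ℝ]} {c : Y → Y → ℍ[ℝ]}

theorem IsHermForm.prod (hb : IsHermForm b) (hc : IsHermForm c) :
    IsHermForm fun x y : X × Y => b x.1 y.1 + c x.2 y.2 where
  add_left u v w := by
    rw [Prod.fst_add, Prod.snd_add, hb.add_left, hc.add_left]
    abel
  smul_left a v w := by rw [Prod.smul_fst, Prod.smul_snd, hb.smul_left, hc.smul_left, add_mul]
  conj_symm v w := by rw [hb.conj_symm, hc.conj_symm, star_add]

/-- A neutral vector orthogonal to a maximal negative subspace vanishes. -/
theorem eq_zero_of_neutral (hc : IsHermForm c) [Module.Finite ℍ[ℝ]ᵐᵒᵖ Y]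
    {Xm : Submodule ℍ[ℝ]ᵐᵒᵖ X} {Yp Ym : Submodule ℍ[ℝ]ᵐᵒᵖ Y}
    (hXm : ∀ x ∈ Xm, x ≠ 0 → (b x x).re < 0) (hY : Yp ⊔ Ym = ⊤)
    (hYp : ∀ y ∈ Yp, y ≠ 0 → 0 < (c y y).re)
    (hdim : Module.finrank ℍ[ℝ]ᵐᵒᵖ Ym = Module.finrank ℍ[ℝ]ᵐᵒᵖ Xm) {σ : X →ₗ[ℍ[ℝ]ᵐᵒᵖ] Y}
    (hσ : ∀ x, c (σ x) (σ x) = b x x) {y : Y} (hy : c y y = 0) (hyσ : ∀ x, c y (σ x) = 0) :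
    y = 0 := by
  have hinj : Function.Injective (σ.comp Xm.subtype) := by
    rw [injective_iff_map_eq_zero]
    intro x hx
    by_contra hne
    have h1 := hXm x x.2 fun h0 => hne (Subtype.ext h0)
    rw [← hσ, show σ (x : X) = 0 from hx, hc.zero_left] at h1
    simp at h1
  set U := LinearMap.range (σ.comp Xm.subtype)
  have hU : Module.finrank ℍ[ℝ]ᵐᵒᵖ U = Module.finrank ℍ[ℝ]ᵐᵒᵖ Xm :=
    LinearMap.finrank_range_of_inj hinj
  -- Adjoining `y` to the negative subspace `U` keeps the form nonpositive, but `U` already has the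
  -- largest possible dimension. So `y` lies in `U`, where the only neutral vector is `0`.
  have hW : Module.finrank ℍ[ℝ]ᵐᵒᵖ ↥(U ⊔ Submodule.span ℍ[ℝ]ᵐᵒᵖ {y}) ≤
      Module.finrank ℍ[ℝ]ᵐᵒᵖ Ym := by
    refine finrank_le_of_nonpos hY hYp fun w hw => ?_
    obtain ⟨_, ⟨x, rfl⟩, z, hz, rfl⟩ := Submodule.mem_sup.mp hw
    obtain ⟨a, rfl⟩ := Submodule.mem_span_singleton.mp hz
    obtain ⟨a, rfl⟩ := MulOpposite.op_surjective a
    rw [LinearMap.comp_apply, Submodule.subtype_apply, hc.re_add_self_of_orthogonal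
      (hc.eq_zero_symm (by rw [hc.smul_left, hyσ, zero_mul])), hc.re_smul_self, hy, hσ]
    by_cases hx : (x : X) = 0
    · rw [hx, ← hσ, map_zero, hc.zero_left]
      simp
    · simpa using (hXm x x.2 hx).le
  have heq := Submodule.eq_of_le_of_finrank_le
    (le_sup_left : U ≤ U ⊔ Submodule.span ℍ[ℝ]ᵐᵒᵖ {y}) (by rw [hU, ← hdim]; exact hW)
  have hyU : y ∈ U := by
    rw [heq]
    exact Submodule.mem_sup_right (Submodule.mem_span_singleton_self y)
  obtain ⟨x, rfl⟩ := hyU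
  by_contra hne
  have hx : (x : X) ≠ 0 := fun h0 => hne (by
    rw [LinearMap.comp_apply, Submodule.subtype_apply, h0, map_zero])
  have h1 := hXm x x.2 hx
  rw [← hσ, show c (σ (x : X)) (σ x) = 0 from hy] at h1
  simp at h1

/-- A densely defined isometric relation between spaces with the same finite negative index is the
graph of an isometry. -/
theorem exists_isometry_of_relation (hb : IsHermForm b) (hc : IsHermForm c)
    [Module.Finite ℍ[ℝ]ᵐᵒᵖ Y] {Xm : Submodule ℍ[ℝ]ᵐᵒᵖ X} {Yp Ym : Submodule ℍ[ℝ]ᵐᵒᵖ Y}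
    (hXm : ∀ x ∈ Xm, x ≠ 0 → (b x x).re < 0) (hY : Yp ⊔ Ym = ⊤)
    (hYp : ∀ y ∈ Yp, y ≠ 0 → 0 < (c y y).re)
    (hdim : Module.finrank ℍ[ℝ]ᵐᵒᵖ Ym = Module.finrank ℍ[ℝ]ᵐᵒᵖ Xm) {g : Set (X × Y)}
    (hg : ∀ r ∈ g, ∀ r' ∈ g, b r.1 r'.1 = c r.2 r'.2)
    (hdom : Submodule.map (LinearMap.fst ℍ[ℝ]ᵐᵒᵖ X Y) (Submodule.span ℍ[ℝ]ᵐᵒᵖ g) = ⊤) :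
    ∃ T : X →ₗ[ℍ[ℝ]ᵐᵒᵖ] Y, (∀ x x', c (T x) (T x') = b x x') ∧ ∀ r ∈ g, T r.1 = r.2 := by
  set S := Submodule.span ℍ[ℝ]ᵐᵒᵖ g
  have hd := hb.prod hc.neg
  have hS : ∀ r ∈ S, ∀ r' ∈ S, c r.2 r'.2 = b r.1 r'.1 := by
    intro r hr r' hr'
    have h1 : ∀ r ∈ g, ∀ r' ∈ S, b r.1 r'.1 + -c r.2 r'.2 = 0 := fun r hr r' hr' =>
      hd.eq_zero_of_span (v := r) (fun w hw => by rw [hg r hr w hw, add_neg_cancel]) hr'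
    have h2 := hd.eq_zero_of_span (v := r') (fun w hw => hd.eq_zero_symm (h1 w hw r' hr')) hr
    have h3 := hd.eq_zero_symm h2
    exact (eq_of_sub_eq_zero (by rwa [sub_eq_add_neg])).symm
  have hsurj : LinearMap.range ((LinearMap.fst ℍ[ℝ]ᵐᵒᵖ X Y).comp S.subtype) = ⊤ := by
    rw [LinearMap.range_comp, Submodule.range_subtype, hdom]
  obtain ⟨τ, hτ⟩ := LinearMap.exists_rightInverse_of_surjective _ hsurj
  have hτ' : ∀ x, (τ x : X × Y).1 = x := fun x => LinearMap.congr_fun hτ x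
  set T := (LinearMap.snd ℍ[ℝ]ᵐᵒᵖ X Y).comp (S.subtype.comp τ)
  have hT : ∀ x, (x, T x) ∈ S := fun x => by
    have : (x, T x) = (τ x : X × Y) := Prod.ext (hτ' x).symm rfl
    rw [this]
    exact (τ x).2
  refine ⟨T, fun x x' => hS _ (hT x) _ (hT x'), fun r hr => ?_⟩
  -- The relation contains `(0, r.2 - T r.1)`. Isometry makes its second entry neutral and
  -- orthogonal to the range of `T`, hence zero: the relation is single valued.
  have h1 := S.sub_mem (Submodule.subset_span hr) (hT r.1)
  have h2 : r - (r.1, T r.1) = (0, r.2 - T r.1) := Prod.ext (sub_self _) rfl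
  rw [h2] at h1
  refine (sub_eq_zero.mp (eq_zero_of_neutral (b := b) hc hXm hY hYp hdim (σ := T)
    (fun x => hS _ (hT x) _ (hT x)) ?_ fun x => ?_)).symm
  · exact (hS _ h1 _ h1).trans (hb.zero_left _)
  · exact (hS _ h1 _ (hT x)).trans (hb.zero_left _)

end Relations

/-! ### The backward shift colligation -/

section BackwardShift

theorem finrank_submodule_prod {X Y : Type*} [AddCommGroup X] [Module ℍ[ℝ]ᵐᵒᵖ X] [AddCommGroup Y]
    [Module ℍ[ℝ]ᵐᵒᵖ Y] [Module.Finite ℍ[ℝ]ᵐᵒᵖ X] [Module.Finite ℍ[ℝ]ᵐᵒᵖ Y]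
    (p : Submodule ℍ[ℝ]ᵐᵒᵖ X) (q : Submodule ℍ[ℝ]ᵐᵒᵖ Y) :
    Module.finrank ℍ[ℝ]ᵐᵒᵖ (p.prod q) = Module.finrank ℍ[ℝ]ᵐᵒᵖ p + Module.finrank ℍ[ℝ]ᵐᵒᵖ q := by
  have h : p.prod q = LinearMap.range (p.subtype.prodMap q.subtype) := by
    rw [LinearMap.range_prodMap, Submodule.range_subtype, Submodule.range_subtype]
  rw [h, LinearMap.finrank_range_of_inj, Module.finrank_prod]
  exact Function.Injective.prodMap p.injective_subtype q.injective_subtype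

variable {P : Type*} [AddCommGroup P] [Module ℍ[ℝ]ᵐᵒᵖ P]

/-- The negative index of the sum depends on `J` only through `sqNeg J`; here `sqNeg J₁ = sqNeg J₂`
will give both sides of the colligation the same index. -/
theorem exists_decomposition_prod [Module.Finite ℍ[ℝ]ᵐᵒᵖ P] {b : P → P → ℍ[ℝ]} (hb : IsHermForm b)
    {Pp Pm : Submodule ℍ[ℝ]ᵐᵒᵖ P} (hc : Pp ⊔ Pm = ⊤) (hp : ∀ v ∈ Pp, v ≠ 0 → 0 < (b v v).re)
    (hm : ∀ v ∈ Pm, v ≠ 0 → (b v v).re < 0) {N : ℕ} {J : Matrix (Fin N) (Fin N) ℍ[ℝ]}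
    (hJ : IsSignature J) : ∃ Yp Ym : Submodule ℍ[ℝ]ᵐᵒᵖ (P × (Fin N → ℍ[ℝ])), Yp ⊔ Ym = ⊤ ∧
      (∀ y ∈ Yp, y ≠ 0 → 0 < (b y.1 y.1 + matForm J y.2 y.2).re) ∧
      (∀ y ∈ Ym, y ≠ 0 → (b y.1 y.1 + matForm J y.2 y.2).re < 0) ∧
      Module.finrank ℍ[ℝ]ᵐᵒᵖ Ym = Module.finrank ℍ[ℝ]ᵐᵒᵖ Pm + sqNeg J := by
  have hbJ := isHermForm_matForm hJ.1
  obtain ⟨Np, Nm, hNc, hNp, hNm, hdim⟩ := exists_decomposition_sqNeg hJ.1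
    (IsUnit.of_mul_eq_one J hJ.2)
  refine ⟨Pp.prod Np, Pm.prod Nm, ?_, fun y hy hne => ?_, fun y hy hne => ?_, ?_⟩
  · rw [Submodule.prod_sup_prod, hc, hNc, Submodule.prod_top]
  · rw [Quaternion.re_add]
    by_cases h1 : y.1 = 0
    · have h2 : y.2 ≠ 0 := fun h2 => hne (Prod.ext h1 h2)
      simpa [h1, hb.zero_left] using hNp _ hy.2 h2
    · have h3 := hp _ hy.1 h1
      by_cases h2 : y.2 = 0
      · simpa [h2, hbJ.zero_left] using h3
      · exact add_pos h3 (hNp _ hy.2 h2)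
  · rw [Quaternion.re_add]
    by_cases h1 : y.1 = 0
    · have h2 : y.2 ≠ 0 := fun h2 => hne (Prod.ext h1 h2)
      simpa [h1, hb.zero_left] using hNm _ hy.2 h2
    · have h3 := hm _ hy.1 h1
      by_cases h2 : y.2 = 0
      · simpa [h2, hbJ.zero_left] using h3
      · exact add_neg h3 (hNm _ hy.2 h2)
  · rw [finrank_submodule_prod, hdim]

theorem star_smul_dotProduct {N : ℕ} (q : ℍ[ℝ]) (u v : Fin N → ℍ[ℝ]) :
    star (star q • u) ⬝ᵥ v = star u ⬝ᵥ (q • v) := by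
  simp [dotProduct, mul_assoc]

theorem op_smul_mulVec {N M : ℕ} (q : ℍ[ℝ]) (K : Matrix (Fin N) (Fin M) ℍ[ℝ]) (u : Fin M → ℍ[ℝ]) :
    (MulOpposite.op q • K) *ᵥ u = K *ᵥ (q • u) := by
  ext1 i
  simp [Matrix.mulVec, dotProduct, mul_assoc]

theorem eq_zero_of_continuous {N : ℕ} {V D : Set ℍ[ℝ]} (hD : ∀ p ∈ V, p ∈ closure {q ∈ V | q ∈ D})
    {f : V → Fin N → ℍ[ℝ]} (hf : Continuous f) (h0 : ∀ q : V, (q : ℍ[ℝ]) ∈ D → f q = 0) : f = 0 := by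
  funext p
  have hcl : IsClosed {q : V | f q = 0} := isClosed_eq hf continuous_const
  have hp : p ∈ closure {q : V | (q : ℍ[ℝ]) ∈ D} := by
    rw [closure_subtype]
    refine closure_mono ?_ (hD p p.2)
    rintro q ⟨hq, hqD⟩
    exact ⟨⟨q, hq⟩, hqD, rfl⟩
  exact closure_minimal (fun q hq => h0 q hq) hcl hp

variable {N M : ℕ} {J₂ : Matrix (Fin N) (Fin N) ℍ[ℝ]} {J₁ : Matrix (Fin M) (Fin M) ℍ[ℝ]} {V : Set ℍ[ℝ]}
  {s : ℍ[ℝ] → Matrix (Fin N) (Fin M) ℍ[ℝ]} {κ : ℕ}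

theorem IsGeneralizedSchur.norm_lt_one (hs : IsGeneralizedSchur J₂ J₁ V s κ) (q : V) :
    ‖(q : ℍ[ℝ])‖ < 1 := mem_ball_zero_iff.mp (hs.subset_ball q.2)

theorem IsGeneralizedSchur.continuousOn (hs : IsGeneralizedSchur J₂ J₁ V s κ) :
    ∀ q ∈ V, ∀ i j, ContinuousOn (fun p => schurKernel J₂ J₁ s p q i j) V :=
  fun q hq => continuousOn_schurKernel hs.isOpen hs.subset_ball hs.sliceHyperholomorphic
    (hs.norm_lt_one ⟨q, hq⟩)

/-- The kernel functions at nonzero points span the space. -/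
theorem span_kernelElem_ne_zero (hs : IsGeneralizedSchur J₂ J₁ V s κ)
    (R : ReproducingKernelPontryaginSpace V (schurKernel J₂ J₁ s))
    [Module.Finite ℍ[ℝ]ᵐᵒᵖ R.carrier] {L : Submodule ℍ[ℝ]ᵐᵒᵖ R.carrier}
    (hL : ∀ q : V, (q : ℍ[ℝ]) ≠ 0 → ∀ u, R.kernelElem (q, u) ∈ L) : L = ⊤ := by
  refine (R.inner.isHermForm.finite_and_eq_top_of_orthogonal L fun f hf => Subtype.ext ?_).2
  have : (𝓝[≠] (0 : ℍ[ℝ])).NeBot := Module.punctured_nhds_neBot ℝ ℍ[ℝ] 0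
  -- The elements of the space are continuous and the origin is not isolated, so the kernel
  -- functions at `0` can be dispensed with.
  refine eq_zero_of_continuous (D := {0}ᶜ) (fun p hp => ?_)
    (R.continuous_of_finite hs.continuousOn f) fun q hq => ?_
  · exact hs.isOpen.inter_closure ⟨hp, dense_compl_singleton 0 p⟩
  · exact eq_zero_of_star_dotProduct fun a => by
      rw [← R.form_kernelElem, hf _ (hL q hq a)]

/-- The generators of the isometric relation. -/
noncomputable def shiftRelation (R : ReproducingKernelPontryaginSpace V (schurKernel J₂ J₁ s)) :
    Set ((R.carrier × (Fin N → ℍ[ℝ])) × (R.carrier × (Fin M → ℍ[ℝ]))) :=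
  Set.range fun x : V × (Fin N → ℍ[ℝ]) =>
    ((R.kernelElem (x.1, star (x.1 : ℍ[ℝ]) • x.2), x.2), (R.kernelElem x, (s x.1)ᴴ *ᵥ x.2))

theorem kernelElem_zero {K : ℍ[ℝ] → ℍ[ℝ] → Matrix (Fin N) (Fin N) ℍ[ℝ]}
    (R : ReproducingKernelPontryaginSpace V K) (q : V) :
    R.kernelElem (q, 0) = 0 :=
  Subtype.ext (funext fun p => Matrix.mulVec_zero (K p q))

theorem form_kernelElem_kernelElem {K : ℍ[ℝ] → ℍ[ℝ] → Matrix (Fin N) (Fin N) ℍ[ℝ]}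
    (R : ReproducingKernelPontryaginSpace V K) (q w : V) (u v : Fin N → ℍ[ℝ]) :
    R.inner.form (R.kernelElem (q, u)) (R.kernelElem (w, v)) = star v ⬝ᵥ (K w q *ᵥ u) :=
  R.form_kernelElem _ w v

/-- This is the Stein equation in the form `p K q̄ + J₂ = K + s(p) J₁ s(q)*`, read as an equality of
inner products. -/
theorem shiftRelation_isometric (hs : IsGeneralizedSchur J₂ J₁ V s κ)
    (R : ReproducingKernelPontryaginSpace V (schurKernel J₂ J₁ s)) :
    ∀ r ∈ shiftRelation R, ∀ r' ∈ shiftRelation R,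
      R.inner.form r.1.1 r'.1.1 + matForm J₂ r.1.2 r'.1.2 =
        R.inner.form r.2.1 r'.2.1 + matForm J₁ r.2.2 r'.2.2 := by
  rintro _ ⟨⟨q, u⟩, rfl⟩ _ ⟨⟨w, v⟩, rfl⟩
  have h1 := schurKernel_sub (J₂ := J₂) (J₁ := J₁) (s := s) (hs.norm_lt_one w).le (hs.norm_lt_one q)
  have h2 : (w : ℍ[ℝ]) • MulOpposite.op (star (q : ℍ[ℝ])) • schurKernel J₂ J₁ s w q + J₂ =
      schurKernel J₂ J₁ s w q + s w * J₁ * (s q)ᴴ := by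
    rw [sub_eq_sub_iff_add_eq_add] at h1
    rw [h1, add_comm]
  have h3 := congrArg (fun X => star v ⬝ᵥ (X *ᵥ u)) h2
  simp only [Matrix.add_mulVec, dotProduct_add, Matrix.smul_mulVec, op_smul_mulVec,
    ← Matrix.mulVec_mulVec] at h3
  simp only [form_kernelElem_kernelElem, matForm, star_smul_dotProduct]
  rw [h3, star_dotProduct_mulVec (s w)]

/-- The generators at `q = 0` supply all `(0, u)`. Subtracting these and dividing by `q̄` supplies
the kernel functions at nonzero points, which span. -/
theorem map_fst_shiftRelation (hs : IsGeneralizedSchur J₂ J₁ V s κ)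
    (R : ReproducingKernelPontryaginSpace V (schurKernel J₂ J₁ s))
    [Module.Finite ℍ[ℝ]ᵐᵒᵖ R.carrier] :
    Submodule.map (LinearMap.fst ℍ[ℝ]ᵐᵒᵖ (R.carrier × (Fin N → ℍ[ℝ])) (R.carrier × (Fin M → ℍ[ℝ])))
      (Submodule.span ℍ[ℝ]ᵐᵒᵖ (shiftRelation R)) = ⊤ := by
  set S := Submodule.map
    (LinearMap.fst ℍ[ℝ]ᵐᵒᵖ (R.carrier × (Fin N → ℍ[ℝ])) (R.carrier × (Fin M → ℍ[ℝ])))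
      (Submodule.span ℍ[ℝ]ᵐᵒᵖ (shiftRelation R))
  have hmem : ∀ (q : V) u, (R.kernelElem (q, star (q : ℍ[ℝ]) • u), u) ∈ S := fun q u =>
    ⟨_, Submodule.subset_span ⟨(q, u), rfl⟩, rfl⟩
  have hinr : ∀ u, ((0 : R.carrier), u) ∈ S := fun u => by
    have := hmem ⟨0, hs.zero_mem⟩ u
    rwa [star_zero, zero_smul, kernelElem_zero] at this
  have hinl : Submodule.comap (LinearMap.inl ℍ[ℝ]ᵐᵒᵖ R.carrier (Fin N → ℍ[ℝ])) S = ⊤ := by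
    refine span_kernelElem_ne_zero hs R fun q hq u => ?_
    have h1 := S.sub_mem (hmem q ((star (q : ℍ[ℝ]))⁻¹ • u)) (hinr ((star (q : ℍ[ℝ]))⁻¹ • u))
    rw [smul_smul, mul_inv_cancel₀ (star_ne_zero.mpr hq), one_smul, Prod.mk_sub_mk, sub_zero,
      sub_self] at h1
    exact h1
  rw [Submodule.eq_top_iff']
  rintro ⟨f, u⟩
  have h1 : f ∈ Submodule.comap (LinearMap.inl ℍ[ℝ]ᵐᵒᵖ R.carrier (Fin N → ℍ[ℝ])) S :=
    hinl ▸ Submodule.mem_top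
  simpa using S.add_mem h1 (hinr u)

theorem isHermForm_sumForm {N : ℕ} (Φ : PontryaginForm P) :
    IsHermForm (sumForm Φ : P × (Fin N → ℍ[ℝ]) → P × (Fin N → ℍ[ℝ]) → ℍ[ℝ]) := by
  have h := Φ.isHermForm.prod (isHermForm_matForm (n := N) Matrix.isHermitian_one)
  simp only [matForm, Matrix.one_mulVec] at h
  exact h

theorem sumForm_nondegenerate {N : ℕ} (Φ : PontryaginForm P) (v : P × (Fin N → ℍ[ℝ]))
    (hv : ∀ w, sumForm Φ v w = 0) : v = 0 := by
  refine Prod.ext (Φ.nondegenerate _ fun w => ?_) (eq_zero_of_star_dotProduct fun a => ?_)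
  · simpa [sumForm] using hv (w, 0)
  · simpa [sumForm, Φ.isHermForm.zero_right] using hv (0, a)

theorem coprod_prod_coprod_blocks {X₁ X₂ Y₁ Y₂ : Type*} [AddCommGroup X₁] [AddCommGroup X₂]
    [AddCommGroup Y₁] [AddCommGroup Y₂] [Module ℍ[ℝ]ᵐᵒᵖ X₁] [Module ℍ[ℝ]ᵐᵒᵖ X₂] [Module ℍ[ℝ]ᵐᵒᵖ Y₁]
    [Module ℍ[ℝ]ᵐᵒᵖ Y₂] (T : X₁ × X₂ →ₗ[ℍ[ℝ]ᵐᵒᵖ] Y₁ × Y₂) :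
    ((LinearMap.fst _ _ _ ∘ₗ T ∘ₗ LinearMap.inl _ _ _).coprod
      (LinearMap.fst _ _ _ ∘ₗ T ∘ₗ LinearMap.inr _ _ _)).prod
      ((LinearMap.snd _ _ _ ∘ₗ T ∘ₗ LinearMap.inl _ _ _).coprod
      (LinearMap.snd _ _ _ ∘ₗ T ∘ₗ LinearMap.inr _ _ _)) = T := by
  refine LinearMap.ext fun x => ?_
  have h : T (x.1, 0) + T (0, x.2) = T x := by rw [← map_add]; simp
  rw [← h]
  rfl

/-- The coisometric backward shift realization in a finite dimensional reproducing kernel space. -/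
theorem exists_backward_shift_realization (hs : IsGeneralizedSchur J₂ J₁ V s κ)
    (R : ReproducingKernelPontryaginSpace V (schurKernel J₂ J₁ s))
    [Module.Finite ℍ[ℝ]ᵐᵒᵖ R.carrier] :
    ∃ (A : R.carrier →ₗ[ℍ[ℝ]ᵐᵒᵖ] R.carrier) (B : (Fin M → ℍ[ℝ]) →ₗ[ℍ[ℝ]ᵐᵒᵖ] R.carrier)
      (C : R.carrier →ₗ[ℍ[ℝ]ᵐᵒᵖ] (Fin N → ℍ[ℝ]))
      (D : (Fin M → ℍ[ℝ]) →ₗ[ℍ[ℝ]ᵐᵒᵖ] (Fin N → ℍ[ℝ])),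
      IsCoisometric R.inner J₁ J₂ ((A.coprod B).prod (C.coprod D)) ∧
      (∀ (f : R.carrier) (q : V), (f : V → Fin N → ℍ[ℝ]) q =
        C f + (q : ℍ[ℝ]) • (A f : V → Fin N → ℍ[ℝ]) q) ∧
      ∀ u (q : V), s q *ᵥ u = D u + (q : ℍ[ℝ]) • (B u : V → Fin N → ℍ[ℝ]) q := by
  have hΦ := R.inner.isHermForm
  have hJ₂ := isHermForm_matForm hs.signature_left.1
  have hJ₁ := isHermForm_matForm hs.signature_right.1
  obtain ⟨Pp, Pm, hc, -, hp, hm⟩ := hΦ.exists_decomposition R.inner.nondegenerate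
  obtain ⟨-, Xm, -, -, hXm, hXdim⟩ :=
    exists_decomposition_prod hΦ hc.sup_eq_top hp hm hs.signature_left
  obtain ⟨Yp, Ym, hY, hYp, -, hYdim⟩ :=
    exists_decomposition_prod hΦ hc.sup_eq_top hp hm hs.signature_right
  obtain ⟨T', hiso, hgen⟩ := exists_isometry_of_relation (hΦ.prod hJ₂) (hΦ.prod hJ₁) hXm hY hYp
    (by rw [hXdim, hYdim, hs.sqNeg_eq]) (shiftRelation_isometric hs R) (map_fst_shiftRelation hs R)
  -- The adjoint is taken for the standard inner products, as `IsCoisometric` requires; `J₁` and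
  -- `J₂` return through the isometry of `T'`.
  obtain ⟨T, hT⟩ := (isHermForm_sumForm (N := N) R.inner).exists_adjoint
    (isHermForm_sumForm (N := M) R.inner) (sumForm_nondegenerate R.inner) T'
  have hker : ∀ (q : V) u, T' (R.kernelElem (q, star (q : ℍ[ℝ]) • u), u) =
      (R.kernelElem (q, u), (s q)ᴴ *ᵥ u) := fun q u => hgen _ ⟨(q, u), rfl⟩
  refine ⟨LinearMap.fst _ _ _ ∘ₗ T ∘ₗ LinearMap.inl _ _ _,
    LinearMap.fst _ _ _ ∘ₗ T ∘ₗ LinearMap.inr _ _ _,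
    LinearMap.snd _ _ _ ∘ₗ T ∘ₗ LinearMap.inl _ _ _,
    LinearMap.snd _ _ _ ∘ₗ T ∘ₗ LinearMap.inr _ _ _,
    (coprod_prod_coprod_blocks T).symm ▸ ⟨T', hT, fun y => ?_⟩, fun f q => ?_, fun v q => ?_⟩
  · refine sub_eq_zero.mp (sumForm_nondegenerate R.inner _ fun z => ?_)
    rw [(isHermForm_sumForm R.inner).sub_left, hT, sub_eq_zero]
    exact hiso y z
  · refine sub_eq_zero.mp (eq_zero_of_star_dotProduct fun u => ?_)
    -- Pairing with a generator turns the adjoint relation into point evaluation at `q`: one side is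
    -- `u* f(q)`, the other `u*(Cf + q(Af)(q))`.
    have h1 := hT (f, 0) (R.kernelElem (q, star (q : ℍ[ℝ]) • u), u)
    rw [hker, sumForm, sumForm, R.form_kernelElem, R.form_kernelElem, star_smul_dotProduct,
      dotProduct_zero, add_zero, ← dotProduct_add] at h1
    rw [dotProduct_sub, ← h1, add_comm, sub_eq_zero]
    rfl
  · refine sub_eq_zero.mp (eq_zero_of_star_dotProduct fun u => ?_)
    have h1 := hT (0, v) (R.kernelElem (q, star (q : ℍ[ℝ]) • u), u)
    rw [hker, sumForm, sumForm, R.form_kernelElem, star_smul_dotProduct, hΦ.zero_left,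
      zero_add, ← star_dotProduct_mulVec, ← dotProduct_add] at h1
    rw [dotProduct_sub, ← h1, add_comm, sub_eq_zero]
    rfl

end BackwardShift

/-! ### Finite rank of kernels with a realization -/

section FiniteRank

variable {N M n : ℕ} {V : Set ℍ[ℝ]}

theorem continuous_mulVec_const {X : Type*} [TopologicalSpace X]
    {F : X → Matrix (Fin N) (Fin n) ℍ[ℝ]} (hF : ∀ i j, Continuous fun x => F x i j)
    (a : Fin n → ℍ[ℝ]) : Continuous fun x => F x *ᵥ a := by
  refine continuous_pi fun i => ?_
  change Continuous fun x => ∑ j, F x i j * a j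
  exact continuous_finsetSum _ fun j _ => (hF i j).mul continuous_const

/-- A separately continuous kernel that factors through a finite dimensional space on a dense set
has finite rank. -/
theorem finite_kernelSpan {K : ℍ[ℝ] → ℍ[ℝ] → Matrix (Fin N) (Fin N) ℍ[ℝ]} {D : Set ℍ[ℝ]}
    (hD : ∀ p ∈ V, p ∈ closure {q ∈ V | q ∈ D}) (hK : ∀ z ∈ V, ∀ w ∈ V, K z w = (K w z)ᴴ)
    (hc : ∀ q ∈ V, ∀ i j, ContinuousOn (fun p => K p q i j) V)
    {F : ℍ[ℝ] → Matrix (Fin N) (Fin n) ℍ[ℝ]} {H : Matrix (Fin n) (Fin n) ℍ[ℝ]}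
    (hF : ∀ p ∈ V, p ∈ D → ∀ q ∈ V, q ∈ D → K p q = F p * H * (F q)ᴴ) :
    Module.Finite ℍ[ℝ]ᵐᵒᵖ (kernelSpan V K) := by
  let ι := {q : V // (q : ℍ[ℝ]) ∈ D}
  let ρ : (V → Fin N → ℍ[ℝ]) →ₗ[ℍ[ℝ]ᵐᵒᵖ] (ι → Fin N → ℍ[ℝ]) := LinearMap.funLeft _ _ Subtype.val
  let Fm : (Fin n → ℍ[ℝ]) →ₗ[ℍ[ℝ]ᵐᵒᵖ] (ι → Fin N → ℍ[ℝ]) :=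
    LinearMap.pi fun p => mulVecRight (F p.1)
  let Fr : (Fin n → ℍ[ℝ]) →ₗ[ℝ] (ι → Fin N → ℍ[ℝ]) :=
    { toFun := Fm
      map_add' := map_add Fm
      map_smul' := fun r x => by
        ext1 p
        exact Matrix.mulVec_smul _ r x }
  have hclosed : IsClosed (Set.range Fm) :=
    Submodule.closed_of_finiteDimensional (LinearMap.range Fr)
  have hcq : ∀ (p : V) a, Continuous fun q : V => K p q *ᵥ a := by
    intro p a
    refine continuous_mulVec_const (fun i j => ?_) a
    have h1 : (fun q : V => K p q i j) = fun q : V => star (K q p j i) := by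
      funext q
      rw [hK p p.2 q q.2, Matrix.conjTranspose_apply]
    rw [h1]
    exact continuous_star.comp (hc p p.2 j i).domRestrict
  -- Restricted to `D`, kernel functions based in `D` lie in a finite dimensional, hence closed,
  -- subspace; those based elsewhere in `V` are limits of these.
  have hmem : ∀ x, ρ (kernelFun V K x) ∈ Set.range Fm := by
    rintro ⟨q, a⟩
    have hcl : IsClosed {q : V | ρ (kernelFun V K (q, a)) ∈ Set.range Fm} := by
      refine hclosed.preimage (continuous_pi fun p => hcq p.1 a)
    have hq : q ∈ closure {q : V | (q : ℍ[ℝ]) ∈ D} := by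
      rw [closure_subtype]
      refine closure_mono ?_ (hD q q.2)
      rintro q ⟨hq, hqD⟩
      exact ⟨⟨q, hq⟩, hqD, rfl⟩
    refine closure_minimal (fun w hw => ?_) hcl hq
    refine ⟨(H * (F w)ᴴ) *ᵥ a, funext fun p => ?_⟩
    change F p.1 *ᵥ ((H * (F w)ᴴ) *ᵥ a) = K p.1 w *ᵥ a
    rw [hF p.1 p.1.2 p.2 w w.2 hw, Matrix.mulVec_mulVec, Matrix.mul_assoc]
  have hle : ∀ f ∈ kernelSpan V K, ρ f ∈ LinearMap.range Fm := by
    intro f hf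
    have : kernelSpan V K ≤ (LinearMap.range Fm).comap ρ :=
      Submodule.span_le.mpr (by rintro _ ⟨x, rfl⟩; exact hmem x)
    exact this hf
  have hcont : ∀ f ∈ kernelSpan V K, Continuous f := by
    intro f hf
    induction hf using Submodule.span_induction with
    | mem x hx =>
      obtain ⟨⟨q, a⟩, rfl⟩ := hx
      exact continuous_mulVec_const (fun i j => (hc q q.2 i j).domRestrict) a
    | zero => exact continuous_zero
    | add x y _ _ hx hy => exact hx.add hy
    | smul a x _ hx => exact hx.const_smul a
  -- Continuous functions are determined by their restriction to the dense set `D`.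
  refine Module.Finite.of_injective (ρ.restrict hle) ?_
  rw [injective_iff_map_eq_zero]
  intro f hf
  refine Subtype.ext (eq_zero_of_continuous hD (hcont f f.2) fun q hq => ?_)
  exact congrFun (congrArg Subtype.val hf) ⟨q, hq⟩

variable {J₂ : Matrix (Fin N) (Fin N) ℍ[ℝ]} {J₁ : Matrix (Fin M) (Fin M) ℍ[ℝ]}
  {s : ℍ[ℝ] → Matrix (Fin N) (Fin M) ℍ[ℝ]} {H A : Matrix (Fin n) (Fin n) ℍ[ℝ]}
  {B : Matrix (Fin n) (Fin M) ℍ[ℝ]} {C : Matrix (Fin N) (Fin n) ℍ[ℝ]}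
  {D : Matrix (Fin N) (Fin M) ℍ[ℝ]}

/-- The kernel of a transfer function. -/
theorem schurKernel_eq_of_realization (hrel : ColligationRelation H J₁ J₂ A B C D) {p q : ℍ[ℝ]}
    (hp : ‖p‖ < 1) (hq : ‖q‖ < 1) (hpu : IsUnit (pencil A p)) (hqu : IsUnit (pencil A q))
    (hsp : s p = transferFunction A B C D p) (hsq : s q = transferFunction A B C D q) :
    schurKernel J₂ J₁ s p q = starEval C A p * H * (starEval C A q)ᴴ := by
  refine eq_of_stein hp.le hq ?_
  rw [schurKernel_sub hp.le hq, hsp, hsq, starEval_identity hrel hpu hqu]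

theorem finite_kernelSpan_of_realization {κ : ℕ} (hs : IsGeneralizedSchur J₂ J₁ V s κ)
    (h : HasFiniteCoisometricRealization J₂ J₁ V s) :
    Module.Finite ℍ[ℝ]ᵐᵒᵖ (kernelSpan V (schurKernel J₂ J₁ s)) := by
  obtain ⟨P, _, _, Φ, A, B, C, D, _, hco, hre⟩ := h
  let e := Module.finBasis ℍ[ℝ]ᵐᵒᵖ P
  have hrel := colligationRelation_of_isCoisometric e hco
  have htf := fun p (hp : p ∈ V) => transferFunction_of_realization e hre hp
  exact finite_kernelSpan (D := {p | IsUnit (pencil (coordA e A) p)})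
    (fun p hp => mem_closure_isUnit_pencil _ hs.isOpen hp) hs.negativeSquares.1 hs.continuousOn
    fun p hp hpu q hq hqu => schurKernel_eq_of_realization hrel (hs.norm_lt_one ⟨p, hp⟩)
      (hs.norm_lt_one ⟨q, hq⟩) hpu hqu (htf p hp hpu) (htf q hq hqu)

end FiniteRank

/-! ### From the backward shift to the transfer function -/

section Realization

variable {N M : ℕ} {V : Set ℍ[ℝ]} {J₂ : Matrix (Fin N) (Fin N) ℍ[ℝ]}
  {J₁ : Matrix (Fin M) (Fin M) ℍ[ℝ]} {s : ℍ[ℝ] → Matrix (Fin N) (Fin M) ℍ[ℝ]} {κ : ℕ}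

theorem smul_vec_identities {N : ℕ} (q : ℍ[ℝ]) (v : Fin N → ℍ[ℝ]) :
    q • v + star q • v = (2 * q.re) • v ∧ star q • q • v = (‖q‖ ^ 2) • v := by
  have h := two_re_smul_sub_eq (p := q) (Matrix.replicateCol (Fin 1) v)
  constructor
  · funext i
    exact congrFun (congrFun h.1 i) 0
  · funext i
    exact congrFun (congrFun h.2.1 i) 0

/-- Point evaluations are given by the star resolvent of the backward shift. -/
theorem apply_eq_opStarResolvent {L : Submodule ℍ[ℝ]ᵐᵒᵖ (V → Fin N → ℍ[ℝ])}
    {A : L →ₗ[ℍ[ℝ]ᵐᵒᵖ] L} {C : L →ₗ[ℍ[ℝ]ᵐᵒᵖ] (Fin N → ℍ[ℝ])}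
    (h : ∀ (f : L) (q : V), (f : V → Fin N → ℍ[ℝ]) q =
      C f + (q : ℍ[ℝ]) • (A f : V → Fin N → ℍ[ℝ]) q)
    {q : V} (hq : IsUnit (opPencil A q : Module.End ℍ[ℝ]ᵐᵒᵖ L)) (f : L) :
    (f : V → Fin N → ℍ[ℝ]) q = opStarResolvent C A q f := by
  set g := Ring.inverse (opPencil A q : Module.End ℍ[ℝ]ᵐᵒᵖ L) f with hg
  have hf : opPencil A q g = f :=
    LinearMap.congr_fun (Ring.mul_inverse_cancel (opPencil A q : Module.End ℍ[ℝ]ᵐᵒᵖ L) hq) f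
  have h1 := h g q
  have h2 := h (A g) q
  obtain ⟨e1, -⟩ := smul_vec_identities (q : ℍ[ℝ]) ((A g : V → Fin N → ℍ[ℝ]) q)
  obtain ⟨-, e2⟩ := smul_vec_identities (q : ℍ[ℝ]) ((A (A g) : V → Fin N → ℍ[ℝ]) q)
  -- The shift equation for `g` and `A g` gives `Cg = g(q) - q(Ag)(q)` and `CAg = (Ag)(q) -
  -- q(A²g)(q)`. Then `Cg - q̄ CAg` is the value at `q` of the pencil applied to `g`, that is,
  -- `f(q)`.
  rw [opStarResolvent, ← hg, eq_sub_iff_add_eq.mpr h1.symm,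
    eq_sub_iff_add_eq.mpr h2.symm]
  conv_lhs => rw [← hf]
  change (g : V → Fin N → ℍ[ℝ]) q
    - MulOpposite.op ((2 * (q : ℍ[ℝ]).re : ℝ) : ℍ[ℝ]) • (A g : V → Fin N → ℍ[ℝ]) q
    + MulOpposite.op ((‖(q : ℍ[ℝ])‖ ^ 2 : ℝ) : ℍ[ℝ]) • (A (A g) : V → Fin N → ℍ[ℝ]) q = _
  rw [op_coe_smul_eq, op_coe_smul_eq, ← e1, ← e2, smul_sub]
  abel

theorem isOpRealizationOn_of_backward_shift {L : Submodule ℍ[ℝ]ᵐᵒᵖ (V → Fin N → ℍ[ℝ])}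
    {A : L →ₗ[ℍ[ℝ]ᵐᵒᵖ] L} {B : (Fin M → ℍ[ℝ]) →ₗ[ℍ[ℝ]ᵐᵒᵖ] L}
    {C : L →ₗ[ℍ[ℝ]ᵐᵒᵖ] (Fin N → ℍ[ℝ])} {D : (Fin M → ℍ[ℝ]) →ₗ[ℍ[ℝ]ᵐᵒᵖ] (Fin N → ℍ[ℝ])}
    (h : ∀ (f : L) (q : V), (f : V → Fin N → ℍ[ℝ]) q =
      C f + (q : ℍ[ℝ]) • (A f : V → Fin N → ℍ[ℝ]) q)
    (hs : ∀ u (q : V), s q *ᵥ u = D u + (q : ℍ[ℝ]) • (B u : V → Fin N → ℍ[ℝ]) q) :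
    IsOpRealizationOn V s A B C D := by
  intro p hp hu u
  rw [hs u ⟨p, hp⟩, apply_eq_opStarResolvent h (q := ⟨p, hp⟩) hu]

theorem hasFiniteCoisometricRealization_of_finite (hs : IsGeneralizedSchur J₂ J₁ V s κ)
    (R : ReproducingKernelPontryaginSpace V (schurKernel J₂ J₁ s))
    (hR : Module.Finite ℍ[ℝ]ᵐᵒᵖ R.carrier) : HasFiniteCoisometricRealization J₂ J₁ V s := by
  obtain ⟨A, B, C, D, hco, h, hsr⟩ := exists_backward_shift_realization hs R
  exact ⟨R.carrier, _, _, R.inner, A, B, C, D, hR, hco, isOpRealizationOn_of_backward_shift h hsr⟩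

end Realization

/-! ### Observability and the classes `U_κ(J)` -/

section UnitaryClass

variable {N n : ℕ} {V : Set ℍ[ℝ]}

/-- The unobservable subspace is annihilated by `C ⋆ (I - pA)^{-⋆}`. -/
theorem starEval_mulVec_eq_zero {C : Matrix (Fin N) (Fin n) ℍ[ℝ]} {A : Matrix (Fin n) (Fin n) ℍ[ℝ]}
    {p : ℍ[ℝ]} (hp : IsUnit (pencil A p)) {v : Fin n → ℍ[ℝ]} (hv : ∀ k : ℕ, (C * A ^ k) *ᵥ v = 0) :
    starEval C A p *ᵥ v = 0 := by
  let U : Submodule ℍ[ℝ]ᵐᵒᵖ (Fin n → ℍ[ℝ]) := ⨅ k : ℕ, LinearMap.ker (mulVecRight (C * A ^ k))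
  have hU : ∀ w, w ∈ U ↔ ∀ k : ℕ, (C * A ^ k) *ᵥ w = 0 := fun w => by
    simp [U, Submodule.mem_iInf, mulVecRight_apply]
  have hA : ∀ w ∈ U, A *ᵥ w ∈ U := fun w hw => (hU _).mpr fun k => by
    rw [Matrix.mulVec_mulVec, Matrix.mul_assoc, ← pow_succ]
    exact (hU w).mp hw (k + 1)
  have hP : ∀ w ∈ U, mulVecRight (pencil A p) w ∈ U := fun w hw => by
    rw [mulVecRight_apply, pencil, Matrix.add_mulVec, Matrix.sub_mulVec, Matrix.smul_mulVec,
      Matrix.smul_mulVec, ← Matrix.mulVec_mulVec, Matrix.one_mulVec, ← op_coe_smul_eq,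
      ← op_coe_smul_eq]
    exact U.add_mem (U.sub_mem hw (U.smul_mem _ (hA w hw))) (U.smul_mem _ (hA _ (hA w hw)))
  have hcancel : ∀ w, Ring.inverse (pencil A p) *ᵥ (pencil A p *ᵥ w) = w := fun w => by
    rw [Matrix.mulVec_mulVec, Ring.inverse_mul_cancel _ hp, Matrix.one_mulVec]
  have hinj : Function.Injective ((mulVecRight (pencil A p)).restrict hP) := by
    intro x y hxy
    have h1 : pencil A p *ᵥ (x : Fin n → ℍ[ℝ]) = pencil A p *ᵥ (y : Fin n → ℍ[ℝ]) :=
      congrArg Subtype.val hxy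
    exact Subtype.ext (by rw [← hcancel x, h1, hcancel])
  -- The pencil maps the unobservable subspace injectively into itself, hence onto it by dimension;
  -- so `w` is again unobservable.
  obtain ⟨w, hw⟩ := LinearMap.surjective_of_injective hinj ⟨v, (hU v).mpr hv⟩
  have hw' : pencil A p *ᵥ (w : Fin n → ℍ[ℝ]) = v := congrArg Subtype.val hw
  have h0 := (hU w).mp w.2 0
  have h1 := (hU w).mp w.2 1
  rw [pow_zero, Matrix.mul_one] at h0
  rw [pow_one] at h1
  rw [starEval, ← Matrix.mulVec_mulVec, ← hw', hcancel, Matrix.sub_mulVec, Matrix.smul_mulVec, h0,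
    h1, smul_zero, sub_zero]

/-- `G⁻¹ = (G⁻¹)* G G⁻¹` is a congruence of `G`. -/
theorem sqNeg_inverse {G : Matrix (Fin n) (Fin n) ℍ[ℝ]} (hG : G.IsHermitian) (hu : IsUnit G) :
    (Ring.inverse G).IsHermitian ∧ sqNeg (Ring.inverse G) = sqNeg G := by
  have h1 := Ring.inverse_mul_cancel G hu
  have h2 := Ring.mul_inverse_cancel G hu
  have hH : (Ring.inverse G).IsHermitian := by
    have h3 := congrArg Matrix.conjTranspose h1
    rw [Matrix.conjTranspose_mul, hG.eq, Matrix.conjTranspose_one] at h3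
    rw [Matrix.IsHermitian, ← one_mul (Ring.inverse G)ᴴ, ← h1, mul_assoc, h3, mul_one]
  refine ⟨hH, ?_⟩
  have h4 := sqNeg_congr_eq hG (Ring.inverse G) fun v => ⟨G *ᵥ v, by
    rw [mulVecRight_apply, Matrix.mulVec_mulVec, h1, Matrix.one_mulVec]⟩
  rwa [hH.eq, h1, one_mul] at h4

variable {J : Matrix (Fin N) (Fin N) ℍ[ℝ]} {s : ℍ[ℝ] → Matrix (Fin N) (Fin N) ℍ[ℝ]} {κ : ℕ}

/-- The number of negative squares is the negative index of the reproducing kernel space. -/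
theorem hasNegativeSquares_gramMatrix {K : ℍ[ℝ] → ℍ[ℝ] → Matrix (Fin N) (Fin N) ℍ[ℝ]}
    (hK : ∀ z ∈ V, ∀ w ∈ V, K z w = (K w z)ᴴ) (R : ReproducingKernelPontryaginSpace V K)
    (e : Module.Basis (Fin n) ℍ[ℝ]ᵐᵒᵖ R.carrier) :
    HasNegativeSquares K V (sqNeg (gramMatrix R.inner.form e)) := by
  classical
  have : Module.Finite ℍ[ℝ]ᵐᵒᵖ R.carrier := Module.Finite.of_basis e
  let ψ : ℍ[ℝ] → (Fin N → ℍ[ℝ]) → Fin n → ℍ[ℝ] := fun z c =>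
    if hz : z ∈ V then coordEquiv e (R.kernelElem (⟨z, hz⟩, c)) else 0
  have hψ : ∀ z (hz : z ∈ V) c, ψ z c = coordEquiv e (R.kernelElem (⟨z, hz⟩, c)) :=
    fun z hz c => dif_pos hz
  refine hasNegativeSquares_of_span (isHermitian_gramMatrix R.inner.isHermForm e) hK (ψ := ψ)
    (fun z hz w hw c d => ?_) ?_
  · rw [hψ z hz, hψ w hw, matForm_gramMatrix R.inner.isHermForm, form_kernelElem_kernelElem]
  · have h1 := congrArg (Submodule.map (coordEquiv e).toLinearMap) R.span_kernelElem
    rw [Submodule.map_span, ← Set.range_comp, Submodule.map_top, LinearEquiv.range] at h1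
    rw [eq_top_iff, ← h1]
    refine Submodule.span_mono ?_
    rintro _ ⟨⟨z, c⟩, rfl⟩
    exact ⟨z, z.2, c, hψ z z.2 c⟩

/-- Functions in the class `U_κ(J)` have minimal realizations. -/
theorem IsJUnitaryClass.exists_realization (h : IsJUnitaryClass J V s κ) :
    ∃ (n : ℕ) (H A : Matrix (Fin n) (Fin n) ℍ[ℝ]) (B : Matrix (Fin n) (Fin N) ℍ[ℝ])
      (C : Matrix (Fin N) (Fin n) ℍ[ℝ]) (D : Matrix (Fin N) (Fin N) ℍ[ℝ]),
      H.IsHermitian ∧ sqNeg H = κ ∧ Observable C A ∧ ColligationRelation H J J A B C D ∧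
      ∀ᶠ p in 𝓝 (0 : ℍ[ℝ]), s p = transferFunction A B C D p := by
  obtain ⟨hs, R, hR⟩ := h
  obtain ⟨A, B, C, D, hco, hsh, hsr⟩ := exists_backward_shift_realization hs R
  let e := Module.finBasis ℍ[ℝ]ᵐᵒᵖ R.carrier
  obtain ⟨hH, hsq⟩ := sqNeg_inverse (isHermitian_gramMatrix R.inner.isHermForm e)
    (isUnit_gramMatrix R.inner.isHermForm e R.inner.nondegenerate)
  refine ⟨_, Ring.inverse (gramMatrix R.inner.form e), coordA e A, coordB e B, coordC e C,
    matrixOf D, hH, ?_, fun v hv => ?_, colligationRelation_of_isCoisometric e hco, ?_⟩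
  · rw [hsq]
    exact (hasNegativeSquares_gramMatrix hs.negativeSquares.1 R e).unique hs.negativeSquares
  · obtain ⟨f, rfl⟩ := (coordEquiv e).surjective v
    -- An unobservable `f` vanishes wherever the resolvent computes its values, which is a dense
    -- subset of `V`.
    have hf : f = 0 := Subtype.ext <| eq_zero_of_continuous
      (D := {p | IsUnit (pencil (coordA e A) p)})
      (fun p hp => mem_closure_isUnit_pencil _ hs.isOpen hp)
      (R.continuous_of_finite hs.continuousOn f) fun q hq => by
        rw [apply_eq_opStarResolvent hsh (isUnit_opPencil e hq), ← starEval_mulVec e hq]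
        exact starEval_mulVec_eq_zero hq hv
    rw [hf, map_zero]
  · filter_upwards [hs.isOpen.mem_nhds hs.zero_mem,
      (isOpen_isUnit_pencil (coordA e A)).mem_nhds (isUnit_pencil_zero _)] with p hp hu
    exact transferFunction_of_realization e (isOpRealizationOn_of_backward_shift hsh hsr) hp hu

theorem MatrixSliceHyperholomorphicOn.congr {M : ℕ} {f g : ℍ[ℝ] → Matrix (Fin N) (Fin M) ℍ[ℝ]}
    (hV : IsOpen V) (hf : MatrixSliceHyperholomorphicOn f V) (h : ∀ p ∈ V, g p = f p) :
    MatrixSliceHyperholomorphicOn g V := by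
  intro i j
  refine ⟨(hf i j).1.congr fun p hp => by rw [h p hp], fun I hI x y hp => ?_⟩
  have heq : (fun p => g p i j) =ᶠ[𝓝 ((x : ℍ[ℝ]) + y • I)] fun p => f p i j := by
    filter_upwards [hV.mem_nhds hp] with q hq
    rw [h q hq]
  rw [heq.fderiv_eq]
  exact (hf i j).2 I hI x y hp

/-- If `E(p)v = 0` on `V`, then `Cv = E(0)v = 0` and `E = C + pEA` gives `p E(p)Av = 0`. Dividing by
`p ≠ 0`, with continuity at `0`, shows that `Av` satisfies the same hypothesis, and induction on `k`
applies. -/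
theorem observability_of_starEval {C : Matrix (Fin N) (Fin n) ℍ[ℝ]}
    {A : Matrix (Fin n) (Fin n) ℍ[ℝ]} (hV : IsOpen V) (h0 : (0 : ℍ[ℝ]) ∈ V)
    (hu : ∀ p ∈ V, IsUnit (pencil A p)) (k : ℕ) :
    ∀ v : Fin n → ℍ[ℝ], (∀ p ∈ V, starEval C A p *ᵥ v = 0) → (C * A ^ k) *ᵥ v = 0 := by
  induction k with
  | zero =>
    intro v hv
    have h1 := hv 0 h0
    rw [starEval_eq C (hu 0 h0), zero_smul, add_zero] at h1
    rw [pow_zero, Matrix.mul_one, h1]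
  | succ k ih =>
    intro v hv
    have hC : C *ᵥ v = 0 := by
      have h1 := hv 0 h0
      rwa [starEval_eq C (hu 0 h0), zero_smul, add_zero] at h1
    rw [pow_succ, ← Matrix.mul_assoc, ← Matrix.mulVec_mulVec]
    refine ih _ fun p hp => ?_
    have : (𝓝[≠] (0 : ℍ[ℝ])).NeBot := Module.punctured_nhds_neBot ℝ ℍ[ℝ] 0
    refine congrFun (eq_zero_of_continuous (V := V) (D := {0}ᶜ)
      (f := fun p => starEval C A p *ᵥ (A *ᵥ v))
      (fun p hp => hV.inter_closure ⟨hp, dense_compl_singleton 0 p⟩) ?_ fun q hq => ?_) ⟨p, hp⟩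
    · refine continuous_mulVec_const (fun i j => ?_) (A *ᵥ v)
      have hc : ContinuousOn (fun p => starEval C A p i j) V := fun p hp =>
        (differentiableAt_starEval (hu p hp) C i j).continuousAt.continuousWithinAt
      exact hc.domRestrict
    · have h1 := hv q q.2
      rw [starEval_eq C (hu q q.2), Matrix.add_mulVec, hC, zero_add, Matrix.smul_mulVec,
        ← Matrix.mulVec_mulVec] at h1
      exact (smul_eq_zero.mp h1).resolve_left hq

/-- Functions with a matrix realization belong to a class `U_κ(J)`. -/
theorem exists_isJUnitaryClass (hJ : IsSignature J) {H A : Matrix (Fin n) (Fin n) ℍ[ℝ]}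
    {B : Matrix (Fin n) (Fin N) ℍ[ℝ]} {C : Matrix (Fin N) (Fin n) ℍ[ℝ]}
    {D : Matrix (Fin N) (Fin N) ℍ[ℝ]} (hH : H.IsHermitian)
    (hrel : ColligationRelation H J J A B C D)
    (hs : ∀ᶠ p in 𝓝 (0 : ℍ[ℝ]), s p = transferFunction A B C D p) :
    ∃ V, (∃ κ, IsJUnitaryClass J V s κ) ∧
      (Observable C A → IsJUnitaryClass J V s (sqNeg H)) := by
  have hu0 : ∀ᶠ p in 𝓝 (0 : ℍ[ℝ]), IsUnit (pencil A p) :=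
    (isOpen_isUnit_pencil A).mem_nhds (isUnit_pencil_zero A)
  have hb0 : ∀ᶠ p in 𝓝 (0 : ℍ[ℝ]), p ∈ Metric.ball (0 : ℍ[ℝ]) 1 := Metric.ball_mem_nhds _ one_pos
  obtain ⟨V, hVs, hVo, hV0⟩ := mem_nhds_iff.mp (hs.and (hu0.and hb0))
  have hst : ∀ p ∈ V, s p = transferFunction A B C D p := fun p hp => (hVs hp).1
  have hu : ∀ p ∈ V, IsUnit (pencil A p) := fun p hp => (hVs hp).2.1
  have hball : V ⊆ Metric.ball 0 1 := fun p hp => (hVs hp).2.2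
  have hn : ∀ p ∈ V, ‖p‖ < 1 := fun p hp => mem_ball_zero_iff.mp (hball hp)
  have hslice : MatrixSliceHyperholomorphicOn s V :=
    (sliceHyperholomorphic_transferFunction hVo hu B C D).congr hVo hst
  have hker : ∀ p ∈ V, ∀ q ∈ V,
      schurKernel J J s p q = starEval C A p * H * (starEval C A q)ᴴ := fun p hp q hq =>
    schurKernel_eq_of_realization hrel (hn p hp) (hn q hq) (hu p hp) (hu q hq) (hst p hp) (hst q hq)
  have hherm : ∀ p ∈ V, ∀ q ∈ V, schurKernel J J s p q = (schurKernel J J s q p)ᴴ :=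
    fun p hp q hq => by
      rw [hker p hp q hq, hker q hq p hp, Matrix.conjTranspose_mul, Matrix.conjTranspose_mul,
        hH.eq, Matrix.conjTranspose_conjTranspose, Matrix.mul_assoc]
  have hψ : ∀ z ∈ V, ∀ w ∈ V, ∀ c d, star c ⬝ᵥ (schurKernel J J s z w *ᵥ d) =
      matForm H ((starEval C A w)ᴴ *ᵥ d) ((starEval C A z)ᴴ *ᵥ c) := fun z hz w hw c d => by
    rw [hker z hz w hw, ← Matrix.mulVec_mulVec, ← Matrix.mulVec_mulVec, star_dotProduct_mulVec,
      matForm]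
  have hclass : ∀ κ, HasNegativeSquares (schurKernel J J s) V κ → IsJUnitaryClass J V s κ := by
    intro κ hκ
    refine ⟨⟨hJ, hJ, rfl, hVo, hV0, hball, hslice, hκ⟩, ?_⟩
    have : Module.Finite ℍ[ℝ]ᵐᵒᵖ (kernelSpan V (schurKernel J J s)) :=
      finite_kernelSpan (D := Set.univ) (fun p hp => subset_closure ⟨hp, trivial⟩) hherm
        (fun q hq => continuousOn_schurKernel hVo hball hslice (hn q hq))
        fun p hp _ q hq _ => hker p hp q hq
    exact exists_reproducingKernelPontryaginSpace hherm
  refine ⟨V, ?_, fun hobs => hclass _ (hasNegativeSquares_of_span hH hherm hψ ?_)⟩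
  · obtain ⟨κ, hκ⟩ := exists_hasNegativeSquares hH hherm hψ
    exact ⟨κ, hclass κ hκ⟩
  -- A vector orthogonal to every `E(p)*c` is annihilated by every `E(p)`, hence is unobservable and
  -- zero; so these features span `ℍⁿ`.
  · refine ((isHermForm_matForm Matrix.isHermitian_one).finite_and_eq_top_of_orthogonal _
      fun v hv => hobs v fun k => observability_of_starEval hVo hV0 hu k v fun p hp => ?_).2
    refine eq_zero_of_star_dotProduct fun c => ?_
    rw [star_dotProduct_mulVec]
    simpa [matForm] using hv _ (Submodule.subset_span ⟨p, hp, c, rfl⟩)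

end UnitaryClass

end QuatSchur

/-! ### Assembly of the three parts -/

theorem mainTheorem12 :
    -- `P(s)` is finite dimensional iff `s` has a finite dimensional coisometric realization
    (∀ (N M : ℕ) (J₂ : Matrix (Fin N) (Fin N) ℍ[ℝ]) (J₁ : Matrix (Fin M) (Fin M) ℍ[ℝ])
      (V : Set ℍ[ℝ]) (s : ℍ[ℝ] → Matrix (Fin N) (Fin M) ℍ[ℝ]) (κ : ℕ),
      QuatSchur.IsGeneralizedSchur J₂ J₁ V s κ →
      ((∃ R : QuatSchur.ReproducingKernelPontryaginSpace V (QuatSchur.schurKernel J₂ J₁ s),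
          Module.Finite ℍ[ℝ]ᵐᵒᵖ R.carrier) ↔
        QuatSchur.HasFiniteCoisometricRealization J₂ J₁ V s) ∧
      ∀ R : QuatSchur.ReproducingKernelPontryaginSpace V (QuatSchur.schurKernel J₂ J₁ s),
        Module.Finite ℍ[ℝ]ᵐᵒᵖ R.carrier ↔
          QuatSchur.HasFiniteCoisometricRealization J₂ J₁ V s) ∧
    -- matrix realizations of the functions in the classes `U_κ(J)`
    (∀ (N : ℕ) (J : Matrix (Fin N) (Fin N) ℍ[ℝ]), QuatSchur.IsSignature J →
      ∀ s : ℍ[ℝ] → Matrix (Fin N) (Fin N) ℍ[ℝ],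
      ((∃ (κ : ℕ) (V : Set ℍ[ℝ]), QuatSchur.IsJUnitaryClass J V s κ) ↔
        ∃ (n : ℕ) (H A : Matrix (Fin n) (Fin n) ℍ[ℝ]) (B : Matrix (Fin n) (Fin N) ℍ[ℝ])
          (C : Matrix (Fin N) (Fin n) ℍ[ℝ]) (D : Matrix (Fin N) (Fin N) ℍ[ℝ]),
          H.IsHermitian ∧ QuatSchur.ColligationRelation H J J A B C D ∧
          ∀ᶠ p in 𝓝 (0 : ℍ[ℝ]), s p = QuatSchur.transferFunction A B C D p) ∧
      ∀ κ : ℕ, (∃ V : Set ℍ[ℝ], QuatSchur.IsJUnitaryClass J V s κ) ↔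
        ∃ (n : ℕ) (H A : Matrix (Fin n) (Fin n) ℍ[ℝ]) (B : Matrix (Fin n) (Fin N) ℍ[ℝ])
          (C : Matrix (Fin N) (Fin n) ℍ[ℝ]) (D : Matrix (Fin N) (Fin N) ℍ[ℝ]),
          H.IsHermitian ∧ QuatSchur.sqNeg H = κ ∧ QuatSchur.Observable C A ∧
          QuatSchur.ColligationRelation H J J A B C D ∧
          ∀ᶠ p in 𝓝 (0 : ℍ[ℝ]), s p = QuatSchur.transferFunction A B C D p) ∧
    -- the key identity
    (∀ (n N M : ℕ) (J₂ : Matrix (Fin N) (Fin N) ℍ[ℝ]) (J₁ : Matrix (Fin M) (Fin M) ℍ[ℝ])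
      (H A : Matrix (Fin n) (Fin n) ℍ[ℝ]) (B : Matrix (Fin n) (Fin M) ℍ[ℝ])
      (C : Matrix (Fin N) (Fin n) ℍ[ℝ]) (D : Matrix (Fin N) (Fin M) ℍ[ℝ]),
      QuatSchur.ColligationRelation H J₁ J₂ A B C D →
      ∀ p q : ℍ[ℝ], IsUnit (QuatSchur.pencil A p) → IsUnit (QuatSchur.pencil A q) →
        J₂ - QuatSchur.transferFunction A B C D p * J₁ * (QuatSchur.transferFunction A B C D q)ᴴ =
          QuatSchur.starMulRight
            (QuatSchur.starMulRight
              (fun q' => QuatSchur.starMul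
                (QuatSchur.starMul (fun _ => C) (QuatSchur.starResolvent A))
                (fun p' => H - p' • (MulOpposite.op (star q') • H)) p)
              (fun q' => (QuatSchur.starResolvent A q')ᴴ))
            (fun _ => Cᴴ) q) := by 
  refine ⟨fun N M J₂ J₁ V s κ hs => ⟨⟨fun ⟨R, hR⟩ => ?_, fun h => ?_⟩,
      fun R => ⟨fun hR => ?_, fun h => ?_⟩⟩,
    fun N J hJ s => ⟨⟨fun ⟨κ, V, h⟩ => ?_, fun ⟨n, H, A, B, C, D, hH, hrel, hs⟩ => ?_⟩,
      fun κ => ⟨fun ⟨V, h⟩ => h.exists_realization,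
        fun ⟨n, H, A, B, C, D, hH, hκ, hobs, hrel, hs⟩ => ?_⟩⟩,
    fun n N M J₂ J₁ H A B C D hrel p q hp hq => QuatSchur.key_identity hrel hp hq⟩
  · exact QuatSchur.hasFiniteCoisometricRealization_of_finite hs R hR
  · have := QuatSchur.finite_kernelSpan_of_realization hs h
    exact QuatSchur.exists_reproducingKernelPontryaginSpace hs.negativeSquares.1
  · exact QuatSchur.hasFiniteCoisometricRealization_of_finite hs R hR
  · have := QuatSchur.finite_kernelSpan_of_realization hs h
    exact R.finite_of_finite_kernelSpan
  · obtain ⟨n, H, A, B, C, D, hH, -, -, hrel, hs⟩ := h.exists_realization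
    exact ⟨n, H, A, B, C, D, hH, hrel, hs⟩
  · obtain ⟨V, ⟨κ, h⟩, -⟩ := QuatSchur.exists_isJUnitaryClass hJ hH hrel hs
    exact ⟨κ, V, h⟩
  · obtain ⟨V, -, h⟩ := QuatSchur.exists_isJUnitaryClass hJ hH hrel hs
    exact ⟨V, hκ ▸ h hobs⟩
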